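/- Let $n\ge 1$, $T>0$ and let $\sigma\in C^2(\mathbb R^n\setminus\{0\})$ be convex and positively one-homogeneous with $\lambda_-|x|\le\sigma(x)\le\lambda_+|x|$ for all $x\in\mathbb R^n$, where $\lambda_\pm>0$. Let $g\in C(\mathcal S^{n-1}\times\mathbb R)$ be non-decreasing in the second variable and Lipschitz in the second variable with a constant $L_g$ uniform in the first variable. Let $f\in C(\mathbb R^n\times[0,T])$ be bounded and Lipschitz in space with a constant $L_f$ uniform in time, write $\sup|f|$ for the supremum of $|f|$ over $\mathbb R^n\times[0,T]$, and let $G$ be a constant such that $$\sup_{0<r\le 1}\ \sup_{p\in\mathcal S^{n-1}} r\,\Big|g\Big(p,\pm\Big(\frac{n-1}{r}+\sup|f|\Big)\Big)\Big|\le G$$ for both choices of the sign. Let $u\in C(\mathbb R^n\times[0,T])$ be a viscosity solution of $$u_t+|\nabla u|\,g\Big(\frac{\nabla u}{|\nabla u|},\,-\operatorname{div}(\nabla\sigma(\nabla u))+f(x,t)\Big)=0\quad\text{in }\mathbb R^n\times(0,T)$$ (defined by test functions, with the semicontinuous envelopes of the operator where $\nabla u=0$). Assume that $u$ is constant outside $B\times[0,T]$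 for some ball $B$ and that $u(\cdot,0)$ is Lipschitz with constant $L$, and put $M=L_gL_f$. Then $$|u(x,t)-u(x,s)|\le A\,|t-s|^{1/2}\qquad\text{for all }x\in\mathbb R^n,\ t,s\in[0,T],$$ with a constant $A$ depending only on $L$, $M$, $T$, $G$, $\lambda_+$, $\lambda_-$. -/

import Mathlib

open Set Filter Topology

noncomputable section

/-- The Hessian `∇²ψ(x)` of a function on `ℝⁿ`, as a linear operator: the derivative of the
gradient field. -/
def hessian {n : ℕ} (ψ : EuclideanSpace ℝ (Fin n) → ℝ) (x : EuclideanSpace ℝ (Fin n)) :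
    EuclideanSpace ℝ (Fin n) →L[ℝ] EuclideanSpace ℝ (Fin n) :=
  fderiv ℝ (gradient ψ) x

/-- The points `(x, t, p, X)` at which a second order operator is evaluated: position, time,
gradient and Hessian. -/
abbrev JetSpace (n : ℕ) : Type :=
  EuclideanSpace ℝ (Fin n) × ℝ × EuclideanSpace ℝ (Fin n) ×
    (EuclideanSpace ℝ (Fin n) →L[ℝ] EuclideanSpace ℝ (Fin n))

/-- The jets with `p ≠ 0` and `X` symmetric; level set operators are defined only there. -/
def regularJets (n : ℕ) : Set (JetSpace n) :=
  {z | z.2.2.1 ≠ 0 ∧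
    (z.2.2.2 : EuclideanSpace ℝ (Fin n) →ₗ[ℝ] EuclideanSpace ℝ (Fin n)).IsSymmetric}

/-- The level set operator `F(x,t,p,X) = |p| g(p/|p|, -tr(∇²σ(p) X) + f(x,t))`, so that
`F(x,t,∇u,∇²u) = |∇u| g(∇u/|∇u|, -div(∇σ(∇u)) + f(x,t))`. Only its values on `regularJets n`
are used; on these only the values of `g` at unit vectors enter. -/
def levelSetOp {n : ℕ} (σ : EuclideanSpace ℝ (Fin n) → ℝ)
    (g : EuclideanSpace ℝ (Fin n) → ℝ → ℝ) (f : EuclideanSpace ℝ (Fin n) → ℝ → ℝ)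
    (z : JetSpace n) : ℝ :=
  ‖z.2.2.1‖ * g (‖z.2.2.1‖⁻¹ • z.2.2.1)
    (-(LinearMap.trace ℝ (EuclideanSpace ℝ (Fin n))
        ((hessian σ z.2.2.1).comp z.2.2.2 :
          EuclideanSpace ℝ (Fin n) →L[ℝ] EuclideanSpace ℝ (Fin n)).toLinearMap)
      + f z.1 z.2.1)

/-- The lower semicontinuous envelope `F_*` of an operator given on the regular jets, with values
in `[-∞, ∞]`. -/
def lowerEnvelope {n : ℕ} (F : JetSpace n → ℝ) (z : JetSpace n) : EReal :=
  liminf (fun w => (F w : EReal)) (𝓝[regularJets n] z)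

/-- The upper semicontinuous envelope `F^*` of an operator given on the regular jets, with values
in `[-∞, ∞]`. -/
def upperEnvelope {n : ℕ} (F : JetSpace n → ℝ) (z : JetSpace n) : EReal :=
  limsup (fun w => (F w : EReal)) (𝓝[regularJets n] z)

/-- The jet `(x, t, ∇φ(x,t), ∇²φ(x,t))` of a test function (spatial derivatives). -/
def testJet {n : ℕ} (φ : EuclideanSpace ℝ (Fin n) × ℝ → ℝ) (x : EuclideanSpace ℝ (Fin n))
    (t : ℝ) : JetSpace n :=
  (x, t, gradient (fun y => φ (y, t)) x, hessian (fun y => φ (y, t)) x)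

/-- `u` is a viscosity subsolution of `u_t + F(x,t,∇u,∇²u) = 0` in `ℝⁿ × (0,T)`:
`φ_t + F_*(x,t,∇φ,∇²φ) ≤ 0` wherever `u - φ` has a local maximum. -/
def IsViscositySubsolution {n : ℕ} (F : JetSpace n → ℝ) (T : ℝ)
    (u : EuclideanSpace ℝ (Fin n) → ℝ → ℝ) : Prop :=
  UpperSemicontinuousOn (fun z : EuclideanSpace ℝ (Fin n) × ℝ => u z.1 z.2)
      (univ ×ˢ Ioo 0 T) ∧
    ∀ φ : EuclideanSpace ℝ (Fin n) × ℝ → ℝ, ContDiff ℝ 2 φ →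
      ∀ (x : EuclideanSpace ℝ (Fin n)), ∀ t ∈ Ioo 0 T,
        IsLocalMax (fun z : EuclideanSpace ℝ (Fin n) × ℝ => u z.1 z.2 - φ z) (x, t) →
        lowerEnvelope F (testJet φ x t) ≤ ((-deriv (fun s => φ (x, s)) t : ℝ) : EReal)

/-- `u` is a viscosity supersolution of `u_t + F(x,t,∇u,∇²u) = 0` in `ℝⁿ × (0,T)`:
`φ_t + F^*(x,t,∇φ,∇²φ) ≥ 0` wherever `u - φ` has a local minimum. -/
def IsViscositySupersolution {n : ℕ} (F : JetSpace n → ℝ) (T : ℝ)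
    (u : EuclideanSpace ℝ (Fin n) → ℝ → ℝ) : Prop :=
  LowerSemicontinuousOn (fun z : EuclideanSpace ℝ (Fin n) × ℝ => u z.1 z.2)
      (univ ×ˢ Ioo 0 T) ∧
    ∀ φ : EuclideanSpace ℝ (Fin n) × ℝ → ℝ, ContDiff ℝ 2 φ →
      ∀ (x : EuclideanSpace ℝ (Fin n)), ∀ t ∈ Ioo 0 T,
        IsLocalMin (fun z : EuclideanSpace ℝ (Fin n) × ℝ => u z.1 z.2 - φ z) (x, t) →
        ((-deriv (fun s => φ (x, s)) t : ℝ) : EReal) ≤ upperEnvelope F (testJet φ x t)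

/-- Viscosity solutions of `u_t + F(x,t,∇u,∇²u) = 0` in `ℝⁿ × (0,T)`. -/
def IsViscositySolution {n : ℕ} (F : JetSpace n → ℝ) (T : ℝ)
    (u : EuclideanSpace ℝ (Fin n) → ℝ → ℝ) : Prop :=
  IsViscositySubsolution F T u ∧ IsViscositySupersolution F T u

end

/-!
The Hölder estimate in time follows from a Lipschitz estimate in space by comparison with explicit
barriers.

**Lipschitz estimate in space.** With `M = L_g L_f`, the solution satisfies
`|u(x,t) - u(y,t)| ≤ L' e^{M' t} |x - y|` for any `L' ≥ max L 1` and any positive `M' ≥ M`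
(`IsAdmissible.spatial_lipschitz`). Indeed, for `v = e^{-M' t} (u - c)` consider a maximum of
`v(x,t) - v(y,s)` minus a penalty. Degenerate ellipticity cancels the second order terms, the
monotonicity and the Lipschitz bound of `g` reduce the difference of the operators to
`|p| L_g |f(x,t) - f(y,s)|`, and the exponential factor absorbs this. This needs the theorem on
sums, which is derived here from Alexandrov's theorem (by Rademacher's theorem and Sard's lemma for
the resolvent of a subdifferential) and Jensen's lemma. It is used in the symmetric form
`exists_limitSuperjets_of_max`: both functions are penalized by `Θ` against a third point `z`, the
sup-convolutions `sup_x (v(x) - Θ(z - x))` are semiconvex functions of `z`, and the superjets of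
the sup-convolutions are superjets of the original functions. The spatial part of `Θ` is
`l (δ⁴ + |ξ|⁴)^{1/4}`: its gradient has norm at most `l`, and where it vanishes it is flat to
third order, so that the singularity of the operator at `∇u = 0` does no harm.

**Barriers.** Let `σ*` be the convex conjugate of `(σ² + |·|²)/2`. The term `|·|²` makes the
conjugate `C^{1,1}` even if `σ²` is not strictly convex. If `p` is the dual point of `x`, then the
inverse `B` of `σ ∇²σ + ∇σ ⊗ ∇σ + 1` at `p` bounds `σ*` from above to second order at `x`, and
`tr(∇²σ(p) B) ≤ (n - 1) / σ(p)` (`trace_hessian_comp_inverse_le`): the level sets of `σ*` are at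
most as curved as Wulff shapes. By the growth condition on `g`, the function
`k (δ⁴ + 4 σ*(x - x₀)²)^{1/4} + C (t - s)` is a supersolution for `C` of order `1/δ`, and by the
Lipschitz estimate it lies above `u - u(x₀, s)` at time `s` when `k` is a suitable multiple of the
Lipschitz constant. Hence `u(x₀,t) - u(x₀,s) ≤ k δ + C (t - s)` (`IsAdmissible.le_barrier`), and
`δ` proportional to `(t - s)^{1/2}` gives the estimate from above. The estimate from below is the
same one for `-u`, which solves the equation with `σ(-p)`, `-g(-p, -ξ)` and `-f`.
-/

section
open MeasureTheory Module
open scoped InnerProductSpace NNReal ENNReal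

/-! ### Second order differentiability of convex functions -/

/-- `q` is a subgradient of `h` at `z`. -/
def IsSubgradient {H : Type*} [NormedAddCommGroup H] [InnerProductSpace ℝ H]
    (h : H → ℝ) (z q : H) : Prop :=
  ∀ w, h z + ⟪q, w - z⟫_ℝ ≤ h w

/-- `U + C/2 ‖·‖²` is convex; stated through the existence of a supporting paraboloid of opening
`-C` at every point. -/
def IsSemiconvex {H : Type*} [NormedAddCommGroup H] [InnerProductSpace ℝ H]
    (C : ℝ) (U : H → ℝ) : Prop :=
  ∀ z, ∃ q, ∀ w, U z + ⟪q, w - z⟫_ℝ - C / 2 * ‖w - z‖ ^ 2 ≤ U w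

/-- `U` has the second order Taylor expansion `U z + ⟪q, ξ⟫ + ⟪A ξ, ξ⟫ / 2 + o(‖ξ‖²)` at `z`. -/
def HasExpansion {H : Type*} [NormedAddCommGroup H] [InnerProductSpace ℝ H]
    (U : H → ℝ) (z q : H) (A : H →L[ℝ] H) : Prop :=
  ∀ ε > 0, ∀ᶠ ξ in 𝓝 (0 : H), |U (z + ξ) - U z - ⟪q, ξ⟫_ℝ - 1 / 2 * ⟪A ξ, ξ⟫_ℝ| ≤ ε * ‖ξ‖ ^ 2

section convex
variable {H : Type*} [NormedAddCommGroup H] [InnerProductSpace ℝ H]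

lemma IsSubgradient.inner_sub_nonneg {h : H → ℝ} {z z' q q' : H} (hq : IsSubgradient h z q)
    (hq' : IsSubgradient h z' q') : 0 ≤ ⟪q - q', z - z'⟫_ℝ := by
  have h1 := hq z'
  have h2 := hq' z
  have h3 : ⟪q, z' - z⟫_ℝ = - ⟪q, z - z'⟫_ℝ := by rw [← inner_neg_right, neg_sub]
  rw [inner_sub_left]
  linarith

lemma convexOn_of_exists_isSubgradient {h : H → ℝ} (hh : ∀ z, ∃ q, IsSubgradient h z q) :
    ConvexOn ℝ univ h := by
  refine ⟨convex_univ, fun x _ y _ a b ha hb hab => ?_⟩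
  obtain ⟨q, hq⟩ := hh (a • x + b • y)
  have h1 := mul_le_mul_of_nonneg_left (hq x) ha
  have h2 := mul_le_mul_of_nonneg_left (hq y) hb
  have h3 : a * ⟪q, x - (a • x + b • y)⟫_ℝ + b * ⟪q, y - (a • x + b • y)⟫_ℝ = 0 := by
    simp only [inner_sub_right, inner_add_right, inner_smul_right]
    have : b = 1 - a := by linarith
    subst this; ring
  simp only [smul_eq_mul]
  have h4 : a * h (a • x + b • y) + b * h (a • x + b • y) = h (a • x + b • y) := by
    rw [← add_mul, hab, one_mul]
  linarith

lemma IsSubgradient.convex {h : H → ℝ} {z q q' : H} (hq : IsSubgradient h z q)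
    (hq' : IsSubgradient h z q') {t : ℝ} (ht : t ∈ Icc (0 : ℝ) 1) :
    IsSubgradient h z (q + t • (q' - q)) := by
  intro w
  have h1 := mul_le_mul_of_nonneg_left (hq w) (sub_nonneg.2 ht.2)
  have h2 := mul_le_mul_of_nonneg_left (hq' w) ht.1
  simp only [inner_add_left, inner_smul_left, inner_sub_left, RCLike.conj_to_real]
  linarith

/-- A function on `[0, 1]` whose increments are at most `e (t - s) + b (t - s)²` grows by at
most `e`. -/
lemma sub_le_of_increment_le {φ : ℝ → ℝ} {e b : ℝ}
    (hφ : ∀ s t, 0 ≤ s → s ≤ t → t ≤ 1 → φ t - φ s ≤ e * (t - s) + b * (t - s) ^ 2) :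
    φ 1 - φ 0 ≤ e := by
  have key : ∀ m : ℕ, φ 1 - φ 0 ≤ e + b * (1 / ((m : ℝ) + 1)) := by
    intro m
    have hm : (0 : ℝ) < (m : ℝ) + 1 := by positivity
    have h1 : ∑ i ∈ Finset.range (m + 1),
        (φ ((i + 1 : ℕ) / ((m : ℝ) + 1)) - φ ((i : ℕ) / ((m : ℝ) + 1))) = φ 1 - φ 0 := by
      rw [Finset.sum_range_sub (fun i : ℕ => φ ((i : ℝ) / ((m : ℝ) + 1)))]
      push_cast
      rw [div_self hm.ne']; simp
    rw [← h1]
    have h2 : ∀ i ∈ Finset.range (m + 1),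
        φ ((i + 1 : ℕ) / ((m : ℝ) + 1)) - φ ((i : ℕ) / ((m : ℝ) + 1)) ≤
          (e + b * (1 / ((m : ℝ) + 1))) / ((m : ℝ) + 1) := by
      intro i hi
      have hi' : (i : ℝ) + 1 ≤ (m : ℝ) + 1 := by
        have := Finset.mem_range.1 hi
        exact_mod_cast this
      have := hφ ((i : ℝ) / ((m : ℝ) + 1)) ((i + 1 : ℕ) / ((m : ℝ) + 1)) (by positivity)
        (by push_cast; gcongr; linarith) (by push_cast; rw [div_le_one hm]; exact hi')
      refine this.trans (le_of_eq ?_)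
      push_cast
      field_simp
      ring
    refine (Finset.sum_le_sum h2).trans (le_of_eq ?_)
    rw [Finset.sum_const, Finset.card_range, nsmul_eq_mul]
    push_cast
    field_simp
  have h3 : Tendsto (fun m : ℕ => e + b * (1 / ((m : ℝ) + 1))) atTop (𝓝 (e + b * 0)) :=
    tendsto_const_nhds.add (tendsto_const_nhds.mul tendsto_one_div_add_atTop_nhds_zero_nat)
  have := ge_of_tendsto' h3 key
  simpa using this

/-- A first order expansion of the subgradients integrates to a second order expansion of the
function. -/
lemma hasExpansion_of_isSubgradient {h : H → ℝ} (hh : ∀ z, ∃ q, IsSubgradient h z q) {z q : H}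
    {A : H →L[ℝ] H}
    (hA : ∀ ε > 0, ∀ᶠ w in 𝓝 z, ∀ p, IsSubgradient h w p → ‖p - q - A (w - z)‖ ≤ ε * ‖w - z‖) :
    HasExpansion h z q A := by
  intro ε hε
  obtain ⟨r, hr, hball⟩ := Metric.eventually_nhds_iff.1 (hA ε hε)
  refine Metric.eventually_nhds_iff.2 ⟨r, hr, fun ξ hξ => ?_⟩
  rw [dist_zero_right] at hξ
  set φ : ℝ → ℝ := fun t => h (z + t • ξ) - t * ⟪q, ξ⟫_ℝ - t ^ 2 / 2 * ⟪A ξ, ξ⟫_ℝ with hφ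
  have hsub : ∀ t ∈ Icc (0 : ℝ) 1, ∃ p, IsSubgradient h (z + t • ξ) p ∧
      |⟪p, ξ⟫_ℝ - ⟪q, ξ⟫_ℝ - t * ⟪A ξ, ξ⟫_ℝ| ≤ ε * ‖ξ‖ ^ 2 := by
    intro t ht
    obtain ⟨p, hp⟩ := hh (z + t • ξ)
    refine ⟨p, hp, ?_⟩
    have htn : ‖t • ξ‖ ≤ ‖ξ‖ := by
      rw [norm_smul, Real.norm_eq_abs, abs_of_nonneg ht.1]
      exact mul_le_of_le_one_left (norm_nonneg _) ht.2
    have h1 := hball (y := z + t • ξ) (by rw [dist_eq_norm]; simpa using htn.trans_lt hξ) p hp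
    rw [add_sub_cancel_left] at h1
    have h2 : ⟪p, ξ⟫_ℝ - ⟪q, ξ⟫_ℝ - t * ⟪A ξ, ξ⟫_ℝ = ⟪p - q - A (t • ξ), ξ⟫_ℝ := by
      simp [inner_sub_left, inner_smul_left]
    rw [h2]
    refine (abs_real_inner_le_norm _ _).trans ?_
    calc _ ≤ (ε * ‖t • ξ‖) * ‖ξ‖ := by gcongr
      _ ≤ (ε * ‖ξ‖) * ‖ξ‖ := by gcongr
      _ = _ := by ring
  have hst : ∀ s t : ℝ, (z + s • ξ) - (z + t • ξ) = (s - t) • ξ := by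
    intro s t; rw [add_sub_add_left_eq_sub, sub_smul]
  have hb := le_abs_self ⟪A ξ, ξ⟫_ℝ
  have hb' := neg_abs_le ⟪A ξ, ξ⟫_ℝ
  have up : φ 1 - φ 0 ≤ ε * ‖ξ‖ ^ 2 := by
    apply sub_le_of_increment_le (b := |⟪A ξ, ξ⟫_ℝ| / 2)
    intro s t hs hst' ht
    obtain ⟨p, hp, hp2⟩ := hsub t ⟨hs.trans hst', ht⟩
    have h1 := hp (z + s • ξ)
    rw [hst, inner_smul_right] at h1
    have h2 := mul_le_mul_of_nonneg_left (abs_le.1 hp2).2 (sub_nonneg.2 hst')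
    have h3 := mul_le_mul_of_nonneg_left hb (sq_nonneg (t - s))
    simp only [hφ]
    nlinarith
  have down : (-φ 1) - (-φ 0) ≤ ε * ‖ξ‖ ^ 2 := by
    apply sub_le_of_increment_le (φ := fun t => -φ t) (b := |⟪A ξ, ξ⟫_ℝ| / 2)
    intro s t hs hst' ht
    obtain ⟨p, hp, hp2⟩ := hsub s ⟨hs, hst'.trans ht⟩
    have h1 := hp (z + t • ξ)
    rw [hst, inner_smul_right] at h1
    have h2 := mul_le_mul_of_nonneg_left (abs_le.1 hp2).1 (sub_nonneg.2 hst')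
    have h3 := mul_le_mul_of_nonneg_left hb (sq_nonneg (t - s))
    simp only [hφ]
    nlinarith
  have e1 : h (z + ξ) - h z - ⟪q, ξ⟫_ℝ - 1 / 2 * ⟪A ξ, ξ⟫_ℝ = φ 1 - φ 0 := by
    simp [hφ]; ring
  rw [e1, abs_le]
  constructor <;> linarith

variable [FiniteDimensional ℝ H]

lemma continuous_of_exists_isSubgradient {h : H → ℝ} (hh : ∀ z, ∃ q, IsSubgradient h z q) :
    Continuous h :=
  continuousOn_univ.1 ((convexOn_of_exists_isSubgradient hh).continuousOn isOpen_univ)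

/-- Subgradients converge to the unique subgradient at the limit point. -/
lemma eventually_norm_isSubgradient_sub_lt {h : H → ℝ} (hh : ∀ z, ∃ q, IsSubgradient h z q)
    {z q : H} (hq : ∀ p, IsSubgradient h z p → p = q) {ε : ℝ} (hε : 0 < ε) :
    ∀ᶠ w in 𝓝 z, ∀ p, IsSubgradient h w p → ‖p - q‖ < ε := by
  have hc := continuous_of_exists_isSubgradient hh
  -- subgradients are bounded near `z`
  obtain ⟨K, N, hN, hK⟩ : ∃ K : ℝ≥0, ∃ N ∈ 𝓝 z, LipschitzOnWith K h N := by
    have := (convexOn_of_exists_isSubgradient hh).locallyLipschitzOn isOpen_univ (mem_univ z)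
    simpa using this
  have hbd : ∀ᶠ w in 𝓝 z, ∀ p, IsSubgradient h w p → ‖p‖ ≤ K := by
    filter_upwards [eventually_eventually_nhds.2 hN] with w hw p hp
    have hcont : Tendsto (fun t : ℝ => w + t • p) (𝓝[>] 0) (𝓝 w) := by
      have : Continuous fun t : ℝ => w + t • p := by fun_prop
      simpa using (this.tendsto 0).mono_left nhdsWithin_le_nhds
    obtain ⟨t, ht, ht0⟩ := ((hcont.eventually hw).and self_mem_nhdsWithin).exists
    have ht0 : 0 < t := ht0
    have h1 := hp (w + t • p)
    have h2 := hK.dist_le_mul _ ht _ (mem_of_mem_nhds hw)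
    rw [add_sub_cancel_left, inner_smul_right, real_inner_self_eq_norm_sq] at h1
    rw [Real.dist_eq, dist_eq_norm, add_sub_cancel_left, norm_smul, Real.norm_eq_abs,
      abs_of_pos ht0] at h2
    have h3 := (le_abs_self _).trans h2
    by_contra hcon
    push Not at hcon
    have hp0 : 0 < ‖p‖ := K.2.trans_lt hcon
    have : t * ‖p‖ * ‖p‖ ≤ t * ‖p‖ * K := by nlinarith
    have := le_of_mul_le_mul_left this (by positivity)
    linarith
  by_contra hcon
  have hfr : ∃ᶠ w in 𝓝 z, ∃ p, IsSubgradient h w p ∧ ε ≤ ‖p - q‖ := by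
    intro hf
    apply hcon
    filter_upwards [hf] with w hw p hp
    by_contra hlt
    exact hw ⟨p, hp, not_lt.1 hlt⟩
  obtain ⟨w, hw, hw2⟩ := exists_seq_forall_of_frequently (hfr.and_eventually hbd)
  choose p hp using fun k => (hw2 k).1
  have hpb : ∀ k, p k ∈ Metric.closedBall (0 : H) K := fun k => by
    simpa using (hw2 k).2 _ (hp k).1
  obtain ⟨p', -, φ, hφ, hlim⟩ := (isCompact_closedBall (0 : H) K).tendsto_subseq hpb
  have hsub : IsSubgradient h z p' := by
    intro y
    have hwφ := hw.comp hφ.tendsto_atTop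
    have h1 : Tendsto (fun k => h (w (φ k)) + ⟪p (φ k), y - w (φ k)⟫_ℝ) atTop
        (𝓝 (h z + ⟪p', y - z⟫_ℝ)) :=
      ((hc.tendsto z).comp hwφ).add (hlim.inner (tendsto_const_nhds.sub hwφ))
    exact le_of_tendsto' h1 fun k => (hp (φ k)).1 y
  have h2 : Tendsto (fun k => ‖p (φ k) - q‖) atTop (𝓝 ‖p' - q‖) := (hlim.sub_const q).norm
  have h3 := ge_of_tendsto' h2 fun k => (hp (φ k)).2
  rw [hq p' hsub, sub_self, norm_zero] at h3
  linarith

/-- The pointwise step in Alexandrov's theorem: if the resolvent `J = (1 + ∂h)⁻¹`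
is differentiable at `z + q` with invertible derivative, then `h` is twice differentiable
at `z`. -/
lemma exists_hasExpansion_of_resolvent {h : H → ℝ} (hh : ∀ z, ∃ q, IsSubgradient h z q)
    {J : H → H} (hJ : ∀ z q, IsSubgradient h z q → J (z + q) = z) {z q : H}
    (hq : IsSubgradient h z q) {B : H →L[ℝ] H} (hB : HasFDerivAt J B (z + q)) (hdet : B.det ≠ 0) :
    ∃ A : H →L[ℝ] H, HasExpansion h z q A := by
  obtain ⟨B', hB'⟩ : ∃ B' : H ≃L[ℝ] H, (B' : H →L[ℝ] H) = B :=
    ⟨B.toContinuousLinearEquivOfDetNeZero hdet, by ext; simp⟩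
  have hinj : ∀ v, B v = 0 → v = 0 := by
    intro v hv
    rw [← hB'] at hv
    simpa using hv
  have huniq : ∀ p, IsSubgradient h z p → p = q := by
    intro p hp
    have h1 : HasDerivAt (fun t : ℝ => J ((z + q) + t • (p - q))) (B (p - q)) 0 := by
      have h2 : HasDerivAt (fun t : ℝ => (z + q) + t • (p - q)) (p - q) 0 := by
        simpa using ((hasDerivAt_id (0 : ℝ)).smul_const (p - q)).const_add (z + q)
      have hB2 : HasFDerivAt J B ((z + q) + (0 : ℝ) • (p - q)) := by simpa using hB
      exact hB2.comp_hasDerivAt (0 : ℝ) h2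
    have h3 : HasDerivWithinAt (fun t : ℝ => J ((z + q) + t • (p - q))) 0 (Icc 0 1) 0 := by
      refine (hasDerivWithinAt_const (0 : ℝ) (Icc (0 : ℝ) 1) z).congr_of_mem (fun t ht => ?_)
        (by simp)
      have := hJ z _ (hq.convex hp ht)
      rwa [← add_assoc] at this
    have h4 := (uniqueDiffOn_Icc (zero_lt_one' ℝ) 0 (by simp)).eq_deriv _ h1.hasDerivWithinAt h3
    exact sub_eq_zero.1 (hinj _ h4)
  refine ⟨(B'.symm : H →L[ℝ] H) - ContinuousLinearMap.id ℝ H,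
    hasExpansion_of_isSubgradient hh fun ε hε => ?_⟩
  set c : ℝ := ‖(B'.symm : H →L[ℝ] H)‖ + 1 with hc
  have hc0 : 0 < c := by positivity
  have hcb : ∀ v, ‖B'.symm v‖ ≤ c * ‖v‖ := fun v =>
    ((B'.symm : H →L[ℝ] H).le_opNorm v).trans (by gcongr; linarith)
  -- `e` is chosen so that `c e ≤ 1 / 2` and `2 c² e ≤ ε`
  set e : ℝ := min (1 / (2 * c)) (ε / (2 * c ^ 2)) with he
  have he0 : 0 < e := by positivity
  have he1 : c * e ≤ 1 / 2 := by
    calc c * e ≤ c * (1 / (2 * c)) := by gcongr; exact min_le_left _ _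
      _ = 1 / 2 := by field_simp
  have he2 : 2 * c ^ 2 * e ≤ ε := by
    calc 2 * c ^ 2 * e ≤ 2 * c ^ 2 * (ε / (2 * c ^ 2)) := by gcongr; exact min_le_right _ _
      _ = ε := by field_simp
  have hlo := (hasFDerivAt_iff_isLittleO_nhds_zero.1 hB).bound he0
  obtain ⟨r, hr, hr2⟩ := Metric.eventually_nhds_iff.1 hlo
  have hnear : ∀ᶠ w in 𝓝 z, ‖w - z‖ < r / 2 := by
    have : Tendsto (fun w => ‖w - z‖) (𝓝 z) (𝓝 0) := tendsto_norm_sub_self z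
    exact this.eventually (gt_mem_nhds (by positivity))
  filter_upwards [eventually_norm_isSubgradient_sub_lt hh huniq (half_pos hr), hnear]
    with w hw hwz p hp
  set η := (w + p) - (z + q) with hη
  have hηr : dist η 0 < r := by
    rw [dist_zero_right]
    have : η = (w - z) + (p - q) := by rw [hη]; abel
    rw [this]
    refine (norm_add_le _ _).trans_lt ?_
    have := hw p hp
    linarith
  have h1 := hr2 hηr
  have h2 : z + q + η = w + p := by rw [hη]; abel
  rw [h2, hJ w p hp, hJ z q hq] at h1
  have h3 : p - q - ((B'.symm : H →L[ℝ] H) - ContinuousLinearMap.id ℝ H) (w - z) =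
      - B'.symm (w - z - B η) := by
    have : B'.symm (B η) = η := by rw [← hB']; simp
    simp only [_root_.sub_apply, map_sub, ContinuousLinearMap.id_apply, this]
    simp [hη]
    abel
  have h4 : ‖η‖ ≤ 2 * c * ‖w - z‖ := by
    have e1 : η = B'.symm (w - z) - B'.symm (w - z - B η) := by
      have : B'.symm (B η) = η := by rw [← hB']; simp
      rw [← map_sub, sub_sub_cancel, this]
    have e2 : ‖η‖ ≤ c * ‖w - z‖ + c * (e * ‖η‖) := by
      calc ‖η‖ = ‖B'.symm (w - z) - B'.symm (w - z - B η)‖ := by rw [← e1]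
        _ ≤ ‖B'.symm (w - z)‖ + ‖B'.symm (w - z - B η)‖ := norm_sub_le _ _
        _ ≤ c * ‖w - z‖ + c * ‖w - z - B η‖ := add_le_add (hcb _) (hcb _)
        _ ≤ _ := by gcongr
    have e3 : c * (e * ‖η‖) ≤ 1 / 2 * ‖η‖ := by
      rw [← mul_assoc]; gcongr
    linarith
  rw [h3, norm_neg]
  calc ‖B'.symm (w - z - B η)‖ ≤ c * ‖w - z - B η‖ := hcb _
    _ ≤ c * (e * (2 * c * ‖w - z‖)) := by gcongr; exact h1.trans (by gcongr)
    _ = (2 * c ^ 2 * e) * ‖w - z‖ := by ring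
    _ ≤ ε * ‖w - z‖ := by gcongr

/-- **Alexandrov's theorem** for convex functions. The resolvent `(1 + ∂h)⁻¹` is `1`-Lipschitz, so
by Rademacher's theorem and Sard's lemma almost every point is the image of a point where it has an
invertible derivative. -/
lemma ae_exists_hasExpansion_of_isSubgradient [MeasurableSpace H] [BorelSpace H] {h : H → ℝ}
    (hh : ∀ z, ∃ q, IsSubgradient h z q) :
    ∀ᵐ z ∂(μH[finrank ℝ H] : Measure H), ∃ (q : H) (A : H →L[ℝ] H), HasExpansion h z q A := by
  set D : Set H := {x | ∃ z, IsSubgradient h z (x - z)} with hD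
  choose! J₀ hJ₀ using fun x (hx : x ∈ D) => hx
  have hlip : LipschitzOnWith 1 J₀ D := by
    refine LipschitzOnWith.of_dist_le_mul fun x hx y hy => ?_
    have h1 := (hJ₀ x hx).inner_sub_nonneg (hJ₀ y hy)
    have h2 : x - J₀ x - (y - J₀ y) = (x - y) - (J₀ x - J₀ y) := by abel
    rw [h2, inner_sub_left, real_inner_self_eq_norm_sq] at h1
    have h3 := real_inner_le_norm (x - y) (J₀ x - J₀ y)
    rw [dist_eq_norm, dist_eq_norm, NNReal.coe_one, one_mul]
    by_contra hcon
    push Not at hcon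
    nlinarith [norm_nonneg (x - y), norm_nonneg (J₀ x - J₀ y)]
  obtain ⟨J, hJlip, hJeq⟩ := hlip.extend_finite_dimension
  have hJ : ∀ z q, IsSubgradient h z q → J (z + q) = z := by
    intro z q hq
    have hmem : z + q ∈ D := ⟨z, by simpa using hq⟩
    rw [← hJeq hmem]
    have h1 := (hJ₀ _ hmem).inner_sub_nonneg hq
    have h2 : z + q - J₀ (z + q) - q = - (J₀ (z + q) - z) := by abel
    rw [h2, inner_neg_left, real_inner_self_eq_norm_sq] at h1
    have h3 : ‖J₀ (z + q) - z‖ = 0 := by nlinarith [norm_nonneg (J₀ (z + q) - z)]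
    exact sub_eq_zero.1 (norm_eq_zero.1 h3)
  set μ : Measure H := μH[finrank ℝ H] with hμ
  set N : Set H := {x | ¬ DifferentiableAt ℝ J x} with hN
  set S : Set H := {x | DifferentiableAt ℝ J x ∧ (fderiv ℝ J x).det = 0} with hS
  have hN0 : μ N = 0 := hJlip.ae_differentiableAt
  have hN1 : μ (J '' N) = 0 := by
    have := hJlip.hausdorffMeasure_image_le (d := finrank ℝ H) (by positivity) N
    rw [← hμ, hN0, mul_zero] at this
    exact nonpos_iff_eq_zero.1 this
  have hS1 : μ (J '' S) = 0 :=
    addHaar_image_eq_zero_of_det_fderivWithin_eq_zero μ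
      (fun x hx => hx.1.hasFDerivAt.hasFDerivWithinAt) (fun x hx => hx.2)
  have hall := (measure_eq_zero_iff_ae_notMem.1 hN1).and (measure_eq_zero_iff_ae_notMem.1 hS1)
  filter_upwards [hall] with z hz
  obtain ⟨q, hq⟩ := hh z
  have hzJ := hJ z q hq
  have hdiff : DifferentiableAt ℝ J (z + q) := by
    by_contra hcon
    exact hz.1 ⟨z + q, hcon, hzJ⟩
  have hdet : (fderiv ℝ J (z + q)).det ≠ 0 := fun hcon => hz.2 ⟨z + q, ⟨hdiff, hcon⟩, hzJ⟩
  obtain ⟨A, hA⟩ := exists_hasExpansion_of_resolvent hh hJ hq hdiff.hasFDerivAt hdet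
  exact ⟨q, A, hA⟩

end convex
end

section
open MeasureTheory Module
open scoped InnerProductSpace NNReal ENNReal

/-! ### Maxima of sums of semiconvex functions -/

section sums
variable {H : Type*} [NormedAddCommGroup H] [InnerProductSpace ℝ H]

lemma IsSemiconvex.isSubgradient_add_sq {C : ℝ} {U : H → ℝ} {z q : H}
    (hq : ∀ w, U z + ⟪q, w - z⟫_ℝ - C / 2 * ‖w - z‖ ^ 2 ≤ U w) :
    IsSubgradient (fun w => U w + C / 2 * ‖w‖ ^ 2) z (q + C • z) := by
  intro w
  have h1 := hq w
  have h2 : ‖w‖ ^ 2 = ‖z‖ ^ 2 + 2 * ⟪z, w - z⟫_ℝ + ‖w - z‖ ^ 2 := by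
    rw [← norm_add_sq_real]; simp
  simp only [inner_add_left, inner_smul_left, RCLike.conj_to_real]
  rw [h2]
  linarith

lemma IsSemiconvex.exists_isSubgradient {C : ℝ} {U : H → ℝ} (hU : IsSemiconvex C U) (z : H) :
    ∃ q, IsSubgradient (fun w => U w + C / 2 * ‖w‖ ^ 2) z q := by
  obtain ⟨q, hq⟩ := hU z
  exact ⟨_, IsSemiconvex.isSubgradient_add_sq hq⟩

lemma IsSemiconvex.add {C D : ℝ} {U V : H → ℝ} (hU : IsSemiconvex C U) (hV : IsSemiconvex D V) :
    IsSemiconvex (C + D) (fun w => U w + V w) := by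
  intro z
  obtain ⟨q, hq⟩ := hU z
  obtain ⟨p, hp⟩ := hV z
  refine ⟨q + p, fun w => ?_⟩
  have := hq w
  have := hp w
  rw [inner_add_left]
  linarith

lemma isSemiconvex_neg_mul_norm_sub_sq (η : ℝ) (z₀ : H) :
    IsSemiconvex (2 * η) (fun w => -(η * ‖w - z₀‖ ^ 2)) := by
  intro z
  refine ⟨-(2 * η) • (z - z₀), fun w => ?_⟩
  have h2 : ‖w - z₀‖ ^ 2 = ‖z - z₀‖ ^ 2 + 2 * ⟪z - z₀, w - z⟫_ℝ + ‖w - z‖ ^ 2 := by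
    rw [← norm_add_sq_real]; simp
  simp only [inner_smul_left, RCLike.conj_to_real]
  rw [h2]
  linarith

lemma IsSemiconvex.continuous [FiniteDimensional ℝ H] {C : ℝ} {U : H → ℝ}
    (hU : IsSemiconvex C U) : Continuous U := by
  have h1 := continuous_of_exists_isSubgradient hU.exists_isSubgradient
  have h2 : U = fun w => (U w + C / 2 * ‖w‖ ^ 2) - C / 2 * ‖w‖ ^ 2 := by ext; ring
  rw [h2]
  fun_prop

/-- A paraboloid below and a paraboloid above that touch have the same slope. -/
lemma eq_of_le_paraboloid {C D : ℝ} {z p q : H}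
    (h : ∀ w, ⟪q, w - z⟫_ℝ - C / 2 * ‖w - z‖ ^ 2 ≤ ⟪p, w - z⟫_ℝ + D / 2 * ‖w - z‖ ^ 2) :
    q = p := by
  have h1 : ∀ s : ℝ, 0 < s → ‖q - p‖ ^ 2 ≤ s * ((|C| + |D|) / 2 * ‖q - p‖ ^ 2) := by
    intro s hs
    have h2 := h (z + s • (q - p))
    rw [add_sub_cancel_left, inner_smul_right, inner_smul_right, norm_smul, mul_pow,
      Real.norm_eq_abs, sq_abs] at h2
    have h3 : ⟪q, q - p⟫_ℝ - ⟪p, q - p⟫_ℝ = ‖q - p‖ ^ 2 := by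
      rw [← inner_sub_left, real_inner_self_eq_norm_sq]
    have h4 : s * ‖q - p‖ ^ 2 ≤ s * (s * ((|C| + |D|) / 2 * ‖q - p‖ ^ 2)) := by
      have := mul_le_mul_of_nonneg_right (le_abs_self C) (by positivity : 0 ≤ s ^ 2 * ‖q - p‖ ^ 2)
      have := mul_le_mul_of_nonneg_right (le_abs_self D) (by positivity : 0 ≤ s ^ 2 * ‖q - p‖ ^ 2)
      have e : s * ⟪q, q - p⟫_ℝ - s * ⟪p, q - p⟫_ℝ = s * ‖q - p‖ ^ 2 := by rw [← h3]; ring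
      linarith
    exact le_of_mul_le_mul_left h4 hs
  have h2 : Tendsto (fun s : ℝ => s * ((|C| + |D|) / 2 * ‖q - p‖ ^ 2)) (𝓝[>] 0) (𝓝 0) := by
    have : Continuous fun s : ℝ => s * ((|C| + |D|) / 2 * ‖q - p‖ ^ 2) := by fun_prop
    simpa using (this.tendsto 0).mono_left nhdsWithin_le_nhds
  have h3 : ‖q - p‖ ^ 2 ≤ 0 := ge_of_tendsto h2 (by
    filter_upwards [self_mem_nhdsWithin] with s hs using h1 s hs)
  have h4 : ‖q - p‖ = 0 := by nlinarith [norm_nonneg (q - p)]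
  exact sub_eq_zero.1 (norm_eq_zero.1 h4)

lemma HasExpansion.neg {U : H → ℝ} {z q : H} {A : H →L[ℝ] H} (h : HasExpansion U z q A) :
    HasExpansion (fun w => -U w) z (-q) (-A) := by
  intro ε hε
  filter_upwards [h ε hε] with ξ hξ
  rw [← abs_neg]
  convert hξ using 2
  simp; ring

lemma HasExpansion.add {U V : H → ℝ} {z q p : H} {A B : H →L[ℝ] H} (hU : HasExpansion U z q A)
    (hV : HasExpansion V z p B) : HasExpansion (fun w => U w + V w) z (q + p) (A + B) := by
  intro ε hε
  filter_upwards [hU (ε / 2) (half_pos hε), hV (ε / 2) (half_pos hε)] with ξ h1 h2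
  have e : U (z + ξ) + V (z + ξ) - (U z + V z) - ⟪q + p, ξ⟫_ℝ - 1 / 2 * ⟪(A + B) ξ, ξ⟫_ℝ =
      (U (z + ξ) - U z - ⟪q, ξ⟫_ℝ - 1 / 2 * ⟪A ξ, ξ⟫_ℝ) +
      (V (z + ξ) - V z - ⟪p, ξ⟫_ℝ - 1 / 2 * ⟪B ξ, ξ⟫_ℝ) := by
    simp only [inner_add_left, _root_.add_apply]; ring
  rw [e]
  refine (abs_add_le _ _).trans ?_
  linarith

lemma hasExpansion_mul_norm_sub_sq (c : ℝ) (z₀ z : H) :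
    HasExpansion (fun w => c / 2 * ‖w - z₀‖ ^ 2) z (c • (z - z₀))
      (c • ContinuousLinearMap.id ℝ H) := by
  intro ε hε
  refine Eventually.of_forall fun ξ => ?_
  have e : c / 2 * ‖z + ξ - z₀‖ ^ 2 - c / 2 * ‖z - z₀‖ ^ 2 - ⟪c • (z - z₀), ξ⟫_ℝ -
      1 / 2 * ⟪(c • ContinuousLinearMap.id ℝ H) ξ, ξ⟫_ℝ = 0 := by
    have : z + ξ - z₀ = (z - z₀) + ξ := by abel
    rw [this, norm_add_sq_real]
    simp [inner_smul_left]
    ring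
  rw [e, abs_zero]; positivity

/-- A function below a paraboloid touching at `z` has its slope and a smaller Hessian there. -/
lemma HasExpansion.le_of_le {W : H → ℝ} {z q p : H} {A : H →L[ℝ] H} {c : ℝ}
    (hW : HasExpansion W z q A) (h : ∀ w, W w ≤ W z + ⟪p, w - z⟫_ℝ + c / 2 * ‖w - z‖ ^ 2) :
    q = p ∧ ∀ ξ, ⟪A ξ, ξ⟫_ℝ ≤ c * ‖ξ‖ ^ 2 := by
  have hscale : ∀ (ξ : H) (ε : ℝ), 0 < ε → ∀ᶠ t in 𝓝[>] (0 : ℝ),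
      ⟪q - p, ξ⟫_ℝ ≤ t * ((c / 2 + ε) * ‖ξ‖ ^ 2 - 1 / 2 * ⟪A ξ, ξ⟫_ℝ) := by
    intro ξ ε hε
    have ht : Tendsto (fun t : ℝ => t • ξ) (𝓝[>] 0) (𝓝 0) := by
      have : Continuous fun t : ℝ => t • ξ := by fun_prop
      simpa using (this.tendsto 0).mono_left nhdsWithin_le_nhds
    filter_upwards [ht.eventually (hW ε hε), self_mem_nhdsWithin] with t h1 ht0
    have ht0 : 0 < t := ht0
    have h2 := (abs_le.1 h1).1
    have h3 := h (z + t • ξ)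
    rw [add_sub_cancel_left] at h3
    simp only [map_smul, inner_smul_left, inner_smul_right, RCLike.conj_to_real, norm_smul,
      mul_pow, Real.norm_eq_abs, sq_abs] at h2 h3
    rw [inner_sub_left]
    refine le_of_mul_le_mul_left ?_ ht0
    nlinarith
  have hqp : q = p := by
    have h1 := hscale (q - p) 1 one_pos
    rw [real_inner_self_eq_norm_sq] at h1
    set k := ((c / 2 + 1) * ‖q - p‖ ^ 2 - 1 / 2 * ⟪A (q - p), q - p⟫_ℝ)
    have h2 : Tendsto (fun s : ℝ => s * k) (𝓝[>] 0) (𝓝 0) := by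
      have : Continuous fun s : ℝ => s * k := by fun_prop
      simpa using (this.tendsto 0).mono_left nhdsWithin_le_nhds
    have h3 : ‖q - p‖ ^ 2 ≤ 0 := ge_of_tendsto h2 h1
    have h4 : ‖q - p‖ = 0 := by nlinarith [norm_nonneg (q - p)]
    exact sub_eq_zero.1 (norm_eq_zero.1 h4)
  refine ⟨hqp, fun ξ => ?_⟩
  have h1 : ∀ ε > 0, ⟪A ξ, ξ⟫_ℝ ≤ c * ‖ξ‖ ^ 2 + ε * (2 * ‖ξ‖ ^ 2) := by
    intro ε hε
    obtain ⟨t, ht, ht0⟩ := ((hscale ξ ε hε).and self_mem_nhdsWithin).exists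
    have ht0 : 0 < t := ht0
    rw [hqp, sub_self, inner_zero_left] at ht
    have := nonneg_of_mul_nonneg_right ht ht0
    linarith
  have h2 : Tendsto (fun ε : ℝ => c * ‖ξ‖ ^ 2 + ε * (2 * ‖ξ‖ ^ 2)) (𝓝[>] 0)
      (𝓝 (c * ‖ξ‖ ^ 2)) := by
    have : Continuous fun s : ℝ => c * ‖ξ‖ ^ 2 + s * (2 * ‖ξ‖ ^ 2) := by fun_prop
    simpa using (this.tendsto 0).mono_left nhdsWithin_le_nhds
  exact ge_of_tendsto h2 (by filter_upwards [self_mem_nhdsWithin] with s hs using h1 s hs)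

lemma HasExpansion.ge_of_ge {W : H → ℝ} {z q p : H} {A : H →L[ℝ] H} {c : ℝ}
    (hW : HasExpansion W z q A) (h : ∀ w, W z + ⟪p, w - z⟫_ℝ - c / 2 * ‖w - z‖ ^ 2 ≤ W w) :
    q = p ∧ ∀ ξ, -(c * ‖ξ‖ ^ 2) ≤ ⟪A ξ, ξ⟫_ℝ := by
  have h1 := hW.neg.le_of_le (p := -p) (c := c) (fun w => by
    have := h w; rw [inner_neg_left]; linarith)
  refine ⟨neg_injective h1.1, fun ξ => ?_⟩
  have := h1.2 ξ
  simp only [_root_.neg_apply, inner_neg_left] at this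
  linarith

/-- Quadratic forms bounded by `c ‖ξ‖²` come from operators of norm at most `c`. -/
lemma norm_le_of_isSymmetric_of_abs_inner_le {A : H →L[ℝ] H}
    (hA : (A : H →ₗ[ℝ] H).IsSymmetric) {c : ℝ} (hc : 0 < c)
    (h : ∀ ξ, |⟪A ξ, ξ⟫_ℝ| ≤ c * ‖ξ‖ ^ 2) : ‖A‖ ≤ c := by
  refine A.opNorm_le_bound hc.le fun x => ?_
  have hs : ⟪A (A x), x⟫_ℝ = ‖A x‖ ^ 2 := by
    have := hA (A x) x
    simp only [ContinuousLinearMap.coe_coe] at this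
    rw [this, real_inner_self_eq_norm_sq]
  have h1 := (abs_le.1 (h (x + c⁻¹ • A x))).2
  have h2 := (abs_le.1 (h (x - c⁻¹ • A x))).1
  have h3 : ‖x + c⁻¹ • A x‖ ^ 2 + ‖x - c⁻¹ • A x‖ ^ 2 =
      2 * ‖x‖ ^ 2 + 2 * (c⁻¹) ^ 2 * ‖A x‖ ^ 2 := by
    rw [norm_add_sq_real, norm_sub_sq_real, norm_smul, Real.norm_eq_abs, mul_pow, sq_abs]; ring
  have h4 : ⟪A (x + c⁻¹ • A x), x + c⁻¹ • A x⟫_ℝ - ⟪A (x - c⁻¹ • A x), x - c⁻¹ • A x⟫_ℝ =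
      4 * c⁻¹ * ‖A x‖ ^ 2 := by
    simp only [map_add, map_sub, map_smul, inner_add_left, inner_add_right, inner_sub_left,
      inner_sub_right, inner_smul_left, inner_smul_right, RCLike.conj_to_real, hs,
      real_inner_self_eq_norm_sq]
    ring
  have h5 : 4 * c⁻¹ * ‖A x‖ ^ 2 ≤ c * (2 * ‖x‖ ^ 2 + 2 * (c⁻¹) ^ 2 * ‖A x‖ ^ 2) := by
    rw [← h4, ← h3]; linarith
  have h6 : ‖A x‖ ^ 2 ≤ (c * ‖x‖) ^ 2 := by
    have h7 := mul_le_mul_of_nonneg_left h5 hc.le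
    have e1 : c * (4 * c⁻¹ * ‖A x‖ ^ 2) = 4 * ‖A x‖ ^ 2 := by field_simp
    have e2 : c * (c * (2 * ‖x‖ ^ 2 + 2 * c⁻¹ ^ 2 * ‖A x‖ ^ 2)) =
      2 * (c * ‖x‖) ^ 2 + 2 * ‖A x‖ ^ 2 := by field_simp
    rw [e1, e2] at h7
    linarith
  exact (sq_le_sq₀ (norm_nonneg _) (by positivity)).1 h6

variable [FiniteDimensional ℝ H]

/-- **Alexandrov's theorem** for semiconvex functions. -/
lemma IsSemiconvex.ae_exists_hasExpansion [MeasurableSpace H] [BorelSpace H] {C : ℝ} {U : H → ℝ}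
    (hU : IsSemiconvex C U) :
    ∀ᵐ z ∂(μH[finrank ℝ H] : Measure H), ∃ (q : H) (A : H →L[ℝ] H),
      (A : H →ₗ[ℝ] H).IsSymmetric ∧ HasExpansion U z q A := by
  have : CompleteSpace H := FiniteDimensional.complete ℝ H
  filter_upwards [ae_exists_hasExpansion_of_isSubgradient hU.exists_isSubgradient] with z hz
  obtain ⟨q, A, hA⟩ := hz
  have h1 := hA.add (hasExpansion_mul_norm_sub_sq (-C) 0 z)
  have h2 : (fun w => U w + C / 2 * ‖w‖ ^ 2 + -C / 2 * ‖w - 0‖ ^ 2) = U := by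
    ext w; rw [sub_zero]; ring
  rw [h2] at h1
  set B := A + -C • ContinuousLinearMap.id ℝ H
  refine ⟨q + -C • (z - 0), (1 / 2 : ℝ) • (B + ContinuousLinearMap.adjoint B), fun x y => ?_,
    fun ε hε => ?_⟩
  · simp only [ContinuousLinearMap.coe_coe, _root_.smul_apply, _root_.add_apply,
      inner_smul_left, inner_smul_right, inner_add_left, inner_add_right,
      ContinuousLinearMap.adjoint_inner_left, ContinuousLinearMap.adjoint_inner_right]
    simp only [RCLike.conj_to_real]
    ring
  · filter_upwards [h1 ε hε] with ξ hξ
    convert hξ using 4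
    simp only [_root_.smul_apply, _root_.add_apply, inner_smul_left, inner_add_left,
      ContinuousLinearMap.adjoint_inner_left, RCLike.conj_to_real]
    rw [real_inner_comm (B ξ) ξ]
    ring

/-- **Jensen's lemma**: the points at which a semiconvex function with a strict maximum is touched
from above by planes of small slope form a set of positive measure, because the slope is a Lipschitz
function of the touching point and takes all small values. -/
lemma IsSemiconvex.measure_contact_ne_zero [MeasurableSpace H] [BorelSpace H] {C : ℝ} (hC : 0 < C)
    {W : H → ℝ} (hW : IsSemiconvex C W) {z₀ : H} {η : ℝ} (hη : 0 < η)
    (hmax : ∀ w, W w ≤ W z₀ - η * ‖w - z₀‖ ^ 2) {δ : ℝ} (hδ : 0 < δ) :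
    (μH[finrank ℝ H] : Measure H) {z | ∃ p, ‖p‖ ≤ δ ∧ ∀ w, W w ≤ W z + ⟪p, w - z⟫_ℝ} ≠ 0 := by
  set K := {z | ∃ p, ‖p‖ ≤ δ ∧ ∀ w, W w ≤ W z + ⟪p, w - z⟫_ℝ} with hK
  have hcont := hW.continuous
  choose! P hPδ hP using fun z (hz : z ∈ K) => hz
  have hsemi : ∀ z ∈ K, ∀ p, (∀ w, W w ≤ W z + ⟪p, w - z⟫_ℝ) →
      ∀ w, W z + ⟪p, w - z⟫_ℝ - C / 2 * ‖w - z‖ ^ 2 ≤ W w := by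
    intro z hz p hp w
    obtain ⟨q, hq⟩ := hW z
    have : q = p := eq_of_le_paraboloid (z := z) (C := C) (D := 0) fun w => by
      have := hq w; have := hp w; linarith
    rw [← this]; exact hq w
  have hlip : LipschitzOnWith C.toNNReal P K := by
    refine LipschitzOnWith.of_dist_le_mul fun x hx y hy => ?_
    rw [Real.coe_toNNReal _ hC.le, dist_comm, dist_comm x y, dist_eq_norm, dist_eq_norm]
    have h1 := hsemi y hy _ (hP y hy) (y + C⁻¹ • (P y - P x))
    have h2 := hP x hx (y + C⁻¹ • (P y - P x))
    have h3 := hsemi x hx _ (hP x hx) y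
    have e1 : y + C⁻¹ • (P y - P x) - x = (y - x) + C⁻¹ • (P y - P x) := by abel
    rw [add_sub_cancel_left, inner_smul_right, norm_smul, mul_pow, Real.norm_eq_abs, sq_abs] at h1
    rw [e1, inner_add_right, inner_smul_right] at h2
    have h4 : ⟪P y, P y - P x⟫_ℝ - ⟪P x, P y - P x⟫_ℝ = ‖P y - P x‖ ^ 2 := by
      rw [← inner_sub_left, real_inner_self_eq_norm_sq]
    have h5 : C⁻¹ * ‖P y - P x‖ ^ 2 ≤
        C / 2 * (C⁻¹ ^ 2 * ‖P y - P x‖ ^ 2) + C / 2 * ‖y - x‖ ^ 2 := by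
      have e : C⁻¹ * ⟪P y, P y - P x⟫_ℝ - C⁻¹ * ⟪P x, P y - P x⟫_ℝ = C⁻¹ * ‖P y - P x‖ ^ 2 := by
        rw [← h4]; ring
      linarith
    have h6 := mul_le_mul_of_nonneg_left h5 hC.le
    have e2 : C * (C⁻¹ * ‖P y - P x‖ ^ 2) = ‖P y - P x‖ ^ 2 := by field_simp
    have e3 : C * (C / 2 * (C⁻¹ ^ 2 * ‖P y - P x‖ ^ 2) + C / 2 * ‖y - x‖ ^ 2) =
      1 / 2 * ‖P y - P x‖ ^ 2 + 1 / 2 * (C * ‖y - x‖) ^ 2 := by field_simp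
    rw [e2, e3] at h6
    exact (sq_le_sq₀ (norm_nonneg _) (by positivity)).1 (by linarith)
  have honto : Metric.closedBall (0 : H) δ ⊆ P '' K := by
    intro p hp
    rw [mem_closedBall_zero_iff] at hp
    set R := ‖p‖ / η
    obtain ⟨z, hz, hzmax⟩ := (isCompact_closedBall z₀ R).exists_isMaxOn
      ⟨z₀, Metric.mem_closedBall_self (by positivity)⟩
      (f := fun w => W w - ⟪p, w - z₀⟫_ℝ) (by fun_prop)
    have hz0 := hzmax (Metric.mem_closedBall_self (by positivity) : z₀ ∈ Metric.closedBall z₀ R)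
    have hcontact : ∀ w, W w ≤ W z + ⟪p, w - z⟫_ℝ := by
      intro w
      have e : ⟪p, w - z⟫_ℝ = ⟪p, w - z₀⟫_ℝ - ⟪p, z - z₀⟫_ℝ := by
        rw [← inner_sub_right]; congr 1; abel
      rw [e]
      by_cases hw : w ∈ Metric.closedBall z₀ R
      · have := hzmax hw
        simp only [mem_ofPred_eq] at this
        linarith
      · simp only [mem_ofPred_eq, sub_self, inner_zero_right, sub_zero] at hz0
        rw [Metric.mem_closedBall, not_le, dist_eq_norm, div_lt_iff₀ hη] at hw
        have h1 := hmax w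
        have h2 := (abs_le.1 (abs_real_inner_le_norm p (w - z₀))).1
        have h3 : ‖p‖ * ‖w - z₀‖ ≤ η * ‖w - z₀‖ ^ 2 := by nlinarith [norm_nonneg (w - z₀)]
        linarith
    have hzK : z ∈ K := ⟨p, hp, hcontact⟩
    refine ⟨z, hzK, ?_⟩
    refine eq_of_le_paraboloid (z := z) (C := C) (D := 0) fun w => ?_
    have := hsemi z hzK _ (hP z hzK) w
    have := hcontact w
    linarith
  intro h0
  have h1 := hlip.hausdorffMeasure_image_le (d := finrank ℝ H) (by positivity)
  rw [h0, mul_zero] at h1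
  have h2 := (measure_mono honto).trans h1
  exact (Metric.measure_closedBall_pos (μH[finrank ℝ H] : Measure H) (0 : H) hδ).not_ge h2

/-- Near a maximum of `U + V`, with `U` and `V` semiconvex, there are points at which both functions
are twice differentiable, with almost opposite gradients and almost opposite or smaller Hessians. -/
lemma IsSemiconvex.exists_hasExpansion_near_max {C : ℝ} (hC : 0 < C) {U V : H → ℝ}
    (hU : IsSemiconvex C U) (hV : IsSemiconvex C V) {z₀ : H}
    (hmax : ∀ w, U w + V w ≤ U z₀ + V z₀) {δ : ℝ} (hδ : 0 < δ) :
    ∃ (z p q : H) (A B : H →L[ℝ] H), ‖z - z₀‖ ≤ δ ∧ HasExpansion U z p A ∧ HasExpansion V z q B ∧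
      (A : H →ₗ[ℝ] H).IsSymmetric ∧ (B : H →ₗ[ℝ] H).IsSymmetric ∧
      ‖p + q‖ ≤ δ ∧ ∀ ξ, ⟪(A + B) ξ, ξ⟫_ℝ ≤ δ * ‖ξ‖ ^ 2 := by
  let _ : MeasurableSpace H := borel H
  have : BorelSpace H := ⟨rfl⟩
  set η := δ / 2 with hη
  have hη0 : 0 < η := by positivity
  set W : H → ℝ := fun w => U w + V w + -(η * ‖w - z₀‖ ^ 2) with hWdef
  have hW : IsSemiconvex (C + C + 2 * η) W :=
    (hU.add hV).add (isSemiconvex_neg_mul_norm_sub_sq η z₀)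
  have hWmax : ∀ w, W w ≤ W z₀ - η * ‖w - z₀‖ ^ 2 := by
    intro w; simp only [hWdef, sub_self, norm_zero]
    have := hmax w; nlinarith
  -- slopes up to `κ` keep `‖z - z₀‖ ≤ κ / η ≤ δ` and `‖p + q‖ ≤ κ + 2 η ‖z - z₀‖ ≤ 3 κ ≤ δ`
  set κ := min (η * δ) (δ / 3) with hκ
  have hκ0 : 0 < κ := by positivity
  have hpos := hW.measure_contact_ne_zero (by positivity) hη0 hWmax hκ0
  have hall := hU.ae_exists_hasExpansion.and hV.ae_exists_hasExpansion
  obtain ⟨z, ⟨s, hs, hcontact⟩, ⟨p, A, hA, hpA⟩, ⟨q, B, hB, hqB⟩⟩ :=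
    ((frequently_ae_iff.2 hpos).and_eventually hall).exists
  have hz : η * ‖z - z₀‖ ≤ κ := by
    have h1 := hcontact z₀
    have h2 := hWmax z
    have h3 := abs_real_inner_le_norm s (z₀ - z)
    have h4 := le_abs_self ⟪s, z₀ - z⟫_ℝ
    rw [norm_sub_rev z₀ z] at h3
    rcases (norm_nonneg (z - z₀)).eq_or_lt' with h0 | h0
    · rw [h0, mul_zero]; exact hκ0.le
    · refine le_of_mul_le_mul_right ?_ h0
      nlinarith
  have hexp := (hpA.add hqB).add (hasExpansion_mul_norm_sub_sq (-(2 * η)) z₀ z)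
  have e : (fun w => U w + V w + -(2 * η) / 2 * ‖w - z₀‖ ^ 2) = W := by
    ext w; simp only [hWdef]; ring
  rw [e] at hexp
  obtain ⟨h1, h2⟩ := hexp.le_of_le (p := s) (c := 0) (fun w => by simpa using hcontact w)
  refine ⟨z, p, q, A, B, ?_, hpA, hqB, hA, hB, ?_, fun ξ => ?_⟩
  · have : η * ‖z - z₀‖ ≤ η * δ := hz.trans (min_le_left _ _)
    exact le_of_mul_le_mul_left this hη0
  · have e2 : p + q = s + (2 * η) • (z - z₀) := by
      rw [← h1, neg_smul]; abel
    rw [e2]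
    refine (norm_add_le _ _).trans ?_
    rw [norm_smul, Real.norm_eq_abs, abs_of_pos (by positivity)]
    have : κ ≤ δ / 3 := min_le_right _ _
    nlinarith
  · have h3 := h2 ξ
    simp only [_root_.add_apply, _root_.smul_apply, inner_add_left, inner_smul_left,
      ContinuousLinearMap.id_apply, real_inner_self_eq_norm_sq, RCLike.conj_to_real] at h3 ⊢
    have e3 : 2 * η = δ := by rw [hη]; ring
    rw [e3] at h3
    linarith

/-- The **theorem on sums** in limit form: at a maximum of `U + V`, with `U` and `V` semiconvex,
the two functions have limiting second order expansions with opposite gradients and with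
Hessians of nonpositive sum. -/
lemma IsSemiconvex.exists_seq_hasExpansion {C : ℝ} (hC : 0 < C) {U V : H → ℝ}
    (hU : IsSemiconvex C U) (hV : IsSemiconvex C V) {z₀ : H}
    (hmax : ∀ w, U w + V w ≤ U z₀ + V z₀) :
    ∃ (z p q : ℕ → H) (A B : ℕ → H →L[ℝ] H) (p₀ : H) (A₀ B₀ : H →L[ℝ] H),
      (∀ k, HasExpansion U (z k) (p k) (A k)) ∧ (∀ k, HasExpansion V (z k) (q k) (B k)) ∧
      Tendsto z atTop (𝓝 z₀) ∧ Tendsto p atTop (𝓝 p₀) ∧ Tendsto q atTop (𝓝 (-p₀)) ∧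
      Tendsto A atTop (𝓝 A₀) ∧ Tendsto B atTop (𝓝 B₀) ∧
      (∀ k, (A k : H →ₗ[ℝ] H).IsSymmetric) ∧ (∀ k, (B k : H →ₗ[ℝ] H).IsSymmetric) ∧
      (A₀ : H →ₗ[ℝ] H).IsSymmetric ∧ (B₀ : H →ₗ[ℝ] H).IsSymmetric ∧
      (∀ ξ, ⟪(A₀ + B₀) ξ, ξ⟫_ℝ ≤ 0) := by
  have hδ : ∀ k : ℕ, (0 : ℝ) < 1 / ((k : ℝ) + 1) := fun k => by positivity
  have hδ0 : Tendsto (fun k : ℕ => 1 / ((k : ℝ) + 1)) atTop (𝓝 0) :=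
    tendsto_one_div_add_atTop_nhds_zero_nat
  choose z p q A B hz hA hB hAs hBs hpq hAB using
    fun k => hU.exists_hasExpansion_near_max hC hV hmax (hδ k)
  have hzlim : Tendsto z atTop (𝓝 z₀) :=
    tendsto_iff_norm_sub_tendsto_zero.2 (squeeze_zero (fun _ => norm_nonneg _) hz hδ0)
  obtain ⟨p₀, hp₀⟩ := hU z₀
  obtain ⟨q₀, hq₀⟩ := hV z₀
  -- at the maximum `U` is differentiable, hence its gradients converge
  have huniq : ∀ r, IsSubgradient (fun w => U w + C / 2 * ‖w‖ ^ 2) z₀ r → r = p₀ + C • z₀ := by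
    have huniq' : ∀ r, (∀ w, U z₀ + ⟪r, w - z₀⟫_ℝ - C / 2 * ‖w - z₀‖ ^ 2 ≤ U w) → r = -q₀ := by
      intro r hr
      refine eq_of_le_paraboloid (z := z₀) (C := C) (D := C) fun w => ?_
      have := hr w
      have := hq₀ w
      have := hmax w
      rw [inner_neg_left]
      linarith
    intro r hr
    have h1 : ∀ w, U z₀ + ⟪r - C • z₀, w - z₀⟫_ℝ - C / 2 * ‖w - z₀‖ ^ 2 ≤ U w := by
      intro w
      have h1 := hr w
      have h2 : ‖w‖ ^ 2 = ‖z₀‖ ^ 2 + 2 * ⟪z₀, w - z₀⟫_ℝ + ‖w - z₀‖ ^ 2 := by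
        rw [← norm_add_sq_real]; simp
      simp only [inner_sub_left, inner_smul_left, RCLike.conj_to_real]
      simp only [h2] at h1
      linarith
    rw [huniq' _ hp₀, ← huniq' _ h1]; simp
  have hgrad : ∀ k w, U (z k) + ⟪p k, w - z k⟫_ℝ - C / 2 * ‖w - z k‖ ^ 2 ≤ U w := by
    intro k
    obtain ⟨r, hr⟩ := hU (z k)
    rw [((hA k).ge_of_ge hr).1]
    exact hr
  have hplim : Tendsto p atTop (𝓝 p₀) := by
    have h1 : Tendsto (fun k => p k + C • z k) atTop (𝓝 (p₀ + C • z₀)) := by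
      rw [Metric.tendsto_nhds]
      intro ε hε
      filter_upwards [hzlim.eventually
        (eventually_norm_isSubgradient_sub_lt hU.exists_isSubgradient huniq hε)] with k hk
      rw [dist_eq_norm]
      exact hk _ (IsSemiconvex.isSubgradient_add_sq (hgrad k))
    have h2 := h1.sub (hzlim.const_smul C)
    simpa using h2
  have hqlim : Tendsto q atTop (𝓝 (-p₀)) := by
    have h1 : Tendsto (fun k => p k + q k) atTop (𝓝 0) :=
      tendsto_zero_iff_norm_tendsto_zero.2 (squeeze_zero (fun _ => norm_nonneg _) hpq hδ0)
    simpa using h1.sub hplim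
  have hδ1 : ∀ k : ℕ, 1 / ((k : ℝ) + 1) ≤ 1 := fun k => by
    rw [div_le_one (by positivity)]; linarith [(Nat.cast_nonneg k : (0 : ℝ) ≤ k)]
  have hAlow : ∀ k ξ, -(C * ‖ξ‖ ^ 2) ≤ ⟪A k ξ, ξ⟫_ℝ := fun k => by
    obtain ⟨r, hr⟩ := hU (z k); exact ((hA k).ge_of_ge hr).2
  have hBlow : ∀ k ξ, -(C * ‖ξ‖ ^ 2) ≤ ⟪B k ξ, ξ⟫_ℝ := fun k => by
    obtain ⟨r, hr⟩ := hV (z k); exact ((hB k).ge_of_ge hr).2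
  have hsum : ∀ k ξ, ⟪A k ξ, ξ⟫_ℝ + ⟪B k ξ, ξ⟫_ℝ ≤ ‖ξ‖ ^ 2 := by
    intro k ξ
    have h1 := hAB k ξ
    rw [_root_.add_apply, inner_add_left] at h1
    have := mul_le_mul_of_nonneg_right (hδ1 k) (sq_nonneg ‖ξ‖)
    linarith
  have hAbd : ∀ k, A k ∈ Metric.closedBall (0 : H →L[ℝ] H) (C + 1) := fun k => by
    rw [mem_closedBall_zero_iff]
    refine norm_le_of_isSymmetric_of_abs_inner_le (hAs k) (by positivity) fun ξ => abs_le.2 ⟨?_, ?_⟩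
    · nlinarith [hAlow k ξ, sq_nonneg ‖ξ‖]
    · linarith [hsum k ξ, hBlow k ξ]
  have hBbd : ∀ k, B k ∈ Metric.closedBall (0 : H →L[ℝ] H) (C + 1) := fun k => by
    rw [mem_closedBall_zero_iff]
    refine norm_le_of_isSymmetric_of_abs_inner_le (hBs k) (by positivity) fun ξ => abs_le.2 ⟨?_, ?_⟩
    · nlinarith [hBlow k ξ, sq_nonneg ‖ξ‖]
    · linarith [hsum k ξ, hAlow k ξ]
  have : ProperSpace (H →L[ℝ] H) := FiniteDimensional.proper_real _
  obtain ⟨A₀, -, φ, hφ, hAlim⟩ := (isCompact_closedBall _ _).tendsto_subseq hAbd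
  obtain ⟨B₀, -, ψ, hψ, hBlim⟩ := (isCompact_closedBall _ _).tendsto_subseq fun k => hBbd (φ k)
  set χ := φ ∘ ψ
  have hχ : Tendsto χ atTop atTop := (hφ.comp hψ).tendsto_atTop
  have hAlim' : Tendsto (A ∘ χ) atTop (𝓝 A₀) := hAlim.comp hψ.tendsto_atTop
  have hBlim' : Tendsto (B ∘ χ) atTop (𝓝 B₀) := hBlim
  have happ : ∀ {T : ℕ → H →L[ℝ] H} {T₀ : H →L[ℝ] H}, Tendsto T atTop (𝓝 T₀) → ∀ x,
      Tendsto (fun k => T k x) atTop (𝓝 (T₀ x)) := fun hT x =>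
    ((ContinuousLinearMap.apply ℝ H x).continuous.tendsto _).comp hT
  have hsymm : ∀ {T : ℕ → H →L[ℝ] H} {T₀ : H →L[ℝ] H}, Tendsto T atTop (𝓝 T₀) →
      (∀ k, (T k : H →ₗ[ℝ] H).IsSymmetric) → (T₀ : H →ₗ[ℝ] H).IsSymmetric := by
    intro T T₀ hT hs x y
    refine tendsto_nhds_unique ((happ hT x).inner (tendsto_const_nhds (x := y))) ?_
    refine ((tendsto_const_nhds (x := x)).inner (happ hT y)).congr fun k => ?_
    exact (hs k x y).symm
  refine ⟨z ∘ χ, p ∘ χ, q ∘ χ, A ∘ χ, B ∘ χ, p₀, A₀, B₀, fun k => hA _, fun k => hB _,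
    hzlim.comp hχ, hplim.comp hχ, hqlim.comp hχ, hAlim', hBlim',
    fun k => hAs _, fun k => hBs _,
    hsymm hAlim' (fun k => hAs _), hsymm hBlim' (fun k => hBs _), fun ξ => ?_⟩
  have h1 : Tendsto (fun k => ⟪A (χ k) ξ + B (χ k) ξ, ξ⟫_ℝ) atTop (𝓝 ⟪A₀ ξ + B₀ ξ, ξ⟫_ℝ) :=
    ((happ hAlim' ξ).add (happ hBlim' ξ)).inner tendsto_const_nhds
  have h2 : Tendsto (fun k => (1 / ((χ k : ℝ) + 1)) * ‖ξ‖ ^ 2) atTop (𝓝 (0 * ‖ξ‖ ^ 2)) :=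
    (hδ0.comp hχ).mul_const _
  rw [zero_mul] at h2
  exact le_of_tendsto_of_tendsto' h1 h2 fun k => by simpa using hAB (χ k) ξ

end sums
end

section
open scoped InnerProductSpace NNReal ENNReal

/-! ### Sup-convolutions and superjets -/

lemma exists_supConv_isMax {H : Type*} [NormedAddCommGroup H] {S : Set H}
    (hS : IsClosed S) (hne : S.Nonempty) {v Θ : H → ℝ}
    (hv : ContinuousOn v S) {m : ℝ} (hm : ∀ z ∈ S, v z ≤ m) (hΘc : Continuous Θ)
    (hΘ : Tendsto Θ (cocompact H) atTop) (z : H) :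
    ∃ w ∈ S, ∀ y ∈ S, v y - Θ (z - y) ≤ v w - Θ (z - w) := by
  obtain ⟨w₀, hw₀⟩ := hne
  have hcont : ContinuousOn (fun y => v y - Θ (z - y)) S := by fun_prop
  refine hcont.exists_isMaxOn' hS hw₀ ?_
  have h1 : Tendsto (fun y => Θ (z - y)) (cocompact H) atTop :=
    hΘ.comp (Homeomorph.subLeft z).isClosedEmbedding.tendsto_cocompact
  have h2 := (h1.eventually_ge_atTop (m - (v w₀ - Θ (z - w₀))))
  filter_upwards [mem_inf_of_left h2, mem_inf_of_right (mem_principal_self S)] with y hy hyS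
  have := hm y hyS
  linarith

/-- Optimal points of a sup-convolution at a convergent sequence have optimal cluster points. -/
lemma exists_tendsto_supConv_opt {H : Type*} [NormedAddCommGroup H] {S : Set H}
    (hS : IsClosed S) {v Θ U : H → ℝ} {w : H → H}
    (hv : ContinuousOn v S) {m : ℝ} (hm : ∀ z ∈ S, v z ≤ m) (hΘc : Continuous Θ)
    (hΘ : Tendsto Θ (cocompact H) atTop) (hUc : Continuous U) (hw : ∀ z, w z ∈ S)
    (hU : ∀ z, U z = v (w z) - Θ (z - w z)) {z : ℕ → H} {z₀ : H} (hz : Tendsto z atTop (𝓝 z₀)) :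
    ∃ w₀ ∈ S, ∃ φ : ℕ → ℕ, StrictMono φ ∧ Tendsto (fun k => w (z (φ k))) atTop (𝓝 w₀) ∧
      U z₀ = v w₀ - Θ (z₀ - w₀) := by
  have hUz : Tendsto (fun k => U (z k)) atTop (𝓝 (U z₀)) := (hUc.tendsto _).comp hz
  obtain ⟨K, hK, hKΘ⟩ := mem_cocompact.1 (hΘ.eventually_gt_atTop (m - (U z₀ - 1)))
  have hev : ∀ᶠ k in atTop, z k - w (z k) ∈ K := by
    filter_upwards [hUz.eventually (lt_mem_nhds (sub_one_lt (U z₀)))] with k hk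
    by_contra hcon
    have h1 : m - (U z₀ - 1) < Θ (z k - w (z k)) := hKΘ hcon
    have h2 := hU (z k)
    have h3 := hm _ (hw (z k))
    linarith
  obtain ⟨e, -, φ, hφ, hlim⟩ := hK.tendsto_subseq' hev.frequently
  have hzφ := hz.comp hφ.tendsto_atTop
  have hwlim : Tendsto (fun k => w (z (φ k))) atTop (𝓝 (z₀ - e)) := by
    have := hzφ.sub hlim
    simpa [Function.comp_def] using this
  have hmem : z₀ - e ∈ S := hS.mem_of_tendsto hwlim (Eventually.of_forall fun k => hw _)
  refine ⟨z₀ - e, hmem, φ, hφ, hwlim, ?_⟩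
  have h1 : Tendsto (fun k => v (w (z (φ k)))) atTop (𝓝 (v (z₀ - e))) :=
    (hv _ hmem).tendsto.comp (tendsto_nhdsWithin_iff.2 ⟨hwlim, Eventually.of_forall fun k => hw _⟩)
  have h2 : Tendsto (fun k => Θ (z (φ k) - w (z (φ k)))) atTop (𝓝 (Θ (z₀ - (z₀ - e)))) :=
    (hΘc.tendsto _).comp (hzφ.sub hwlim)
  refine tendsto_nhds_unique (hUz.comp hφ.tendsto_atTop) ((h1.sub h2).congr fun k => ?_)
  exact (hU _).symm

section supconv
variable {H : Type*} [NormedAddCommGroup H] [InnerProductSpace ℝ H]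

/-- `(p, A)` is a second order superjet at `z` of the restriction of `v` to `S`. -/
def HasSuperjet (S : Set H) (v : H → ℝ) (z p : H) (A : H →L[ℝ] H) : Prop :=
  ∀ ε > 0, ∀ᶠ ξ in 𝓝 (0 : H), z + ξ ∈ S →
    v (z + ξ) ≤ v z + ⟪p, ξ⟫_ℝ + 1 / 2 * ⟪A ξ, ξ⟫_ℝ + ε * ‖ξ‖ ^ 2

/-- `(p, A)` is a limit of symmetric superjets of `v` at points of `S` converging to `z`. -/
def HasLimitSuperjet (S : Set H) (v : H → ℝ) (z p : H) (A : H →L[ℝ] H) : Prop :=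
  ∃ (w r : ℕ → H) (B : ℕ → H →L[ℝ] H), (∀ k, w k ∈ S) ∧ (∀ k, HasSuperjet S v (w k) (r k) (B k)) ∧
    (∀ k, (B k : H →ₗ[ℝ] H).IsSymmetric) ∧ Tendsto w atTop (𝓝 z) ∧ Tendsto r atTop (𝓝 p) ∧
    Tendsto B atTop (𝓝 A)

/-- Semiconcavity of `Θ` with derivative `DΘ` makes sup-convolutions with `Θ` semiconvex. -/
lemma isSemiconvex_supConv {S : Set H} {v Θ U : H → ℝ} {DΘ : H → H} {C : ℝ} {w : H → H}
    (hΘ : ∀ ξ η, Θ (ξ + η) ≤ Θ ξ + ⟪DΘ ξ, η⟫_ℝ + C / 2 * ‖η‖ ^ 2) (hw : ∀ z, w z ∈ S)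
    (hU : ∀ z, U z = v (w z) - Θ (z - w z)) (hUle : ∀ z, ∀ y ∈ S, v y - Θ (z - y) ≤ U z) (z : H) :
    ∀ y, U z + ⟪-DΘ (z - w z), y - z⟫_ℝ - C / 2 * ‖y - z‖ ^ 2 ≤ U y := by
  intro y
  have h1 := hUle y (w z) (hw z)
  have h2 := hΘ (z - w z) (y - z)
  have h3 : z - w z + (y - z) = y - w z := by abel
  rw [h3] at h2
  rw [hU z, inner_neg_left]
  linarith

lemma HasExpansion.hasSuperjet_supConv {S : Set H} {v Θ U : H → ℝ} {w z p : H}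
    {A : H →L[ℝ] H} (hU : U z = v w - Θ (z - w)) (hUle : ∀ z, ∀ y ∈ S, v y - Θ (z - y) ≤ U z)
    (h : HasExpansion U z p A) : HasSuperjet S v w p A := by
  intro ε hε
  filter_upwards [h ε hε] with ξ hξ hmem
  have h1 := hUle (z + ξ) _ hmem
  have h2 := (abs_le.1 hξ).2
  rw [add_sub_add_right_eq_sub] at h1
  linarith

variable [FiniteDimensional ℝ H]

/-- The maximum principle for semicontinuous functions, in a symmetric form: if
`(z, w₁, w₂) ↦ v₁ w₁ + v₂ w₂ - Θ (z - w₁) - Θ (z - w₂)` has a maximum, then it has a maximum at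
which `v₁` and `v₂` have limiting superjets with opposite slopes and Hessians of nonpositive sum. -/
theorem exists_limitSuperjets_of_max {S : Set H} (hS : IsClosed S) {v₁ v₂ Θ : H → ℝ}
    {DΘ : H → H} {C m : ℝ} (hC : 0 < C) (hv₁ : ContinuousOn v₁ S) (hv₂ : ContinuousOn v₂ S)
    (hm₁ : ∀ z ∈ S, v₁ z ≤ m) (hm₂ : ∀ z ∈ S, v₂ z ≤ m) (hΘc : Continuous Θ) (hDΘ : Continuous DΘ)
    (hΘ : Tendsto Θ (cocompact H) atTop)
    (hΘC : ∀ ξ η, Θ (ξ + η) ≤ Θ ξ + ⟪DΘ ξ, η⟫_ℝ + C / 2 * ‖η‖ ^ 2)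
    {z₀ a b : H} (ha : a ∈ S) (hb : b ∈ S)
    (hmax : ∀ z, ∀ x ∈ S, ∀ y ∈ S, v₁ x + v₂ y - Θ (z - x) - Θ (z - y) ≤
      v₁ a + v₂ b - Θ (z₀ - a) - Θ (z₀ - b)) :
    ∃ w₁ ∈ S, ∃ w₂ ∈ S, ∃ (p : H) (A B : H →L[ℝ] H),
      (∀ z, ∀ x ∈ S, ∀ y ∈ S, v₁ x + v₂ y - Θ (z - x) - Θ (z - y) ≤
        v₁ w₁ + v₂ w₂ - Θ (z₀ - w₁) - Θ (z₀ - w₂)) ∧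
      p = -DΘ (z₀ - w₁) ∧ -p = -DΘ (z₀ - w₂) ∧
      HasLimitSuperjet S v₁ w₁ p A ∧ HasLimitSuperjet S v₂ w₂ (-p) B ∧
      (A : H →ₗ[ℝ] H).IsSymmetric ∧ (B : H →ₗ[ℝ] H).IsSymmetric ∧
      ∀ ξ, ⟪(A + B) ξ, ξ⟫_ℝ ≤ 0 := by
  have hne : S.Nonempty := ⟨a, ha⟩
  choose f hfS hf using fun z => exists_supConv_isMax hS hne hv₁ hm₁ hΘc hΘ z
  choose g hgS hg using fun z => exists_supConv_isMax hS hne hv₂ hm₂ hΘc hΘ z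
  set U : H → ℝ := fun z => v₁ (f z) - Θ (z - f z) with hU
  set V : H → ℝ := fun z => v₂ (g z) - Θ (z - g z) with hV
  have hUsub := isSemiconvex_supConv hΘC hfS (U := U) (fun _ => rfl) hf
  have hVsub := isSemiconvex_supConv hΘC hgS (U := V) (fun _ => rfl) hg
  have hUsemi : IsSemiconvex C U := fun z => ⟨_, hUsub z⟩
  have hVsemi : IsSemiconvex C V := fun z => ⟨_, hVsub z⟩
  have hUV : ∀ z, U z + V z ≤ U z₀ + V z₀ := by
    intro z
    have h1 := hmax z (f z) (hfS z) (g z) (hgS z)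
    have h2 := hf z₀ a ha
    have h3 := hg z₀ b hb
    simp only [hU, hV]
    linarith
  obtain ⟨z, p, q, A, B, p₀, A₀, B₀, hA, hB, hz, hp, hq, hAl, hBl, hAk, hBk, hAs, hBs, hAB⟩ :=
    hUsemi.exists_seq_hasExpansion hC hVsemi hUV
  have hpk : ∀ k, p k = -DΘ (z k - f (z k)) := fun k => ((hA k).ge_of_ge (hUsub (z k))).1
  have hqk : ∀ k, q k = -DΘ (z k - g (z k)) := fun k => ((hB k).ge_of_ge (hVsub (z k))).1
  obtain ⟨w₁, hw₁, φ, hφ, hφw, hUw⟩ := exists_tendsto_supConv_opt hS hv₁ hm₁ hΘc hΘ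
    hUsemi.continuous hfS (U := U) (fun _ => rfl) hz
  obtain ⟨w₂, hw₂, ψ, hψ, hψw, hVw⟩ := exists_tendsto_supConv_opt hS hv₂ hm₂ hΘc hΘ
    hVsemi.continuous hgS (U := V) (fun _ => rfl) hz
  refine ⟨w₁, hw₁, w₂, hw₂, p₀, A₀, B₀, fun z x hx y hy => ?_, ?_, ?_, ?_, ?_, hAs, hBs, hAB⟩
  · have h1 := hmax z x hx y hy
    have h2 := hf z₀ a ha
    have h3 := hg z₀ b hb
    simp only [hU, hV] at hUw hVw
    linarith
  · refine tendsto_nhds_unique (hp.comp hφ.tendsto_atTop) ?_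
    have h1 : Tendsto (fun k => -DΘ (z (φ k) - f (z (φ k)))) atTop (𝓝 (-DΘ (z₀ - w₁))) :=
      ((hDΘ.tendsto _).comp ((hz.comp hφ.tendsto_atTop).sub hφw)).neg
    exact h1.congr fun k => (hpk (φ k)).symm
  · refine tendsto_nhds_unique (hq.comp hψ.tendsto_atTop) ?_
    have h1 : Tendsto (fun k => -DΘ (z (ψ k) - g (z (ψ k)))) atTop (𝓝 (-DΘ (z₀ - w₂))) :=
      ((hDΘ.tendsto _).comp ((hz.comp hψ.tendsto_atTop).sub hψw)).neg
    exact h1.congr fun k => (hqk (ψ k)).symm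
  · exact ⟨fun k => f (z (φ k)), p ∘ φ, A ∘ φ, fun k => hfS _,
      fun k => (hA (φ k)).hasSuperjet_supConv rfl hf, fun k => hAk _, hφw, hp.comp hφ.tendsto_atTop,
      hAl.comp hφ.tendsto_atTop⟩
  · exact ⟨fun k => g (z (ψ k)), q ∘ ψ, B ∘ ψ, fun k => hgS _,
      fun k => (hB (ψ k)).hasSuperjet_supConv rfl hg, fun k => hBk _, hψw, hq.comp hψ.tendsto_atTop,
      hBl.comp hψ.tendsto_atTop⟩

end supconv
end

section
open scoped InnerProductSpace NNReal ENNReal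

/-! ### Gradients and Hessians -/

lemma HasExpansion.of_contDiffAt {n : ℕ} {ψ : EuclideanSpace ℝ (Fin n) → ℝ}
    {x : EuclideanSpace ℝ (Fin n)} (hd : ∀ᶠ y in 𝓝 x, DifferentiableAt ℝ ψ y)
    (hh : HasFDerivAt (gradient ψ) (hessian ψ x) x) :
    HasExpansion ψ x (gradient ψ x) (hessian ψ x) := by
  intro ε hε
  obtain ⟨r, hr, hball⟩ := Metric.eventually_nhds_iff.1
    (hd.and ((hasFDerivAt_iff_isLittleO.1 hh).bound hε))
  refine Metric.eventually_nhds_iff.2 ⟨r, hr, fun ξ hξ => ?_⟩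
  rw [dist_zero_right] at hξ
  set φ : ℝ → ℝ := fun t => ψ (x + t • ξ) - t * ⟪gradient ψ x, ξ⟫_ℝ -
    t ^ 2 / 2 * ⟪hessian ψ x ξ, ξ⟫_ℝ with hφ
  have hnear : ∀ t ∈ Icc (0 : ℝ) 1, dist (x + t • ξ) x < r ∧ ‖t • ξ‖ ≤ ‖ξ‖ := by
    intro t ht
    have : ‖t • ξ‖ ≤ ‖ξ‖ := by
      rw [norm_smul, Real.norm_eq_abs, abs_of_nonneg ht.1]
      exact mul_le_of_le_one_left (norm_nonneg _) ht.2
    exact ⟨by rw [dist_eq_norm, add_sub_cancel_left]; exact this.trans_lt hξ, this⟩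
  have hderiv : ∀ t ∈ Icc (0 : ℝ) 1, HasDerivWithinAt φ
      ⟪gradient ψ (x + t • ξ) - gradient ψ x - hessian ψ x (t • ξ), ξ⟫_ℝ (Icc 0 1) t := by
    intro t ht
    have h1 : HasDerivAt (fun t : ℝ => x + t • ξ) ξ t := by
      simpa using ((hasDerivAt_id t).smul_const ξ).const_add x
    have h2 := (hball (hnear t ht).1).1.hasGradientAt.hasFDerivAt.comp_hasDerivAt t h1
    have h3 : HasDerivAt (fun t : ℝ => t * ⟪gradient ψ x, ξ⟫_ℝ) ⟪gradient ψ x, ξ⟫_ℝ t := by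
      simpa using (hasDerivAt_id t).mul_const ⟪gradient ψ x, ξ⟫_ℝ
    have h4 : HasDerivAt (fun t : ℝ => t ^ 2 / 2 * ⟪hessian ψ x ξ, ξ⟫_ℝ)
        (t * ⟪hessian ψ x ξ, ξ⟫_ℝ) t := by
      have := (((hasDerivAt_id t).pow 2).div_const 2).mul_const ⟪hessian ψ x ξ, ξ⟫_ℝ
      refine this.congr_deriv ?_
      simp
    refine (((h2.sub h3).sub h4).congr_deriv ?_).hasDerivWithinAt
    simp [inner_sub_left, inner_smul_left]
  have hbound : ∀ t ∈ Ico (0 : ℝ) 1,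
      ‖⟪gradient ψ (x + t • ξ) - gradient ψ x - hessian ψ x (t • ξ), ξ⟫_ℝ‖ ≤ ε * ‖ξ‖ ^ 2 := by
    intro t ht
    have ht' : t ∈ Icc (0 : ℝ) 1 := ⟨ht.1, ht.2.le⟩
    have h1 := (hball (hnear t ht').1).2
    rw [add_sub_cancel_left] at h1
    refine (abs_real_inner_le_norm _ _).trans ?_
    calc _ ≤ (ε * ‖t • ξ‖) * ‖ξ‖ := by gcongr
      _ ≤ (ε * ‖ξ‖) * ‖ξ‖ := by gcongr; exact (hnear t ht').2
      _ = _ := by ring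
  have := norm_image_sub_le_of_norm_deriv_le_segment_01' hderiv hbound
  convert this using 1
  rw [Real.norm_eq_abs]
  congr 1
  simp [hφ]; ring

/-- The gradient inequality for convex functions. -/
lemma ConvexOn.gradient_le {n : ℕ} {ψ : EuclideanSpace ℝ (Fin n) → ℝ} (hc : ConvexOn ℝ univ ψ)
    {x : EuclideanSpace ℝ (Fin n)} (hd : DifferentiableAt ℝ ψ x) (w : EuclideanSpace ℝ (Fin n)) :
    ψ x + ⟪gradient ψ x, w - x⟫_ℝ ≤ ψ w := by
  have h1 : HasDerivAt (fun t : ℝ => x + t • (w - x)) (w - x) 0 := by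
    simpa using ((hasDerivAt_id (0 : ℝ)).smul_const (w - x)).const_add x
  have hd' : HasFDerivAt ψ (InnerProductSpace.toDual ℝ _ (gradient ψ x))
      (x + (0 : ℝ) • (w - x)) := by simpa using hd.hasGradientAt.hasFDerivAt
  have h2 := (hd'.comp_hasDerivAt (0 : ℝ) h1).tendsto_slope_zero_right
  simp only [InnerProductSpace.toDual_apply_apply] at h2
  have h3 : ∀ᶠ t in 𝓝[>] (0 : ℝ), t⁻¹ • ((ψ ∘ fun t : ℝ => x + t • (w - x)) (0 + t) -
      (ψ ∘ fun t : ℝ => x + t • (w - x)) 0) ≤ ψ w - ψ x := by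
    filter_upwards [Ioo_mem_nhdsGT (zero_lt_one' ℝ)] with t ht
    have h4 := hc.2 (mem_univ x) (mem_univ w) (sub_nonneg.2 ht.2.le) ht.1.le (by ring)
    have e : (1 - t) • x + t • w = x + t • (w - x) := by rw [sub_smul, smul_sub, one_smul]; abel
    rw [e] at h4
    simp only [smul_eq_mul, Function.comp, zero_add, zero_smul, add_zero] at h4 ⊢
    rw [inv_mul_le_iff₀ ht.1]
    linarith
  linarith [le_of_tendsto h2 h3]

section anisotropy
variable {n : ℕ} {σ : EuclideanSpace ℝ (Fin n) → ℝ}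

lemma hasFDerivAt_gradient {p : EuclideanSpace ℝ (Fin n)} (h : ContDiffAt ℝ 2 σ p) :
    HasFDerivAt (gradient σ) (hessian σ p) p := by
  have h1 : ContDiffAt ℝ 1 (fderiv ℝ σ) p := h.fderiv_right (by norm_num)
  have h2 : DifferentiableAt ℝ (gradient σ) p :=
    ((InnerProductSpace.toDual ℝ _).symm.toContinuousLinearEquiv.differentiableAt).comp p
      (h1.differentiableAt (by norm_num))
  exact h2.hasFDerivAt

lemma ContDiffAt.hasExpansion {p : EuclideanSpace ℝ (Fin n)} (h : ContDiffAt ℝ 2 σ p) :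
    HasExpansion σ p (gradient σ p) (hessian σ p) :=
  HasExpansion.of_contDiffAt
    ((h.eventually (by simp)).mono fun _ hy => hy.differentiableAt (by norm_num))
    (hasFDerivAt_gradient h)

lemma inner_hessian_apply {p : EuclideanSpace ℝ (Fin n)} (h : ContDiffAt ℝ 2 σ p)
    (a b : EuclideanSpace ℝ (Fin n)) :
    ⟪hessian σ p a, b⟫_ℝ = fderiv ℝ (fderiv ℝ σ) p a b := by
  have h1 : ContDiffAt ℝ 1 (fderiv ℝ σ) p := h.fderiv_right (by norm_num)
  have h2 := (hasFDerivAt_gradient h).inner ℝ (hasFDerivAt_const b p)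
  have h3 := (h1.differentiableAt (by norm_num)).hasFDerivAt.clm_apply (hasFDerivAt_const b p)
  have e : (fun y => ⟪gradient σ y, b⟫_ℝ) = fun y => fderiv ℝ σ y b := by
    ext y; exact inner_gradient_left
  rw [e] at h2
  simpa using congrArg (fun A => A a) (h2.unique h3)

lemma isSymmetric_hessian {p : EuclideanSpace ℝ (Fin n)} (h : ContDiffAt ℝ 2 σ p) :
    (hessian σ p : EuclideanSpace ℝ (Fin n) →ₗ[ℝ] EuclideanSpace ℝ (Fin n)).IsSymmetric := by
  intro a b
  have hs := h.isSymmSndFDerivAt (by simp)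
  simp only [ContinuousLinearMap.coe_coe]
  rw [inner_hessian_apply h, real_inner_comm, inner_hessian_apply h]
  exact hs.eq a b

lemma inner_hessian_nonneg {p : EuclideanSpace ℝ (Fin n)} (h : ContDiffAt ℝ 2 σ p)
    (hc : ConvexOn ℝ univ σ) (ξ : EuclideanSpace ℝ (Fin n)) : 0 ≤ ⟪hessian σ p ξ, ξ⟫_ℝ := by
  have := (h.hasExpansion.ge_of_ge (p := gradient σ p) (c := 0) (fun w => by
    have := hc.gradient_le (h.differentiableAt (by norm_num)) w
    linarith)).2 ξ
  simpa using this

lemma gradient_smul_of_homogeneous (hσ : ∀ (a : ℝ) x, 0 < a → σ (a • x) = a * σ x) {a : ℝ}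
    (ha : 0 < a) (p : EuclideanSpace ℝ (Fin n)) : gradient σ (a • p) = gradient σ p := by
  have h1 : (fun x => σ (a • x)) = a • σ := by ext x; simp [hσ a x ha]
  have h2 : a • fderiv ℝ σ (a • p) = a • fderiv ℝ σ p := by
    rw [← fderiv_comp_smul, h1, fderiv_const_smul_field]; rfl
  have h3 : fderiv ℝ σ (a • p) = fderiv ℝ σ p := smul_right_injective _ ha.ne' h2
  rw [gradient, gradient, h3]

lemma hessian_smul_of_homogeneous (hσ : ∀ (a : ℝ) x, 0 < a → σ (a • x) = a * σ x) {a : ℝ}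
    (ha : 0 < a) (p : EuclideanSpace ℝ (Fin n)) : hessian σ (a • p) = a⁻¹ • hessian σ p := by
  have h1 : (fun x => gradient σ (a • x)) = gradient σ := by
    ext1 x; exact gradient_smul_of_homogeneous hσ ha x
  have h2 : a • hessian σ (a • p) = hessian σ p := by
    rw [hessian, hessian, ← fderiv_comp_smul, h1]
  rw [← h2, smul_smul, inv_mul_cancel₀ ha.ne', one_smul]

lemma hessian_apply_self {p : EuclideanSpace ℝ (Fin n)} (h : ContDiffAt ℝ 2 σ p)
    (hσ : ∀ (a : ℝ) x, 0 < a → σ (a • x) = a * σ x) : hessian σ p p = 0 := by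
  have h1 : HasDerivAt (fun t : ℝ => t • p) p 1 := by
    simpa using (hasDerivAt_id (1 : ℝ)).smul_const p
  have h2 : HasFDerivAt (gradient σ) (hessian σ p) ((1 : ℝ) • p) := by
    simpa using hasFDerivAt_gradient h
  have h3 := h2.comp_hasDerivAt (1 : ℝ) h1
  refine h3.unique ((hasDerivAt_const (1 : ℝ) (gradient σ p)).congr_of_eventuallyEq ?_)
  filter_upwards [lt_mem_nhds (zero_lt_one' ℝ)] with t ht
  exact gradient_smul_of_homogeneous hσ ht p

/-- Euler's identity. -/
lemma inner_gradient_self {p : EuclideanSpace ℝ (Fin n)} (h : DifferentiableAt ℝ σ p)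
    (hσ : ∀ (a : ℝ) x, 0 < a → σ (a • x) = a * σ x) : ⟪gradient σ p, p⟫_ℝ = σ p := by
  have h1 : HasDerivAt (fun t : ℝ => t • p) p 1 := by
    simpa using (hasDerivAt_id (1 : ℝ)).smul_const p
  have h2 : HasFDerivAt σ (InnerProductSpace.toDual ℝ _ (gradient σ p)) ((1 : ℝ) • p) := by
    simpa using h.hasGradientAt.hasFDerivAt
  have h3 := h2.comp_hasDerivAt (1 : ℝ) h1
  rw [InnerProductSpace.toDual_apply_apply] at h3
  refine h3.unique (HasDerivAt.congr_of_eventuallyEq (f := fun t : ℝ => t * σ p) ?_ ?_)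
  · simpa using (hasDerivAt_id (1 : ℝ)).mul_const (σ p)
  · filter_upwards [lt_mem_nhds (zero_lt_one' ℝ)] with t ht
    exact hσ t p ht

lemma ContDiffOn.contDiffAt_compl_zero (h : ContDiffOn ℝ 2 σ {0}ᶜ) {p : EuclideanSpace ℝ (Fin n)}
    (hp : p ≠ 0) : ContDiffAt ℝ 2 σ p :=
  h.contDiffAt (isOpen_compl_singleton.mem_nhds hp)

lemma continuousAt_hessian {p : EuclideanSpace ℝ (Fin n)} (h : ContDiffAt ℝ 2 σ p) :
    ContinuousAt (hessian σ) p := by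
  have h1 : ContDiffAt ℝ 1 (fderiv ℝ σ) p := h.fderiv_right (by norm_num)
  have h2 : ContDiffAt ℝ 1 (gradient σ) p :=
    ((InnerProductSpace.toDual ℝ _).symm.toContinuousLinearEquiv.contDiff.contDiffAt).comp p h1
  have h3 : ContDiffAt ℝ 0 (fderiv ℝ (gradient σ)) p := h2.fderiv_right (by norm_num)
  exact h3.continuousAt

lemma exists_norm_hessian_le (h : ContDiffOn ℝ 2 σ {0}ᶜ)
    (hσ : ∀ (a : ℝ) x, 0 < a → σ (a • x) = a * σ x) :
    ∃ c, 0 ≤ c ∧ ∀ p, p ≠ 0 → ‖p‖ * ‖hessian σ p‖ ≤ c := by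
  have hcont : ContinuousOn (hessian σ) (Metric.sphere 0 1) := fun p hp =>
    (continuousAt_hessian (h.contDiffAt_compl_zero
      (ne_zero_of_mem_unit_sphere ⟨p, hp⟩))).continuousWithinAt
  obtain ⟨c, hc⟩ := (isCompact_sphere (0 : EuclideanSpace ℝ (Fin n)) 1).exists_bound_of_continuousOn
    hcont
  refine ⟨max c 0, le_max_right _ _, fun p hp => ?_⟩
  have hp0 : 0 < ‖p‖ := norm_pos_iff.2 hp
  have h1 := hc (‖p‖⁻¹ • p) (by simp [norm_smul, hp0.ne'])
  rw [hessian_smul_of_homogeneous hσ (inv_pos.2 hp0), inv_inv, norm_smul, norm_norm] at h1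
  exact h1.trans (le_max_left _ _)

end anisotropy

/-! ### Traces -/

section trace
variable {V : Type*} [NormedAddCommGroup V] [InnerProductSpace ℝ V] [FiniteDimensional ℝ V]

lemma trace_comp_nonneg {D Z : V →L[ℝ] V} (hZ : (Z : V →ₗ[ℝ] V).IsSymmetric)
    (hD0 : ∀ ξ, 0 ≤ ⟪D ξ, ξ⟫_ℝ) (hZ0 : ∀ ξ, 0 ≤ ⟪Z ξ, ξ⟫_ℝ) :
    0 ≤ LinearMap.trace ℝ V (D.comp Z).toLinearMap := by
  rw [LinearMap.trace_eq_sum_inner _ (hZ.eigenvectorBasis rfl)]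
  refine Finset.sum_nonneg fun i _ => ?_
  set e := hZ.eigenvectorBasis rfl i with he
  have h1 : Z e = (hZ.eigenvalues rfl i : ℝ) • e := hZ.apply_eigenvectorBasis rfl i
  have h2 := hZ0 e
  have h3 : ⟪e, e⟫_ℝ = 1 := by
    rw [real_inner_self_eq_norm_sq, he, OrthonormalBasis.norm_eq_one]; norm_num
  rw [h1, inner_smul_left, h3, mul_one] at h2
  change 0 ≤ ⟪e, D (Z e)⟫_ℝ
  rw [h1, map_smul, inner_smul_right, real_inner_comm]
  exact mul_nonneg h2 (hD0 e)

lemma trace_comp_mono {D X Y : V →L[ℝ] V} (hX : (X : V →ₗ[ℝ] V).IsSymmetric)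
    (hY : (Y : V →ₗ[ℝ] V).IsSymmetric) (hD0 : ∀ ξ, 0 ≤ ⟪D ξ, ξ⟫_ℝ)
    (hXY : ∀ ξ, ⟪X ξ, ξ⟫_ℝ ≤ ⟪Y ξ, ξ⟫_ℝ) :
    LinearMap.trace ℝ V (D.comp X).toLinearMap ≤ LinearMap.trace ℝ V (D.comp Y).toLinearMap := by
  have h1 : (D.comp (Y - X)).toLinearMap = (D.comp Y).toLinearMap - (D.comp X).toLinearMap := by
    ext; simp
  have hs : ((Y - X : V →L[ℝ] V) : V →ₗ[ℝ] V).IsSymmetric := hY.sub hX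
  have := trace_comp_nonneg hs hD0 (fun ξ => by
    simpa [inner_sub_left] using hXY ξ)
  rw [h1, map_sub] at this
  linarith

lemma exists_abs_trace_le : ∃ c, 0 ≤ c ∧ ∀ A : V →L[ℝ] V,
    |LinearMap.trace ℝ V A.toLinearMap| ≤ c * ‖A‖ := by
  let τ : (V →L[ℝ] V) →ₗ[ℝ] ℝ := (LinearMap.trace ℝ V).comp
    (ContinuousLinearMap.coeLM ℝ)
  refine ⟨‖LinearMap.toContinuousLinearMap τ‖,
    norm_nonneg (LinearMap.toContinuousLinearMap τ), fun A => ?_⟩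
  exact (LinearMap.toContinuousLinearMap τ).le_opNorm A

lemma continuous_trace_toLinearMap :
    Continuous fun A : V →L[ℝ] V => LinearMap.trace ℝ V A.toLinearMap := by
  let τ : (V →L[ℝ] V) →ₗ[ℝ] ℝ := (LinearMap.trace ℝ V).comp
    (ContinuousLinearMap.coeLM ℝ)
  exact (LinearMap.toContinuousLinearMap τ).continuous

end trace
end

section
open scoped InnerProductSpace NNReal ENNReal

/-! ### The level set operator and its envelopes -/

/-- The standing assumptions on the anisotropy `σ`, the speed `g` and the driving force `f`. -/
structure IsAdmissible {n : ℕ} (σ : EuclideanSpace ℝ (Fin n) → ℝ)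
    (g f : EuclideanSpace ℝ (Fin n) → ℝ → ℝ) (T lamMinus lamPlus Lg Lf K G : ℝ) : Prop where
  smooth : ContDiffOn ℝ 2 σ {0}ᶜ
  convex : ConvexOn ℝ univ σ
  homog : ∀ (a : ℝ) (x : EuclideanSpace ℝ (Fin n)), 0 < a → σ (a • x) = a * σ x
  bounds : ∀ x : EuclideanSpace ℝ (Fin n), lamMinus * ‖x‖ ≤ σ x ∧ σ x ≤ lamPlus * ‖x‖
  g_cont : ContinuousOn (fun z : EuclideanSpace ℝ (Fin n) × ℝ => g z.1 z.2)
    (Metric.sphere 0 1 ×ˢ univ)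
  g_lip : ∀ p ∈ Metric.sphere (0 : EuclideanSpace ℝ (Fin n)) 1, ∀ ξ η : ℝ,
    |g p ξ - g p η| ≤ Lg * |ξ - η|
  g_mono : ∀ p ∈ Metric.sphere (0 : EuclideanSpace ℝ (Fin n)) 1, Monotone (g p)
  f_cont : ContinuousOn (fun z : EuclideanSpace ℝ (Fin n) × ℝ => f z.1 z.2) (univ ×ˢ Icc 0 T)
  f_lip : ∀ t ∈ Icc 0 T, ∀ x y : EuclideanSpace ℝ (Fin n), |f x t - f y t| ≤ Lf * ‖x - y‖
  f_le : ∀ t ∈ Icc 0 T, ∀ x : EuclideanSpace ℝ (Fin n), |f x t| ≤ K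
  growth : ∀ r : ℝ, 0 < r → r ≤ 1 → ∀ p ∈ Metric.sphere (0 : EuclideanSpace ℝ (Fin n)) 1,
    r * |g p (((n : ℝ) - 1) / r + K)| ≤ G ∧ r * |g p (-(((n : ℝ) - 1) / r + K))| ≤ G

section operator
variable {n : ℕ} {σ : EuclideanSpace ℝ (Fin n) → ℝ} {g f : EuclideanSpace ℝ (Fin n) → ℝ → ℝ}
  {T lamMinus lamPlus Lg Lf K G : ℝ}

lemma inv_norm_smul_mem_sphere {p : EuclideanSpace ℝ (Fin n)} (hp : p ≠ 0) :
    ‖p‖⁻¹ • p ∈ Metric.sphere (0 : EuclideanSpace ℝ (Fin n)) 1 := by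
  simp [norm_smul, hp]

lemma levelSetOp_smul (hσ : ∀ (a : ℝ) (x : EuclideanSpace ℝ (Fin n)), 0 < a → σ (a • x) = a * σ x)
    {a : ℝ} (ha : 0 < a) (x : EuclideanSpace ℝ (Fin n)) (t : ℝ) (p : EuclideanSpace ℝ (Fin n))
    (X : EuclideanSpace ℝ (Fin n) →L[ℝ] EuclideanSpace ℝ (Fin n)) :
    levelSetOp σ g f (x, t, a • p, a • X) = a * levelSetOp σ g f (x, t, p, X) := by
  have h1 : (hessian σ (a • p)).comp (a • X) = (hessian σ p).comp X := by
    rw [hessian_smul_of_homogeneous hσ ha, ContinuousLinearMap.smul_comp,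
      ContinuousLinearMap.comp_smul, smul_smul, inv_mul_cancel₀ ha.ne', one_smul]
  have h2 : ‖a • p‖ = a * ‖p‖ := by rw [norm_smul, Real.norm_eq_abs, abs_of_pos ha]
  have h3 : (a * ‖p‖)⁻¹ • a • p = ‖p‖⁻¹ • p := by
    rw [smul_smul, mul_inv, mul_comm a⁻¹, mul_assoc, inv_mul_cancel₀ ha.ne', mul_one]
  simp only [levelSetOp, h1, h2, h3]
  ring

lemma IsAdmissible.continuousAt_levelSetOp (h : IsAdmissible σ g f T lamMinus lamPlus Lg Lf K G)
    {x : EuclideanSpace ℝ (Fin n)} {t : ℝ} (ht : t ∈ Ioo 0 T) {p : EuclideanSpace ℝ (Fin n)}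
    (hp : p ≠ 0) (X : EuclideanSpace ℝ (Fin n) →L[ℝ] EuclideanSpace ℝ (Fin n)) :
    ContinuousAt (levelSetOp σ g f) (x, t, p, X) := by
  have hpn : ContinuousAt (fun z : JetSpace n => z.2.2.1) (x, t, p, X) := by fun_prop
  have hX : ContinuousAt (fun z : JetSpace n => z.2.2.2) (x, t, p, X) := by fun_prop
  have hdir : ContinuousAt (fun z : JetSpace n => ‖z.2.2.1‖⁻¹ • z.2.2.1) (x, t, p, X) :=
    (hpn.norm.inv₀ (norm_ne_zero_iff.2 hp)).smul hpn
  have hf : ContinuousAt (fun z : JetSpace n => f z.1 z.2.1) (x, t, p, X) := by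
    have h1 : ContinuousAt (fun z : EuclideanSpace ℝ (Fin n) × ℝ => f z.1 z.2) (x, t) :=
      h.f_cont.continuousAt (prod_mem_nhds univ_mem (Icc_mem_nhds ht.1 ht.2))
    have h2 : ContinuousAt (fun z : JetSpace n => (z.1, z.2.1)) (x, t, p, X) := by fun_prop
    exact ContinuousAt.comp (f := fun z : JetSpace n => (z.1, z.2.1))
      (g := fun z : EuclideanSpace ℝ (Fin n) × ℝ => f z.1 z.2) (x := (x, t, p, X)) h1 h2
  have htr : ContinuousAt (fun z : JetSpace n => LinearMap.trace ℝ (EuclideanSpace ℝ (Fin n))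
      ((hessian σ z.2.2.1).comp z.2.2.2).toLinearMap) (x, t, p, X) := by
    have h1 : ContinuousAt (fun z : JetSpace n => hessian σ z.2.2.1) (x, t, p, X) :=
      ContinuousAt.comp (g := hessian σ)
        (continuousAt_hessian (h.smooth.contDiffAt_compl_zero hp)) hpn
    exact continuous_trace_toLinearMap.continuousAt.comp (h1.clm_comp hX)
  have hne : ∀ᶠ z : JetSpace n in 𝓝 (x, t, p, X), z.2.2.1 ≠ 0 := hpn.eventually_ne hp
  have hg : ContinuousAt (fun z : JetSpace n => g (‖z.2.2.1‖⁻¹ • z.2.2.1)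
      (-(LinearMap.trace ℝ (EuclideanSpace ℝ (Fin n))
        ((hessian σ z.2.2.1).comp z.2.2.2).toLinearMap) + f z.1 z.2.1)) (x, t, p, X) := by
    have h1 := h.g_cont _ (⟨inv_norm_smul_mem_sphere hp, mem_univ
      (-(LinearMap.trace ℝ (EuclideanSpace ℝ (Fin n))
        ((hessian σ p).comp X).toLinearMap) + f x t)⟩ :
      (_, _) ∈ Metric.sphere (0 : EuclideanSpace ℝ (Fin n)) 1 ×ˢ (univ : Set ℝ))
    refine Tendsto.comp h1 (tendsto_nhdsWithin_iff.2
      ⟨hdir.prodMk (htr.neg.add hf), ?_⟩)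
    filter_upwards [hne] with z hz using ⟨inv_norm_smul_mem_sphere hz, mem_univ _⟩
  exact hpn.norm.mul hg

lemma IsAdmissible.lipConst_nonneg (h : IsAdmissible σ g f T lamMinus lamPlus Lg Lf K G)
    {p : EuclideanSpace ℝ (Fin n)} (hp : p ≠ 0) : 0 ≤ Lg := by
  have := (abs_nonneg _).trans (h.g_lip _ (inv_norm_smul_mem_sphere hp) 1 0)
  simpa using this

/-- Linear growth of the operator: the singularity of `∇²σ` at the origin is compensated by the
factor `‖p‖`. -/
lemma IsAdmissible.exists_abs_levelSetOp_le
    (h : IsAdmissible σ g f T lamMinus lamPlus Lg Lf K G) :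
    ∃ C c : ℝ, 0 ≤ c ∧ ∀ (x : EuclideanSpace ℝ (Fin n)) (t : ℝ) (p : EuclideanSpace ℝ (Fin n))
      (X : EuclideanSpace ℝ (Fin n) →L[ℝ] EuclideanSpace ℝ (Fin n)), t ∈ Icc 0 T → p ≠ 0 →
      |levelSetOp σ g f (x, t, p, X)| ≤ C * ‖p‖ + c * ‖X‖ := by
  by_cases hE : ∀ p : EuclideanSpace ℝ (Fin n), p = 0
  · exact ⟨0, 0, le_rfl, fun _ _ p _ _ hp => absurd (hE p) hp⟩
  push Not at hE
  obtain ⟨p₁, hp₁⟩ := hE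
  have hLg := h.lipConst_nonneg hp₁
  obtain ⟨cσ, hcσ0, hcσ⟩ := exists_norm_hessian_le h.smooth h.homog
  obtain ⟨ct, hct0, hct⟩ := exists_abs_trace_le (V := EuclideanSpace ℝ (Fin n))
  refine ⟨G + Lg * (2 * K + |(n : ℝ) - 1|), Lg * (ct * cσ), by positivity, ?_⟩
  intro x t p X ht hp
  have hs := inv_norm_smul_mem_sphere hp
  set τ := LinearMap.trace ℝ (EuclideanSpace ℝ (Fin n)) ((hessian σ p).comp X).toLinearMap with hτ
  have hτb : ‖p‖ * |τ| ≤ ct * cσ * ‖X‖ := by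
    have h1 := hct ((hessian σ p).comp X)
    have h2 := (hessian σ p).opNorm_comp_le X
    calc ‖p‖ * |τ| ≤ ‖p‖ * (ct * (‖hessian σ p‖ * ‖X‖)) := by gcongr; exact h1.trans (by gcongr)
      _ = ct * (‖p‖ * ‖hessian σ p‖) * ‖X‖ := by ring
      _ ≤ ct * cσ * ‖X‖ := by gcongr; exact hcσ p hp
  set m : ℝ := ((n : ℝ) - 1) + K with hm
  have hg1 : |g (‖p‖⁻¹ • p) m| ≤ G := by
    have := (h.growth 1 one_pos le_rfl _ hs).1
    simpa using this
  have hf1 := h.f_le t ht x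
  have hdiff : |(-τ + f x t) - m| ≤ |τ| + (2 * K + |(n : ℝ) - 1|) := by
    rw [hm]
    have h1 := abs_le.1 hf1
    have h2 := neg_abs_le τ
    have h3 := le_abs_self τ
    have h4 := neg_abs_le ((n : ℝ) - 1)
    have h5 := le_abs_self ((n : ℝ) - 1)
    exact abs_le.2 ⟨by linarith, by linarith⟩
  have hg2 : |g (‖p‖⁻¹ • p) (-τ + f x t)| ≤ G + Lg * (|τ| + (2 * K + |(n : ℝ) - 1|)) := by
    have h1 := (h.g_lip _ hs (-τ + f x t) m).trans (mul_le_mul_of_nonneg_left hdiff hLg)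
    have h2 := abs_add_le (g (‖p‖⁻¹ • p) (-τ + f x t) - g (‖p‖⁻¹ • p) m) (g (‖p‖⁻¹ • p) m)
    rw [sub_add_cancel] at h2
    linarith
  have e : levelSetOp σ g f (x, t, p, X) = ‖p‖ * g (‖p‖⁻¹ • p) (-τ + f x t) := rfl
  rw [e, abs_mul, abs_norm]
  calc ‖p‖ * |g (‖p‖⁻¹ • p) (-τ + f x t)|
      ≤ ‖p‖ * (G + Lg * (|τ| + (2 * K + |(n : ℝ) - 1|))) := by gcongr
    _ = (G + Lg * (2 * K + |(n : ℝ) - 1|)) * ‖p‖ + Lg * (‖p‖ * |τ|) := by ring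
    _ ≤ (G + Lg * (2 * K + |(n : ℝ) - 1|)) * ‖p‖ + Lg * (ct * cσ * ‖X‖) := by gcongr
    _ = _ := by ring

lemma le_of_lowerEnvelope_le {F : JetSpace n → ℝ} {z : JetSpace n} {a b : ℝ}
    (h : ∀ᶠ w in 𝓝[regularJets n] z, a ≤ F w) (hb : lowerEnvelope F z ≤ (b : EReal)) : a ≤ b := by
  have h1 : (a : EReal) ≤ lowerEnvelope F z := by
    refine le_liminf_of_le (by isBoundedDefault) ?_
    filter_upwards [h] with w hw using EReal.coe_le_coe_iff.2 hw
  exact EReal.coe_le_coe_iff.1 (h1.trans hb)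

lemma IsAdmissible.levelSetOp_le_of_lowerEnvelope_le
    (h : IsAdmissible σ g f T lamMinus lamPlus Lg Lf K G) {x : EuclideanSpace ℝ (Fin n)} {t : ℝ}
    (ht : t ∈ Ioo 0 T) {p : EuclideanSpace ℝ (Fin n)} (hp : p ≠ 0)
    {X : EuclideanSpace ℝ (Fin n) →L[ℝ] EuclideanSpace ℝ (Fin n)} {b : ℝ}
    (hb : lowerEnvelope (levelSetOp σ g f) (x, t, p, X) ≤ (b : EReal)) :
    levelSetOp σ g f (x, t, p, X) ≤ b := by
  refine le_of_forall_lt fun a ha => ?_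
  obtain ⟨a', haa', ha'⟩ := exists_between ha
  refine haa'.trans_le (le_of_lowerEnvelope_le ?_ hb)
  exact ((h.continuousAt_levelSetOp ht hp X).eventually (lt_mem_nhds ha')).filter_mono
    nhdsWithin_le_nhds |>.mono fun _ hw => hw.le

/-- At zero slope the lower envelope is at least of the order of the Hessian; in particular it is
nonnegative at zero slope and zero Hessian. -/
lemma IsAdmissible.exists_neg_le_of_lowerEnvelope_le
    (h : IsAdmissible σ g f T lamMinus lamPlus Lg Lf K G) :
    ∃ c, 0 ≤ c ∧ ∀ (x : EuclideanSpace ℝ (Fin n)) (t : ℝ)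
      (X : EuclideanSpace ℝ (Fin n) →L[ℝ] EuclideanSpace ℝ (Fin n)) (b : ℝ), t ∈ Ioo 0 T →
      lowerEnvelope (levelSetOp σ g f) (x, t, 0, X) ≤ (b : EReal) → -(c * ‖X‖) ≤ b := by
  obtain ⟨C, c, hc, hbound⟩ := h.exists_abs_levelSetOp_le
  refine ⟨c, hc, fun x t X b ht hb => le_of_forall_lt fun a ha => ?_⟩
  obtain ⟨a', haa', ha'⟩ := exists_between ha
  refine haa'.trans_le (le_of_lowerEnvelope_le ?_ hb)
  have hcont : ContinuousAt (fun w : JetSpace n => -(C * ‖w.2.2.1‖ + c * ‖w.2.2.2‖))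
      (x, t, 0, X) := by fun_prop
  have h1 : ∀ᶠ w : JetSpace n in 𝓝 (x, t, 0, X), a' < -(C * ‖w.2.2.1‖ + c * ‖w.2.2.2‖) :=
    hcont.eventually (lt_mem_nhds (by simpa using ha'))
  have h2 : ∀ᶠ w : JetSpace n in 𝓝 (x, t, 0, X), w.2.1 ∈ Ioo 0 T := by
    have : ContinuousAt (fun w : JetSpace n => w.2.1) (x, t, 0, X) := by fun_prop
    exact this.eventually (isOpen_Ioo.mem_nhds ht)
  filter_upwards [nhdsWithin_le_nhds h1, nhdsWithin_le_nhds h2, self_mem_nhdsWithin]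
    with w hw1 hw2 hw3
  have := hbound w.1 w.2.1 w.2.2.1 w.2.2.2 (Ioo_subset_Icc_self hw2) hw3.1
  have := (abs_le.1 this).1
  exact hw1.le.trans this

end operator

/-! ### Reflection: supersolutions as subsolutions -/

section reflection
variable {n : ℕ} {σ : EuclideanSpace ℝ (Fin n) → ℝ} {g f : EuclideanSpace ℝ (Fin n) → ℝ → ℝ}
  {T lamMinus lamPlus Lg Lf K G : ℝ}

lemma fderiv_comp_neg' {V W : Type*} [NormedAddCommGroup V] [NormedSpace ℝ V]
    [NormedAddCommGroup W] [NormedSpace ℝ W] (ψ : V → W) (p : V) :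
    fderiv ℝ (fun x => ψ (-x)) p = -fderiv ℝ ψ (-p) := by
  have := fderiv_comp_smul (𝕜 := ℝ) (f := ψ) (x := p) (-1)
  simpa using this

lemma hessian_comp_neg (p : EuclideanSpace ℝ (Fin n)) :
    hessian (fun x => σ (-x)) p = hessian σ (-p) := by
  have h1 : gradient (fun x => σ (-x)) = fun x => -gradient σ (-x) := by
    ext1 x
    rw [gradient, gradient, fderiv_comp_neg' σ, map_neg]
  rw [hessian, h1, fderiv_fun_neg, fderiv_comp_neg' (gradient σ), neg_neg]
  rfl

lemma levelSetOp_reflect (z : JetSpace n) :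
    levelSetOp (fun x => σ (-x)) (fun p ξ => -g (-p) (-ξ)) (fun x t => -f x t) z =
      -levelSetOp σ g f (z.1, z.2.1, -z.2.2.1, -z.2.2.2) := by
  have h1 : (hessian σ (-z.2.2.1)).comp (-z.2.2.2) = -(hessian σ (-z.2.2.1)).comp z.2.2.2 := by
    ext; simp
  have h2 : (-(hessian σ (-z.2.2.1)).comp z.2.2.2).toLinearMap =
      -((hessian σ (-z.2.2.1)).comp z.2.2.2).toLinearMap := rfl
  simp only [levelSetOp, hessian_comp_neg, norm_neg, smul_neg, h1, h2, map_neg, neg_neg, mul_neg,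
    neg_add]

lemma IsAdmissible.reflect (h : IsAdmissible σ g f T lamMinus lamPlus Lg Lf K G) :
    IsAdmissible (fun x => σ (-x)) (fun p ξ => -g (-p) (-ξ)) (fun x t => -f x t) T lamMinus lamPlus
      Lg Lf K G := by
  have hneg : ∀ p ∈ Metric.sphere (0 : EuclideanSpace ℝ (Fin n)) 1,
      -p ∈ Metric.sphere (0 : EuclideanSpace ℝ (Fin n)) 1 := fun p hp => by simpa using hp
  refine ⟨?_, ?_, fun a x ha => ?_, fun x => ?_, ?_, fun p hp ξ η => ?_, fun p hp ξ η hξη => ?_, ?_,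
    fun t ht x y => ?_, fun t ht x => ?_, fun r hr hr1 p hp => ?_⟩
  · exact h.smooth.comp contDiff_neg.contDiffOn fun x hx => by simpa using hx
  · have := h.convex.comp_linearMap (-LinearMap.id)
    simpa [Function.comp_def] using this
  · rw [← smul_neg, h.homog a _ ha]
  · have := h.bounds (-x)
    rwa [norm_neg] at this
  · have hc : Continuous fun z : EuclideanSpace ℝ (Fin n) × ℝ => (-z.1, -z.2) := by fun_prop
    exact (h.g_cont.comp hc.continuousOn fun z hz => ⟨hneg _ hz.1, mem_univ _⟩).neg
  · have := h.g_lip _ (hneg p hp) (-ξ) (-η)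
    rw [← abs_neg, ← abs_neg (ξ - η)]
    convert this using 3 <;> ring
  · exact neg_le_neg (h.g_mono _ (hneg p hp) (neg_le_neg hξη))
  · exact h.f_cont.neg
  · have := h.f_lip t ht x y
    rw [← abs_neg]
    convert this using 2
    ring
  · rw [abs_neg]; exact h.f_le t ht x
  · have := h.growth r hr hr1 _ (hneg p hp)
    rw [abs_neg, abs_neg, neg_neg]
    exact this.symm

/-- The reflection `(x, t, p, X) ↦ (x, t, -p, -X)` of jets. -/
def reflectJet (z : JetSpace n) : JetSpace n := (z.1, z.2.1, -z.2.2.1, -z.2.2.2)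

lemma reflectJet_reflectJet (z : JetSpace n) : reflectJet (reflectJet z) = z := by
  simp only [reflectJet, neg_neg]

lemma continuous_reflectJet : Continuous (reflectJet (n := n)) := by
  unfold reflectJet; fun_prop

lemma reflectJet_mem_regularJets {z : JetSpace n} (hz : z ∈ regularJets n) :
    reflectJet z ∈ regularJets n := by
  refine ⟨neg_ne_zero.2 hz.1, fun a b => ?_⟩
  have h1 : ⟪z.2.2.2 a, b⟫_ℝ = ⟪a, z.2.2.2 b⟫_ℝ := hz.2 a b
  change ⟪-(z.2.2.2 a), b⟫_ℝ = ⟪a, -(z.2.2.2 b)⟫_ℝ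
  rw [inner_neg_left, inner_neg_right, h1]

lemma nhdsWithin_regularJets_reflectJet_le (z : JetSpace n) :
    𝓝[regularJets n] (reflectJet z) ≤ map reflectJet (𝓝[regularJets n] z) := by
  have h2 : Tendsto reflectJet (𝓝[regularJets n] (reflectJet z)) (𝓝[regularJets n] z) := by
    refine tendsto_nhdsWithin_iff.2 ⟨?_, ?_⟩
    · have := (continuous_reflectJet.tendsto (reflectJet z)).mono_left
        (nhdsWithin_le_nhds (s := regularJets n))
      rwa [reflectJet_reflectJet] at this
    · filter_upwards [self_mem_nhdsWithin] with w hw using reflectJet_mem_regularJets hw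
  have h3 := Filter.map_mono (m := reflectJet) h2
  rw [Filter.map_map] at h3
  have : reflectJet ∘ reflectJet = (id : JetSpace n → JetSpace n) := by
    ext1 z; exact reflectJet_reflectJet z
  rwa [this, Filter.map_id] at h3

lemma testJet_neg (φ : EuclideanSpace ℝ (Fin n) × ℝ → ℝ) (x : EuclideanSpace ℝ (Fin n))
    (t : ℝ) : testJet (-φ) x t = reflectJet (testJet φ x t) := by
  have hg : gradient (fun y => (-φ) (y, t)) = fun y => -gradient (fun y => φ (y, t)) y := by
    ext1 y
    have : (fun y => (-φ) (y, t)) = fun y => -φ (y, t) := rfl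
    rw [gradient, this, fderiv_fun_neg, map_neg]; rfl
  have hh : hessian (fun y => (-φ) (y, t)) x = -hessian (fun y => φ (y, t)) x := by
    rw [hessian, hg, fderiv_fun_neg]; rfl
  have hgx : gradient (fun y => (-φ) (y, t)) x = -gradient (fun y => φ (y, t)) x := congrFun hg x
  rw [testJet, hgx, hh]; rfl

/-- The negative of a supersolution is a subsolution for the reflected data. -/
lemma IsViscositySupersolution.neg {u : EuclideanSpace ℝ (Fin n) → ℝ → ℝ}
    (hu : IsViscositySupersolution (levelSetOp σ g f) T u) :
    IsViscositySubsolution (levelSetOp (fun x => σ (-x)) (fun p ξ => -g (-p) (-ξ))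
      (fun x t => -f x t)) T (fun x t => -u x t) := by
  refine ⟨fun z hz b hb => ?_, fun φ hφ x t ht hmax => ?_⟩
  · have := hu.1 z hz (-b) (by simp only at hb; linarith)
    filter_upwards [this] with w hw
    linarith
  · have hmin : IsLocalMin (fun z : EuclideanSpace ℝ (Fin n) × ℝ => u z.1 z.2 - (-φ) z) (x, t) := by
      filter_upwards [hmax] with w hw
      simp only [Pi.neg_apply] at hw ⊢
      linarith
    have h1 := hu.2 (-φ) hφ.neg x t ht hmin
    have hderiv : deriv (fun s => (-φ) (x, s)) t = -deriv (fun s => φ (x, s)) t := by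
      have : (fun s => (-φ) (x, s)) = fun s => -φ (x, s) := rfl
      rw [this, deriv.fun_neg]
    rw [testJet_neg, hderiv, neg_neg] at h1
    have h4 : upperEnvelope (levelSetOp σ g f) (reflectJet (testJet φ x t)) ≤
        limsup ((fun w => ((levelSetOp σ g f w : ℝ) : EReal)) ∘ reflectJet)
          (𝓝[regularJets n] testJet φ x t) := by
      rw [limsup_comp]
      exact limsup_le_limsup_of_le (nhdsWithin_regularJets_reflectJet_le _)
    have h5 : lowerEnvelope (levelSetOp (fun x => σ (-x)) (fun p ξ => -g (-p) (-ξ))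
        (fun x t => -f x t)) (testJet φ x t) =
        -limsup ((fun w => ((levelSetOp σ g f w : ℝ) : EReal)) ∘ reflectJet)
          (𝓝[regularJets n] testJet φ x t) := by
      rw [← EReal.liminf_neg, lowerEnvelope]
      congr 1
      ext1 w
      rw [levelSetOp_reflect, EReal.coe_neg]; rfl
    rw [h5, EReal.coe_neg, EReal.neg_le_neg_iff]
    exact h1.trans h4

end reflection
end

section
open scoped InnerProductSpace NNReal ENNReal

/-! ### Superjets of subsolutions -/

/-- Space-time `ℝⁿ × ℝ` with its Euclidean structure. -/
abbrev SpaceTime (n : ℕ) : Type := WithLp 2 (EuclideanSpace ℝ (Fin n) × ℝ)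

/-- The closed slab `ℝⁿ × [0, T]`. -/
def slab (n : ℕ) (T : ℝ) : Set (SpaceTime n) := {z | z.snd ∈ Icc 0 T}

/-- The inclusion `x ↦ (x, 0)` of space into space-time. -/
def spaceIncl (n : ℕ) : EuclideanSpace ℝ (Fin n) →L[ℝ] SpaceTime n :=
  ((WithLp.prodContinuousLinearEquiv 2 ℝ (EuclideanSpace ℝ (Fin n)) ℝ).symm :
    EuclideanSpace ℝ (Fin n) × ℝ →L[ℝ] SpaceTime n).comp
      (ContinuousLinearMap.inl ℝ (EuclideanSpace ℝ (Fin n)) ℝ)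

/-- The spatial block of a space-time Hessian. -/
def spatialBlock {n : ℕ} (A : SpaceTime n →L[ℝ] SpaceTime n) :
    EuclideanSpace ℝ (Fin n) →L[ℝ] EuclideanSpace ℝ (Fin n) :=
  (WithLp.fstL 2 ℝ (EuclideanSpace ℝ (Fin n)) ℝ).comp (A.comp (spaceIncl n))

section testing
variable {n : ℕ}

lemma inner_spaceIncl (P : SpaceTime n) (ξ : EuclideanSpace ℝ (Fin n)) :
    ⟪P, spaceIncl n ξ⟫_ℝ = ⟪P.fst, ξ⟫_ℝ := by
  simp [spaceIncl]

lemma inner_spatialBlock (A : SpaceTime n →L[ℝ] SpaceTime n) (ξ η : EuclideanSpace ℝ (Fin n)) :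
    ⟪spatialBlock A ξ, η⟫_ℝ = ⟪A (spaceIncl n ξ), spaceIncl n η⟫_ℝ := by
  rw [inner_spaceIncl]; rfl

lemma norm_spaceIncl (ξ : EuclideanSpace ℝ (Fin n)) : ‖spaceIncl n ξ‖ = ‖ξ‖ := by
  have h : ‖spaceIncl n ξ‖ ^ 2 = ‖ξ‖ ^ 2 := by
    rw [← real_inner_self_eq_norm_sq, inner_spaceIncl, ← real_inner_self_eq_norm_sq]; rfl
  exact (sq_eq_sq₀ (norm_nonneg _) (norm_nonneg _)).1 h

lemma isSymmetric_spatialBlock {A : SpaceTime n →L[ℝ] SpaceTime n}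
    (hA : (A : SpaceTime n →ₗ[ℝ] SpaceTime n).IsSymmetric) :
    (spatialBlock A : EuclideanSpace ℝ (Fin n) →ₗ[ℝ] EuclideanSpace ℝ (Fin n)).IsSymmetric := by
  intro a b
  have h1 : ⟪A (spaceIncl n a), spaceIncl n b⟫_ℝ = ⟪spaceIncl n a, A (spaceIncl n b)⟫_ℝ := hA _ _
  change ⟪spatialBlock A a, b⟫_ℝ = ⟪a, spatialBlock A b⟫_ℝ
  rw [real_inner_comm (spatialBlock A b) a, inner_spatialBlock, inner_spatialBlock, h1,
    real_inner_comm]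

lemma continuous_spatialBlock : Continuous (spatialBlock (n := n)) := by
  unfold spatialBlock; fun_prop

lemma isClosed_slab (T : ℝ) : IsClosed (slab n T) :=
  isClosed_Icc.preimage (WithLp.sndL 2 ℝ (EuclideanSpace ℝ (Fin n)) ℝ).continuous

/-- Gradient and Hessian of a quadratic polynomial. -/
lemma gradient_hessian_quadratic (a : ℝ) (x₀ p : EuclideanSpace ℝ (Fin n))
    {X : EuclideanSpace ℝ (Fin n) →L[ℝ] EuclideanSpace ℝ (Fin n)}
    (hX : (X : EuclideanSpace ℝ (Fin n) →ₗ[ℝ] EuclideanSpace ℝ (Fin n)).IsSymmetric) :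
    gradient (fun y => a + ⟪p, y - x₀⟫_ℝ + 1 / 2 * ⟪X (y - x₀), y - x₀⟫_ℝ) x₀ = p ∧
    hessian (fun y => a + ⟪p, y - x₀⟫_ℝ + 1 / 2 * ⟪X (y - x₀), y - x₀⟫_ℝ) x₀ = X := by
  have hg : gradient (fun y => a + ⟪p, y - x₀⟫_ℝ + 1 / 2 * ⟪X (y - x₀), y - x₀⟫_ℝ) =
      fun y => p + X (y - x₀) := by
    refine gradient_eq fun y => ?_
    rw [hasGradientAt_iff_hasFDerivAt]
    have h0 : HasFDerivAt (fun y : EuclideanSpace ℝ (Fin n) => y - x₀)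
        (ContinuousLinearMap.id ℝ _) y := (hasFDerivAt_id y).sub_const x₀
    have h1 := (((hasFDerivAt_const p y).inner ℝ h0).const_add a).add
      (((X.hasFDerivAt.comp y h0).inner ℝ h0).const_mul (1 / 2))
    refine h1.congr_fderiv ?_
    ext ξ
    have h2 : ⟪X ξ, y - x₀⟫_ℝ = ⟪X (y - x₀), ξ⟫_ℝ := by
      rw [real_inner_comm]; exact (hX _ _).symm
    simp only [Function.comp, InnerProductSpace.toDual_apply_apply, _root_.add_apply,
      ContinuousLinearMap.comp_apply, _root_.smul_apply, fderivInnerCLM_apply,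
      ContinuousLinearMap.prod_apply, ContinuousLinearMap.id_apply, inner_add_left, h2,
      _root_.zero_apply, inner_zero_left, smul_eq_mul, add_zero]
    ring
  refine ⟨by rw [hg]; simp, ?_⟩
  rw [hessian, hg, fderiv_const_add]
  have h0 : HasFDerivAt (fun y : EuclideanSpace ℝ (Fin n) => y - x₀)
    (ContinuousLinearMap.id ℝ _) x₀ := (hasFDerivAt_id x₀).sub_const x₀
  exact (X.hasFDerivAt.comp x₀ h0).fderiv

/-- Superjets of `w` are test functions for a subsolution of the form `c(t) + e(t) w`. -/
lemma IsViscositySubsolution.lowerEnvelope_le_of_hasSuperjet {F : JetSpace n → ℝ} {T : ℝ}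
    {u : EuclideanSpace ℝ (Fin n) → ℝ → ℝ} (hu : IsViscositySubsolution F T u) {c e : ℝ → ℝ}
    (hc : ContDiff ℝ 2 c) (he : ContDiff ℝ 2 e) (he0 : ∀ t, 0 < e t) {w : SpaceTime n → ℝ}
    (huw : ∀ z ∈ slab n T, u z.fst z.snd = c z.snd + e z.snd * w z) {z P : SpaceTime n}
    {A : SpaceTime n →L[ℝ] SpaceTime n} (hz : z.snd ∈ Ioo 0 T)
    (hA : (A : SpaceTime n →ₗ[ℝ] SpaceTime n).IsSymmetric) (h : HasSuperjet (slab n T) w z P A)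
    {ε : ℝ} (hε : 0 < ε) :
    lowerEnvelope F (z.fst, z.snd, e z.snd • P.fst,
      e z.snd • (spatialBlock A + (2 * ε) • ContinuousLinearMap.id ℝ _)) ≤
      ((-(deriv c z.snd + deriv e z.snd * w z + e z.snd * P.snd) : ℝ) : EReal) := by
  set L : (EuclideanSpace ℝ (Fin n) × ℝ) ≃L[ℝ] SpaceTime n :=
    (WithLp.prodContinuousLinearEquiv 2 ℝ (EuclideanSpace ℝ (Fin n)) ℝ).symm with hL
  have hLz : L (z.fst, z.snd) = z := rfl
  set Q : SpaceTime n → ℝ := fun ζ => w z + ⟪P, ζ⟫_ℝ + 1 / 2 * ⟪A ζ, ζ⟫_ℝ + ε * ‖ζ‖ ^ 2 with hQ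
  set φ : EuclideanSpace ℝ (Fin n) × ℝ → ℝ := fun q => c q.2 + e q.2 * Q (L q - z) with hφ
  have hφC : ContDiff ℝ 2 φ := by
    have h1 : ContDiff ℝ 2 fun q : EuclideanSpace ℝ (Fin n) × ℝ => L q - z :=
      L.contDiff.sub contDiff_const
    have h2 : ContDiff ℝ 2 fun q : EuclideanSpace ℝ (Fin n) × ℝ => A (L q - z) :=
      A.contDiff.comp h1
    exact (hc.comp contDiff_snd).add ((he.comp contDiff_snd).mul
      (((contDiff_const.add (contDiff_const.inner ℝ h1)).add
        (contDiff_const.mul (h2.inner ℝ h1))).add (contDiff_const.mul (h1.norm_sq ℝ))))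
  have hmax : IsLocalMax (fun q : EuclideanSpace ℝ (Fin n) × ℝ => u q.1 q.2 - φ q)
      (z.fst, z.snd) := by
    have hlim : Tendsto (fun q => L q - z) (𝓝 (z.fst, z.snd)) (𝓝 0) := by
      have : Continuous fun q => L q - z := by fun_prop
      have h2 := this.tendsto (z.fst, z.snd)
      rwa [hLz, sub_self] at h2
    have htime : ∀ᶠ q : EuclideanSpace ℝ (Fin n) × ℝ in 𝓝 (z.fst, z.snd), q.2 ∈ Ioo 0 T :=
      continuousAt_snd.eventually (isOpen_Ioo.mem_nhds hz)
    filter_upwards [hlim.eventually (h ε hε), htime] with q hq hqt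
    have hmem : L q ∈ slab n T := Ioo_subset_Icc_self hqt
    rw [add_sub_cancel] at hq
    have h1 := hq hmem
    have h2 : u q.1 q.2 = c q.2 + e q.2 * w (L q) := huw _ hmem
    have h3 := huw z (Ioo_subset_Icc_self hz)
    have h4 := mul_le_mul_of_nonneg_left h1 (he0 q.2).le
    simp only [hφ, hQ, hLz, sub_self, h2, h3, map_zero, inner_zero_right, norm_zero]
    simp only [ne_eq, OfNat.ofNat_ne_zero, not_false_eq_true, zero_pow, mul_zero, add_zero]
    linarith
  have key := hu.2 φ hφC z.fst z.snd hz hmax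
  -- the spatial slice of `φ` is a quadratic polynomial
  have hsp : ∀ y, L (y, z.snd) - z = spaceIncl n (y - z.fst) := by
    intro y
    calc L (y, z.snd) - z = L (y, z.snd) - L (z.fst, z.snd) := rfl
      _ = L ((y, z.snd) - (z.fst, z.snd)) := (map_sub L _ _).symm
      _ = spaceIncl n (y - z.fst) := by rw [Prod.mk_sub_mk, sub_self]; rfl
  set X : EuclideanSpace ℝ (Fin n) →L[ℝ] EuclideanSpace ℝ (Fin n) :=
    e z.snd • (spatialBlock A + (2 * ε) • ContinuousLinearMap.id ℝ _) with hX
  have hXapp : ∀ ξ, X ξ = e z.snd • (spatialBlock A ξ + (2 * ε) • ξ) := fun ξ => rfl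
  have hslice : (fun y => φ (y, z.snd)) = fun y => (c z.snd + e z.snd * w z) +
      ⟪e z.snd • P.fst, y - z.fst⟫_ℝ + 1 / 2 * ⟪X (y - z.fst), y - z.fst⟫_ℝ := by
    ext1 y
    simp only [hφ, hQ, hsp, norm_spaceIncl, inner_smul_left, hXapp,
      RCLike.conj_to_real, inner_add_left, inner_spatialBlock, real_inner_self_eq_norm_sq]
    rw [inner_spaceIncl P]
    ring
  have hsym : (X : EuclideanSpace ℝ (Fin n) →ₗ[ℝ] EuclideanSpace ℝ (Fin n)).IsSymmetric := by
    intro a b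
    have h1 : ⟪spatialBlock A a, b⟫_ℝ = ⟪a, spatialBlock A b⟫_ℝ := isSymmetric_spatialBlock hA a b
    change ⟪X a, b⟫_ℝ = ⟪a, X b⟫_ℝ
    simp only [hXapp, inner_smul_left, inner_smul_right, inner_add_left, inner_add_right, h1,
      RCLike.conj_to_real]
  have hgh := gradient_hessian_quadratic (c z.snd + e z.snd * w z) z.fst (e z.snd • P.fst) hsym
  have hjet : testJet φ z.fst z.snd = (z.fst, z.snd, e z.snd • P.fst, X) := by
    rw [testJet, hslice, hgh.1, hgh.2]
  -- the time slice
  set τ : SpaceTime n := L (0, 1) with hτ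
  have htm : ∀ s, L (z.fst, s) - z = (s - z.snd) • τ := by
    intro s
    calc L (z.fst, s) - z = L (z.fst, s) - L (z.fst, z.snd) := rfl
      _ = L ((z.fst, s) - (z.fst, z.snd)) := (map_sub L _ _).symm
      _ = (s - z.snd) • τ := by rw [hτ, ← map_smul]; simp
  have hPτ : ⟪P, τ⟫_ℝ = P.snd := by
    simp [hτ, hL]
  have hderiv : deriv (fun s => φ (z.fst, s)) z.snd =
      deriv c z.snd + deriv e z.snd * w z + e z.snd * P.snd := by
    have h1 : HasDerivAt c (deriv c z.snd) z.snd :=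
      (hc.differentiable (by norm_num) _).hasDerivAt
    have h2 : HasDerivAt e (deriv e z.snd) z.snd :=
      (he.differentiable (by norm_num) _).hasDerivAt
    have h3 : (fun s => φ (z.fst, s)) = fun s => c s + e s * (w z + (s - z.snd) * P.snd +
        (1 / 2 * ⟪A τ, τ⟫_ℝ + ε * ‖τ‖ ^ 2) * (s - z.snd) ^ 2) := by
      ext1 s
      simp only [hφ, hQ, htm, inner_smul_right, hPτ, map_smul, inner_smul_left, norm_smul,
        RCLike.conj_to_real, mul_pow, Real.norm_eq_abs, sq_abs]
      ring
    have h4 : HasDerivAt (fun s => w z + (s - z.snd) * P.snd +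
        (1 / 2 * ⟪A τ, τ⟫_ℝ + ε * ‖τ‖ ^ 2) * (s - z.snd) ^ 2) P.snd z.snd := by
      have h5 : HasDerivAt (fun s : ℝ => s - z.snd) 1 z.snd := (hasDerivAt_id _).sub_const _
      refine ((((h5.mul_const P.snd).const_add (w z))).add ((h5.pow 2).const_mul
        (1 / 2 * ⟪A τ, τ⟫_ℝ + ε * ‖τ‖ ^ 2))).congr_deriv ?_
      simp
    rw [h3]
    refine (HasDerivAt.congr_deriv (h1.add (h2.mul h4)) ?_).deriv
    simp
    ring
  rw [hjet, hderiv] at key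
  exact key

variable {σ : EuclideanSpace ℝ (Fin n) → ℝ} {g f : EuclideanSpace ℝ (Fin n) → ℝ → ℝ}
  {T lamMinus lamPlus Lg Lf K G : ℝ}

/-- The differential inequality at superjets with nonzero spatial slope. -/
lemma IsViscositySubsolution.le_of_hasSuperjet
    (h : IsAdmissible σ g f T lamMinus lamPlus Lg Lf K G)
    {u : EuclideanSpace ℝ (Fin n) → ℝ → ℝ} (hu : IsViscositySubsolution (levelSetOp σ g f) T u)
    {c e : ℝ → ℝ} (hc : ContDiff ℝ 2 c) (he : ContDiff ℝ 2 e) (he0 : ∀ t, 0 < e t)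
    {w : SpaceTime n → ℝ} (huw : ∀ z ∈ slab n T, u z.fst z.snd = c z.snd + e z.snd * w z)
    {z P : SpaceTime n} {A : SpaceTime n →L[ℝ] SpaceTime n} (hz : z.snd ∈ Ioo 0 T)
    (hA : (A : SpaceTime n →ₗ[ℝ] SpaceTime n).IsSymmetric) (hj : HasSuperjet (slab n T) w z P A)
    (hP : P.fst ≠ 0) :
    deriv c z.snd + deriv e z.snd * w z + e z.snd * P.snd +
      e z.snd * levelSetOp σ g f (z.fst, z.snd, P.fst, spatialBlock A) ≤ 0 := by
  have h1 : ∀ ε : ℝ, 0 < ε → deriv c z.snd + deriv e z.snd * w z + e z.snd * P.snd +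
      e z.snd * levelSetOp σ g f (z.fst, z.snd, P.fst,
        spatialBlock A + (2 * ε) • ContinuousLinearMap.id ℝ _) ≤ 0 := by
    intro ε hε
    have h2 := hu.lowerEnvelope_le_of_hasSuperjet hc he he0 huw hz hA hj hε
    have h3 := h.levelSetOp_le_of_lowerEnvelope_le hz (smul_ne_zero (he0 _).ne' hP) h2
    rw [levelSetOp_smul h.homog (he0 _)] at h3
    linarith
  have hX : ContinuousAt (fun ε : ℝ => ((z.fst, z.snd, P.fst,
      spatialBlock A + (2 * ε) • ContinuousLinearMap.id ℝ _) : JetSpace n)) 0 := by fun_prop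
  have hF : ContinuousAt (fun ε : ℝ => levelSetOp σ g f (z.fst, z.snd, P.fst,
      spatialBlock A + (2 * ε) • ContinuousLinearMap.id ℝ _)) 0 := by
    refine ContinuousAt.comp (g := levelSetOp σ g f) ?_ hX
    exact h.continuousAt_levelSetOp hz hP _
  have hlim : Tendsto (fun ε : ℝ => deriv c z.snd + deriv e z.snd * w z + e z.snd * P.snd +
      e z.snd * levelSetOp σ g f (z.fst, z.snd, P.fst,
        spatialBlock A + (2 * ε) • ContinuousLinearMap.id ℝ _)) (𝓝[>] 0)
      (𝓝 (deriv c z.snd + deriv e z.snd * w z + e z.snd * P.snd +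
      e z.snd * levelSetOp σ g f (z.fst, z.snd, P.fst, spatialBlock A))) := by
    have h2 := (tendsto_const_nhds (x := deriv c z.snd + deriv e z.snd * w z + e z.snd * P.snd)).add
      ((hF.tendsto.mono_left (nhdsWithin_le_nhds (s := Ioi 0))).const_mul (e z.snd))
    have e0 : spatialBlock A + (2 * (0 : ℝ)) • ContinuousLinearMap.id ℝ _ = spatialBlock A := by
      ext1 ξ; simp
    rw [e0] at h2
    exact h2
  exact le_of_tendsto hlim (by filter_upwards [self_mem_nhdsWithin] with ε hε using h1 ε hε)

/-- The differential inequality at limits of superjets with nonzero spatial slope. -/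
lemma IsViscositySubsolution.le_of_hasLimitSuperjet
    (h : IsAdmissible σ g f T lamMinus lamPlus Lg Lf K G)
    {u : EuclideanSpace ℝ (Fin n) → ℝ → ℝ} (hu : IsViscositySubsolution (levelSetOp σ g f) T u)
    {c e : ℝ → ℝ} (hc : ContDiff ℝ 2 c) (he : ContDiff ℝ 2 e) (he0 : ∀ t, 0 < e t)
    {w : SpaceTime n → ℝ} (huw : ∀ z ∈ slab n T, u z.fst z.snd = c z.snd + e z.snd * w z)
    (hw : ContinuousOn w (slab n T))
    {z P : SpaceTime n} {A : SpaceTime n →L[ℝ] SpaceTime n} (hz : z.snd ∈ Ioo 0 T)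
    (hj : HasLimitSuperjet (slab n T) w z P A) (hP : P.fst ≠ 0) :
    deriv c z.snd + deriv e z.snd * w z + e z.snd * P.snd +
      e z.snd * levelSetOp σ g f (z.fst, z.snd, P.fst, spatialBlock A) ≤ 0 := by
  obtain ⟨ζ, r, B, hζS, hζj, hBs, hζ, hr, hB⟩ := hj
  have hfst : Continuous fun z : SpaceTime n => z.fst :=
    (WithLp.fstL 2 ℝ (EuclideanSpace ℝ (Fin n)) ℝ).continuous
  have hsnd : Continuous fun z : SpaceTime n => z.snd :=
    (WithLp.sndL 2 ℝ (EuclideanSpace ℝ (Fin n)) ℝ).continuous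
  have hx : Tendsto (fun k => (ζ k).fst) atTop (𝓝 z.fst) := (hfst.tendsto _).comp hζ
  have ht : Tendsto (fun k => (ζ k).snd) atTop (𝓝 z.snd) := (hsnd.tendsto _).comp hζ
  have hp : Tendsto (fun k => (r k).fst) atTop (𝓝 P.fst) := (hfst.tendsto _).comp hr
  have ha : Tendsto (fun k => (r k).snd) atTop (𝓝 P.snd) := (hsnd.tendsto _).comp hr
  have hX : Tendsto (fun k => spatialBlock (B k)) atTop (𝓝 (spatialBlock A)) :=
    (continuous_spatialBlock.tendsto _).comp hB
  have hwz : Tendsto (fun k => w (ζ k)) atTop (𝓝 (w z)) :=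
    (hw z (Ioo_subset_Icc_self hz)).tendsto.comp
      (tendsto_nhdsWithin_iff.2 ⟨hζ, Eventually.of_forall hζS⟩)
  have hF : Tendsto (fun k => levelSetOp σ g f ((ζ k).fst, (ζ k).snd, (r k).fst,
      spatialBlock (B k))) atTop (𝓝 (levelSetOp σ g f (z.fst, z.snd, P.fst, spatialBlock A))) :=
    (h.continuousAt_levelSetOp hz hP _).tendsto.comp
      (hx.prodMk_nhds (ht.prodMk_nhds (hp.prodMk_nhds hX)))
  have hdc : Tendsto (fun k => deriv c (ζ k).snd) atTop (𝓝 (deriv c z.snd)) :=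
    ((hc.continuous_deriv (by norm_num)).tendsto _).comp ht
  have hde : Tendsto (fun k => deriv e (ζ k).snd) atTop (𝓝 (deriv e z.snd)) :=
    ((he.continuous_deriv (by norm_num)).tendsto _).comp ht
  have hee : Tendsto (fun k => e (ζ k).snd) atTop (𝓝 (e z.snd)) :=
    (he.continuous.tendsto _).comp ht
  refine le_of_tendsto (((hdc.add (hde.mul hwz)).add (hee.mul ha)).add (hee.mul hF)) ?_
  filter_upwards [ht.eventually (isOpen_Ioo.mem_nhds hz), hp.eventually_ne hP] with k hk1 hk2
  exact hu.le_of_hasSuperjet h hc he he0 huw hk1 (hBs k) (hζj k) hk2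

/-- The differential inequality at superjets with zero spatial slope and Hessian. -/
lemma IsViscositySubsolution.le_of_hasSuperjet_zero
    (h : IsAdmissible σ g f T lamMinus lamPlus Lg Lf K G)
    {u : EuclideanSpace ℝ (Fin n) → ℝ → ℝ} (hu : IsViscositySubsolution (levelSetOp σ g f) T u)
    {c e : ℝ → ℝ} (hc : ContDiff ℝ 2 c) (he : ContDiff ℝ 2 e) (he0 : ∀ t, 0 < e t)
    {w : SpaceTime n → ℝ} (huw : ∀ z ∈ slab n T, u z.fst z.snd = c z.snd + e z.snd * w z)
    {z P : SpaceTime n} {A : SpaceTime n →L[ℝ] SpaceTime n} (hz : z.snd ∈ Ioo 0 T)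
    (hA : (A : SpaceTime n →ₗ[ℝ] SpaceTime n).IsSymmetric) (hj : HasSuperjet (slab n T) w z P A)
    (hP : P.fst = 0) (hA0 : spatialBlock A = 0) :
    deriv c z.snd + deriv e z.snd * w z + e z.snd * P.snd ≤ 0 := by
  obtain ⟨C, hC, hbound⟩ := h.exists_neg_le_of_lowerEnvelope_le
  set N := ‖ContinuousLinearMap.id ℝ (EuclideanSpace ℝ (Fin n))‖ with hN
  have h1 : ∀ ε : ℝ, 0 < ε → deriv c z.snd + deriv e z.snd * w z + e z.snd * P.snd ≤
      ε * (C * e z.snd * 2 * N) := by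
    intro ε hε
    have h2 := hu.lowerEnvelope_le_of_hasSuperjet hc he he0 huw hz hA hj hε
    rw [hP, hA0, smul_zero, zero_add] at h2
    have h3 := hbound _ _ _ _ hz h2
    rw [norm_smul, norm_smul, Real.norm_eq_abs, Real.norm_eq_abs, abs_of_pos (he0 _),
      abs_of_pos (by positivity), ← hN] at h3
    linarith
  have hlim : Tendsto (fun ε : ℝ => ε * (C * e z.snd * 2 * N)) (𝓝[>] 0) (𝓝 0) := by
    have : Continuous fun ε : ℝ => ε * (C * e z.snd * 2 * N) := by fun_prop
    simpa using (this.tendsto 0).mono_left nhdsWithin_le_nhds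
  exact ge_of_tendsto hlim (by filter_upwards [self_mem_nhdsWithin] with ε hε using h1 ε hε)

end testing
end

section
open scoped InnerProductSpace NNReal ENNReal

/-! ### The penalty function -/

/-- The fourth root of a nonnegative number. -/
noncomputable def fourthRoot (y : ℝ) : ℝ := √(√y)

lemma fourthRoot_nonneg (y : ℝ) : 0 ≤ fourthRoot y := Real.sqrt_nonneg _

lemma fourthRoot_pow {y : ℝ} (hy : 0 ≤ y) : fourthRoot y ^ 4 = y := by
  have h1 : fourthRoot y ^ 4 = ((√(√y)) ^ 2) ^ 2 := by rw [fourthRoot]; ring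
  rw [h1, Real.sq_sqrt (Real.sqrt_nonneg _), Real.sq_sqrt hy]

lemma continuous_fourthRoot : Continuous fourthRoot :=
  Real.continuous_sqrt.comp Real.continuous_sqrt

lemma fourthRoot_le_of_le_pow {y a : ℝ} (ha : 0 ≤ a) (h : y ≤ a ^ 4) : fourthRoot y ≤ a := by
  rw [fourthRoot, Real.sqrt_le_left ha, Real.sqrt_le_left (by positivity)]
  calc y ≤ a ^ 4 := h
    _ = _ := by ring

lemma le_fourthRoot_of_pow_le {y a : ℝ} (h : a ^ 4 ≤ y) : a ≤ fourthRoot y := by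
  refine Real.le_sqrt_of_sq_le (Real.le_sqrt_of_sq_le ?_)
  calc _ = a ^ 4 := by ring
    _ ≤ y := h

/-- Concavity of the fourth root: the graph lies below its tangents. -/
lemma fourthRoot_le_tangent {y y' : ℝ} (hy : 0 < y) (hy' : 0 ≤ y') :
    fourthRoot y' ≤ fourthRoot y + (y' - y) / (4 * fourthRoot y ^ 3) := by
  set a := fourthRoot y'
  set b := fourthRoot y
  have ha : a ^ 4 = y' := fourthRoot_pow hy'
  have hb : b ^ 4 = y := fourthRoot_pow hy.le
  have ha0 : 0 ≤ a := fourthRoot_nonneg _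
  have hb0 : 0 < b := by
    refine lt_of_le_of_ne (fourthRoot_nonneg _) fun h => ?_
    rw [← hb, ← h] at hy
    norm_num at hy
  rw [← ha, ← hb, ← sub_le_iff_le_add', le_div_iff₀ (by positivity)]
  nlinarith [mul_nonneg (sq_nonneg (a - b)) (by positivity : 0 ≤ a ^ 2 + 2 * a * b + 3 * b ^ 2)]

section smoothNorm
variable {V : Type*} [NormedAddCommGroup V] {δ : ℝ}

/-- The smoothing `(δ⁴ + ‖ξ‖⁴)^(1/4)` of the norm, whose Hessian vanishes at the origin. -/
noncomputable def smoothNorm (δ : ℝ) (ξ : V) : ℝ := fourthRoot (δ ^ 4 + ‖ξ‖ ^ 4)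

lemma smoothNorm_pow (ξ : V) : smoothNorm δ ξ ^ 4 = δ ^ 4 + ‖ξ‖ ^ 4 :=
  fourthRoot_pow (by positivity)

lemma le_smoothNorm (ξ : V) : δ ≤ smoothNorm δ ξ :=
  le_fourthRoot_of_pow_le (by have : 0 ≤ ‖ξ‖ ^ 4 := by positivity
                              linarith)

lemma norm_le_smoothNorm (ξ : V) : ‖ξ‖ ≤ smoothNorm δ ξ :=
  le_fourthRoot_of_pow_le (by have : 0 ≤ δ ^ 4 := by positivity
                              linarith)

lemma smoothNorm_pos (hδ : 0 < δ) (ξ : V) : 0 < smoothNorm δ ξ := hδ.trans_le (le_smoothNorm ξ)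

lemma continuous_smoothNorm : Continuous (smoothNorm (V := V) δ) :=
  continuous_fourthRoot.comp (by fun_prop)

lemma smoothNorm_add_le (hδ : 0 < δ) (ξ η : V) : smoothNorm δ (ξ + η) ≤ smoothNorm δ ξ + ‖η‖ := by
  have h0 := smoothNorm_pos hδ ξ
  refine fourthRoot_le_of_le_pow (by positivity) ?_
  have h1 := norm_le_smoothNorm (δ := δ) ξ
  have h2 := smoothNorm_pow (δ := δ) ξ
  have h3 : ‖ξ + η‖ ^ 4 ≤ (‖ξ‖ + ‖η‖) ^ 4 := by gcongr; exact norm_add_le _ _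
  set s := smoothNorm δ ξ
  set a := ‖ξ‖ with ha
  set b := ‖η‖ with hb
  have ha0 : 0 ≤ a := norm_nonneg _
  have hb0 : 0 ≤ b := norm_nonneg _
  have e1 : 0 ≤ s ^ 3 - a ^ 3 := sub_nonneg.2 (by gcongr)
  have e2 : 0 ≤ s ^ 2 - a ^ 2 := sub_nonneg.2 (by gcongr)
  have e3 : 0 ≤ s - a := sub_nonneg.2 h1
  have e4 : 0 ≤ 4 * b * (s ^ 3 - a ^ 3) + 6 * b ^ 2 * (s ^ 2 - a ^ 2) + 4 * b ^ 3 * (s - a) := by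
    positivity
  linarith [show (s + b) ^ 4 - (a + b) ^ 4 = (s ^ 4 - a ^ 4) + (4 * b * (s ^ 3 - a ^ 3) +
    6 * b ^ 2 * (s ^ 2 - a ^ 2) + 4 * b ^ 3 * (s - a)) by ring]

lemma smoothNorm_zero (hδ : 0 < δ) : smoothNorm δ (0 : V) = δ := by
  have h : smoothNorm δ (0 : V) ^ 4 = δ ^ 4 := by simp [smoothNorm_pow]
  exact (pow_left_inj₀ (smoothNorm_pos hδ _).le hδ.le (by norm_num)).1 h

lemma smoothNorm_le_add_norm (hδ : 0 < δ) (ξ : V) : smoothNorm δ ξ ≤ δ + ‖ξ‖ := by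
  have := smoothNorm_add_le hδ 0 ξ
  rwa [zero_add, smoothNorm_zero hδ] at this

lemma smoothNorm_le_quartic (hδ : 0 < δ) (ξ : V) :
    smoothNorm δ ξ ≤ δ + ‖ξ‖ ^ 4 / (4 * δ ^ 3) := by
  have h1 := fourthRoot_le_tangent (y := δ ^ 4) (y' := δ ^ 4 + ‖ξ‖ ^ 4) (by positivity)
    (by positivity)
  have h2 : fourthRoot (δ ^ 4) = δ := by
    have := smoothNorm_zero (V := V) hδ
    simpa [smoothNorm] using this
  rwa [h2, add_sub_cancel_left] at h1

variable [InnerProductSpace ℝ V]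

/-- The gradient of `smoothNorm δ`. -/
noncomputable def smoothNormGrad (δ : ℝ) (ξ : V) : V := (‖ξ‖ ^ 2 / smoothNorm δ ξ ^ 3) • ξ

lemma continuous_smoothNormGrad (hδ : 0 < δ) : Continuous (smoothNormGrad (V := V) δ) :=
  (Continuous.div (by fun_prop) (continuous_smoothNorm.pow 3)
    fun ξ => (pow_pos (smoothNorm_pos hδ ξ) 3).ne').smul continuous_id

lemma norm_smoothNormGrad_le (hδ : 0 < δ) (ξ : V) : ‖smoothNormGrad δ ξ‖ ≤ 1 := by
  have h0 := smoothNorm_pos hδ ξ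
  have h1 := norm_le_smoothNorm (δ := δ) ξ
  rw [smoothNormGrad, norm_smul, Real.norm_eq_abs, abs_of_nonneg (by positivity),
    div_mul_eq_mul_div, div_le_one (by positivity)]
  calc ‖ξ‖ ^ 2 * ‖ξ‖ = ‖ξ‖ ^ 3 := by ring
    _ ≤ _ := by gcongr

lemma smoothNormGrad_eq_zero (hδ : 0 < δ) {ξ : V} (h : smoothNormGrad δ ξ = 0) : ξ = 0 := by
  rcases smul_eq_zero.1 h with h1 | h1
  · have h0 := smoothNorm_pos hδ ξ
    have h2 : ‖ξ‖ ^ 2 = 0 := by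
      rcases div_eq_zero_iff.1 h1 with h3 | h3
      · exact h3
      · exact absurd h3 (by positivity)
    exact norm_eq_zero.1 (pow_eq_zero_iff (two_ne_zero) |>.1 h2)
  · exact h1

/-- Semiconcavity of the smoothed norm. For `‖η‖ ≤ smoothNorm δ ξ` this is the tangent inequality
for the fourth root; for larger `η` the function is `1`-Lipschitz. -/
lemma smoothNorm_semiconcave (hδ : 0 < δ) (ξ η : V) :
    smoothNorm δ (ξ + η) ≤ smoothNorm δ ξ + ⟪smoothNormGrad δ ξ, η⟫_ℝ + 3 / δ * ‖η‖ ^ 2 := by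
  have h0 := smoothNorm_pos hδ ξ
  have hδs := le_smoothNorm (δ := δ) ξ
  have hs := norm_le_smoothNorm (δ := δ) ξ
  rcases le_or_gt ‖η‖ (smoothNorm δ ξ) with hη | hη
  · have h1 := fourthRoot_le_tangent (y := δ ^ 4 + ‖ξ‖ ^ 4) (y' := δ ^ 4 + ‖ξ + η‖ ^ 4)
      (by positivity) (by positivity)
    change smoothNorm δ (ξ + η) ≤ smoothNorm δ ξ + _ / (4 * smoothNorm δ ξ ^ 3) at h1
    have h2 : ‖ξ + η‖ ^ 4 = (‖ξ‖ ^ 2 + 2 * ⟪ξ, η⟫_ℝ + ‖η‖ ^ 2) ^ 2 := by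
      rw [← norm_add_sq_real]; ring
    have h3 : ⟪smoothNormGrad δ ξ, η⟫_ℝ = 4 * ‖ξ‖ ^ 2 * ⟪ξ, η⟫_ℝ / (4 * smoothNorm δ ξ ^ 3) := by
      rw [smoothNormGrad, inner_smul_left, RCLike.conj_to_real]
      field_simp
    set s := smoothNorm δ ξ
    set i := ⟪ξ, η⟫_ℝ with hi
    have hi1 : |i| ≤ s * ‖η‖ := (abs_real_inner_le_norm ξ η).trans (by gcongr)
    have hi2 : i ^ 2 ≤ s ^ 2 * ‖η‖ ^ 2 := by
      rw [← sq_abs, ← mul_pow]; gcongr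
    have hi3 : i ≤ s * s := ((le_abs_self _).trans hi1).trans (by gcongr)
    have h4 : 4 * i ^ 2 + 2 * ‖ξ‖ ^ 2 * ‖η‖ ^ 2 + 4 * i * ‖η‖ ^ 2 + ‖η‖ ^ 4 ≤
        11 * s ^ 2 * ‖η‖ ^ 2 := by
      have e1 : ‖ξ‖ ^ 2 * ‖η‖ ^ 2 ≤ s ^ 2 * ‖η‖ ^ 2 := by gcongr
      have e2 : i * ‖η‖ ^ 2 ≤ (s * s) * ‖η‖ ^ 2 := by gcongr
      have e3 : ‖η‖ ^ 2 * ‖η‖ ^ 2 ≤ s ^ 2 * ‖η‖ ^ 2 := by gcongr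
      nlinarith
    have h5 : (δ ^ 4 + ‖ξ + η‖ ^ 4 - (δ ^ 4 + ‖ξ‖ ^ 4)) / (4 * s ^ 3) ≤
        ⟪smoothNormGrad δ ξ, η⟫_ℝ + 3 / s * ‖η‖ ^ 2 := by
      rw [h3, h2]
      have e : 4 * ‖ξ‖ ^ 2 * i / (4 * s ^ 3) + 3 / s * ‖η‖ ^ 2 =
          (4 * ‖ξ‖ ^ 2 * i + 12 * s ^ 2 * ‖η‖ ^ 2) / (4 * s ^ 3) := by field_simp; ring
      rw [e]
      gcongr
      have e4 : 0 ≤ s ^ 2 * ‖η‖ ^ 2 := by positivity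
      nlinarith
    have h6 : 3 / s * ‖η‖ ^ 2 ≤ 3 / δ * ‖η‖ ^ 2 := by gcongr
    linarith
  · have h1 := smoothNorm_add_le hδ ξ η
    have h2 := (abs_le.1 (abs_real_inner_le_norm (smoothNormGrad δ ξ) η)).1
    have h3 : ‖smoothNormGrad δ ξ‖ * ‖η‖ ≤ 1 * ‖η‖ := by
      gcongr; exact norm_smoothNormGrad_le hδ ξ
    have h4 : 2 * ‖η‖ ≤ 3 / δ * ‖η‖ ^ 2 := by
      rw [div_mul_eq_mul_div, le_div_iff₀ hδ]
      nlinarith [norm_nonneg η]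
    linarith

end smoothNorm

section penalty
variable {n : ℕ} {δ ε l : ℝ}

/-- The doubling penalty `l (δ⁴ + |x|⁴)^(1/4) + t² / (2 ε)` on space-time. -/
noncomputable def penalty (l δ ε : ℝ) (z : SpaceTime n) : ℝ :=
  l * smoothNorm δ z.fst + z.snd ^ 2 / (2 * ε)

/-- The gradient of the doubling penalty. -/
noncomputable def penaltyGrad (l δ ε : ℝ) (z : SpaceTime n) : SpaceTime n :=
  WithLp.toLp 2 (l • smoothNormGrad δ z.fst, z.snd / ε)

lemma continuous_fst_spaceTime : Continuous fun z : SpaceTime n => z.fst :=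
  (WithLp.fstL 2 ℝ (EuclideanSpace ℝ (Fin n)) ℝ).continuous

lemma continuous_snd_spaceTime : Continuous fun z : SpaceTime n => z.snd :=
  (WithLp.sndL 2 ℝ (EuclideanSpace ℝ (Fin n)) ℝ).continuous

lemma norm_sq_spaceTime (z : SpaceTime n) : ‖z‖ ^ 2 = ‖z.fst‖ ^ 2 + z.snd ^ 2 := by
  rw [WithLp.prod_norm_sq_eq_of_L2, Real.norm_eq_abs, sq_abs]

lemma continuous_penalty : Continuous (penalty (n := n) l δ ε) :=
  (continuous_const.mul (continuous_smoothNorm.comp continuous_fst_spaceTime)).add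
    ((continuous_snd_spaceTime.pow 2).div_const _)

lemma continuous_penaltyGrad (hδ : 0 < δ) : Continuous (penaltyGrad (n := n) l δ ε) :=
  (WithLp.prodContinuousLinearEquiv 2 ℝ (EuclideanSpace ℝ (Fin n)) ℝ).symm.continuous.comp
    ((((continuous_smoothNormGrad hδ).comp continuous_fst_spaceTime).const_smul l).prodMk
      (continuous_snd_spaceTime.div_const ε))

lemma inner_penaltyGrad (z ζ : SpaceTime n) :
    ⟪penaltyGrad l δ ε z, ζ⟫_ℝ = l * ⟪smoothNormGrad δ z.fst, ζ.fst⟫_ℝ + z.snd / ε * ζ.snd := by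
  simp [penaltyGrad, inner_smul_left, mul_comm]

lemma penalty_nonneg (hδ : 0 < δ) (hε : 0 < ε) (hl : 0 ≤ l) (z : SpaceTime n) :
    0 ≤ penalty l δ ε z := by
  have := (smoothNorm_pos hδ z.fst).le
  unfold penalty
  positivity

lemma penalty_semiconcave (hδ : 0 < δ) (hε : 0 < ε) (hl : 0 ≤ l) (z ζ : SpaceTime n) :
    penalty l δ ε (z + ζ) ≤ penalty l δ ε z + ⟪penaltyGrad l δ ε z, ζ⟫_ℝ +
      (6 * l / δ + 1 / ε) / 2 * ‖ζ‖ ^ 2 := by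
  rw [inner_penaltyGrad, norm_sq_spaceTime]
  have h1 := mul_le_mul_of_nonneg_left (smoothNorm_semiconcave hδ z.fst ζ.fst) hl
  have h2 : (z.snd + ζ.snd) ^ 2 / (2 * ε) = z.snd ^ 2 / (2 * ε) + z.snd / ε * ζ.snd +
      1 / ε / 2 * ζ.snd ^ 2 := by field_simp; ring
  have h3 : 0 ≤ 6 * l / δ / 2 * ζ.snd ^ 2 := by positivity
  have h4 : 0 ≤ 1 / ε / 2 * ‖ζ.fst‖ ^ 2 := by positivity
  have h5 : l * (3 / δ * ‖ζ.fst‖ ^ 2) = 6 * l / δ / 2 * ‖ζ.fst‖ ^ 2 := by ring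
  simp only [penalty, WithLp.add_fst, WithLp.add_snd, h2]
  linarith

lemma norm_le_penalty (hε : 0 < ε) (hl : 1 ≤ l) (hδ : 0 < δ) (z : SpaceTime n) :
    ‖z‖ - ε / 2 ≤ penalty l δ ε z := by
  have h1 : ‖z‖ ≤ ‖z.fst‖ + |z.snd| := by
    refine abs_le_of_sq_le_sq' ?_ (by positivity) |>.2
    rw [norm_sq_spaceTime, ← sq_abs z.snd]
    nlinarith [norm_nonneg z.fst, abs_nonneg z.snd]
  have h2 : |z.snd| - ε / 2 ≤ z.snd ^ 2 / (2 * ε) := by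
    rw [le_div_iff₀ (by positivity), ← sq_abs z.snd]
    nlinarith [sq_nonneg (|z.snd| - ε)]
  have h3 : ‖z.fst‖ ≤ l * smoothNorm δ z.fst := by
    have := norm_le_smoothNorm (δ := δ) z.fst
    have := smoothNorm_pos hδ z.fst
    nlinarith
  unfold penalty
  linarith

lemma tendsto_penalty (hε : 0 < ε) (hl : 1 ≤ l) (hδ : 0 < δ) :
    Tendsto (penalty (n := n) l δ ε) (cocompact (SpaceTime n)) atTop := by
  refine tendsto_atTop_mono (norm_le_penalty hε hl hδ) ?_
  exact tendsto_atTop_add_const_right _ (-(ε / 2)) tendsto_norm_cocompact_atTop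

/-- The time block `(x, t) ↦ (0, c t)`. -/
def timeBlock (n : ℕ) (c : ℝ) : SpaceTime n →L[ℝ] SpaceTime n :=
  ((WithLp.prodContinuousLinearEquiv 2 ℝ (EuclideanSpace ℝ (Fin n)) ℝ).symm :
    EuclideanSpace ℝ (Fin n) × ℝ →L[ℝ] SpaceTime n).comp
      ((ContinuousLinearMap.inr ℝ (EuclideanSpace ℝ (Fin n)) ℝ).comp
        (c • WithLp.sndL 2 ℝ (EuclideanSpace ℝ (Fin n)) ℝ))

lemma inner_timeBlock (c : ℝ) (ζ ζ' : SpaceTime n) :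
    ⟪timeBlock n c ζ, ζ'⟫_ℝ = c * ζ.snd * ζ'.snd := by
  simp [timeBlock, mul_comm]

lemma isSymmetric_timeBlock (c : ℝ) :
    (timeBlock n c : SpaceTime n →ₗ[ℝ] SpaceTime n).IsSymmetric := by
  intro a b
  change ⟪timeBlock n c a, b⟫_ℝ = ⟪a, timeBlock n c b⟫_ℝ
  rw [real_inner_comm (timeBlock n c b) a, inner_timeBlock, inner_timeBlock]; ring

lemma spatialBlock_timeBlock (c : ℝ) : spatialBlock (timeBlock n c) = 0 := by
  ext1 ξ
  refine ext_inner_right ℝ fun η => ?_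
  rw [inner_spatialBlock, inner_timeBlock]
  simp [spaceIncl]

/-- Where the spatial part of its argument vanishes, the penalty is flat to third order in space;
functions touched there from above by the penalty have superjets without spatial part. -/
lemma hasSuperjet_of_le_penalty (hδ : 0 < δ) (hl : 0 ≤ l) {S : Set (SpaceTime n)}
    {v : SpaceTime n → ℝ} {w z : SpaceTime n} (hz : z.fst = 0)
    (h : ∀ ζ, w + ζ ∈ S → v (w + ζ) ≤ v w + penalty l δ ε (z + ζ) - penalty l δ ε z) :
    HasSuperjet S v w (penaltyGrad l δ ε z) (timeBlock n (1 / ε)) := by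
  intro κ hκ
  set k := l / (4 * δ ^ 3) with hk
  have hk0 : 0 ≤ k := by positivity
  have hsmall : ∀ᶠ ζ in 𝓝 (0 : SpaceTime n), k * ‖ζ‖ ^ 2 < κ := by
    have : Continuous fun ζ : SpaceTime n => k * ‖ζ‖ ^ 2 := by fun_prop
    have h2 := this.tendsto 0
    exact h2.eventually (gt_mem_nhds (by simpa using hκ))
  filter_upwards [hsmall] with ζ hζ hmem
  refine (h ζ hmem).trans ?_
  rw [inner_penaltyGrad, inner_timeBlock]
  have h1 := mul_le_mul_of_nonneg_left (smoothNorm_le_quartic hδ ζ.fst) hl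
  have h2 : (z.snd + ζ.snd) ^ 2 / (2 * ε) = z.snd ^ 2 / (2 * ε) + z.snd / ε * ζ.snd +
      1 / 2 * (1 / ε * ζ.snd * ζ.snd) := by ring
  have h3 : l * (‖ζ.fst‖ ^ 4 / (4 * δ ^ 3)) = k * ‖ζ.fst‖ ^ 2 * ‖ζ.fst‖ ^ 2 := by rw [hk]; ring
  have h4 : ‖ζ.fst‖ ^ 2 ≤ ‖ζ‖ ^ 2 := by
    rw [norm_sq_spaceTime]; nlinarith [sq_nonneg ζ.snd]
  have h5 : k * ‖ζ.fst‖ ^ 2 * ‖ζ.fst‖ ^ 2 ≤ κ * ‖ζ‖ ^ 2 := by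
    calc k * ‖ζ.fst‖ ^ 2 * ‖ζ.fst‖ ^ 2 ≤ k * ‖ζ‖ ^ 2 * ‖ζ‖ ^ 2 := by gcongr
      _ ≤ κ * ‖ζ‖ ^ 2 := by gcongr
  simp only [penalty, WithLp.add_fst, WithLp.add_snd, hz, zero_add, h2, smoothNorm_zero hδ,
    smoothNormGrad, smul_zero, inner_zero_left, mul_zero]
  linarith

end penalty

/-! ### Existence of maxima for the doubled problem -/

/-- Here `hR` keeps maximizing sequences bounded, as the value at the maximum is positive. -/
lemma exists_max_doubling {H : Type*} [NormedAddCommGroup H] [ProperSpace H] {S : Set H}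
    (hS : IsClosed S) {v₁ v₂ Θ : H → ℝ} {m R : ℝ} (hv₁ : ContinuousOn v₁ S)
    (hv₂ : ContinuousOn v₂ S) (hm₁ : ∀ z ∈ S, v₁ z ≤ m) (hm₂ : ∀ z ∈ S, v₂ z ≤ m)
    (hΘc : Continuous Θ) (hΘ : Tendsto Θ (cocompact H) atTop) (hΘ0 : ∀ z, 0 ≤ Θ z)
    (hR : ∀ x ∈ S, ∀ y ∈ S, R < ‖x‖ → R < ‖y‖ → v₁ x + v₂ y ≤ 0) {z₁ a₁ b₁ : H} (ha₁ : a₁ ∈ S)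
    (hb₁ : b₁ ∈ S) (hpos : 0 < v₁ a₁ + v₂ b₁ - Θ (z₁ - a₁) - Θ (z₁ - b₁)) :
    ∃ z₀, ∃ a ∈ S, ∃ b ∈ S, ∀ z, ∀ x ∈ S, ∀ y ∈ S, v₁ x + v₂ y - Θ (z - x) - Θ (z - y) ≤
      v₁ a + v₂ b - Θ (z₀ - a) - Θ (z₀ - b) := by
  set Ψ : H × H × H → ℝ := fun q => v₁ q.2.1 + v₂ q.2.2 - Θ (q.1 - q.2.1) - Θ (q.1 - q.2.2) with hΨ
  obtain ⟨Q, hQ, hQΘ⟩ := mem_cocompact.1 (hΘ.eventually_gt_atTop (2 * m))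
  obtain ⟨ρ, hρ⟩ := hQ.isBounded.exists_norm_le
  have hball : ∀ ξ, Θ ξ ≤ 2 * m → ‖ξ‖ ≤ ρ := by
    intro ξ hξ
    refine hρ ξ ?_
    by_contra hcon
    exact absurd (hQΘ hcon : 2 * m < Θ ξ) (not_lt.2 hξ)
  set R' := R + 2 * ρ with hR'
  have hρ0 : 0 ≤ ρ := by
    have h1 := hm₁ _ ha₁
    have h2 := hm₂ _ hb₁
    have h3 := hΘ0 (z₁ - b₁)
    exact (norm_nonneg _).trans (hball (z₁ - a₁) (by linarith))
  have hbd : ∀ z, ∀ x ∈ S, ∀ y ∈ S, 0 < v₁ x + v₂ y - Θ (z - x) - Θ (z - y) →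
      ‖z‖ ≤ R' ∧ ‖x‖ ≤ R' ∧ ‖y‖ ≤ R' := by
    intro z x hx y hy h
    have h1 := hm₁ _ hx
    have h2 := hm₂ _ hy
    have h3 := hΘ0 (z - x)
    have h4 := hΘ0 (z - y)
    have h5 := hball (z - x) (by linarith)
    have h6 := hball (z - y) (by linarith)
    have h7 : ‖x‖ ≤ R ∨ ‖y‖ ≤ R := by
      by_contra hcon
      push Not at hcon
      have := hR x hx y hy hcon.1 hcon.2
      linarith
    have e1 : ‖z‖ ≤ ‖z - x‖ + ‖x‖ := by simpa using norm_add_le (z - x) x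
    have e2 : ‖z‖ ≤ ‖z - y‖ + ‖y‖ := by simpa using norm_add_le (z - y) y
    have e3 : ‖x‖ ≤ ‖z - x‖ + ‖z‖ := by
      have := norm_sub_le z (z - x); rw [sub_sub_cancel] at this; linarith
    have e4 : ‖y‖ ≤ ‖z - y‖ + ‖z‖ := by
      have := norm_sub_le z (z - y); rw [sub_sub_cancel] at this; linarith
    rcases h7 with h7 | h7 <;> exact ⟨by linarith, by linarith, by linarith⟩
  set 𝒦 : Set (H × H × H) := Metric.closedBall 0 R' ×ˢ
    ((Metric.closedBall 0 R' ∩ S) ×ˢ (Metric.closedBall 0 R' ∩ S)) with h𝒦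
  have hcomp : IsCompact 𝒦 := (isCompact_closedBall _ _).prod
    (((isCompact_closedBall _ _).inter_right hS).prod ((isCompact_closedBall _ _).inter_right hS))
  have hcont : ContinuousOn Ψ 𝒦 := by
    have c1 : ContinuousOn (fun q : H × H × H => v₁ q.2.1) 𝒦 :=
      hv₁.comp (by fun_prop) fun q hq => hq.2.1.2
    have c2 : ContinuousOn (fun q : H × H × H => v₂ q.2.2) 𝒦 :=
      hv₂.comp (by fun_prop) fun q hq => hq.2.2.2
    have c3 : Continuous (fun q : H × H × H => Θ (q.1 - q.2.1)) := by fun_prop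
    have c4 : Continuous (fun q : H × H × H => Θ (q.1 - q.2.2)) := by fun_prop
    exact ((c1.add c2).sub c3.continuousOn).sub c4.continuousOn
  obtain ⟨h1, h2, h3⟩ := hbd z₁ a₁ ha₁ b₁ hb₁ hpos
  have hmem : (z₁, a₁, b₁) ∈ 𝒦 :=
    ⟨by simpa using h1, ⟨by simpa using h2, ha₁⟩, ⟨by simpa using h3, hb₁⟩⟩
  obtain ⟨⟨z₀, a, b⟩, hq, hmax⟩ := hcomp.exists_isMaxOn ⟨_, hmem⟩ hcont
  refine ⟨z₀, a, hq.2.1.2, b, hq.2.2.2, fun z x hx y hy => ?_⟩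
  have h4 : Ψ (z₁, a₁, b₁) ≤ Ψ (z₀, a, b) := hmax hmem
  by_cases hzxy : 0 < v₁ x + v₂ y - Θ (z - x) - Θ (z - y)
  · obtain ⟨e1, e2, e3⟩ := hbd z x hx y hy hzxy
    exact hmax (show (z, x, y) ∈ 𝒦 from
      ⟨by simpa using e1, ⟨by simpa using e2, hx⟩, ⟨by simpa using e3, hy⟩⟩)
  · simp only [hΨ] at h4
    linarith

end

section
open scoped InnerProductSpace NNReal ENNReal

/-! ### Spatial Lipschitz continuity -/

section doubling
variable {n : ℕ} {σ : EuclideanSpace ℝ (Fin n) → ℝ} {g f : EuclideanSpace ℝ (Fin n) → ℝ → ℝ}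
  {T lamMinus lamPlus Lg Lf K G : ℝ}

/-- Degenerate ellipticity of the operator, with the oscillation of the driving force as error. -/
lemma IsAdmissible.levelSetOp_sub_le (h : IsAdmissible σ g f T lamMinus lamPlus Lg Lf K G)
    {p : EuclideanSpace ℝ (Fin n)} (hp : p ≠ 0)
    {X Y : EuclideanSpace ℝ (Fin n) →L[ℝ] EuclideanSpace ℝ (Fin n)}
    (hX : (X : EuclideanSpace ℝ (Fin n) →ₗ[ℝ] EuclideanSpace ℝ (Fin n)).IsSymmetric)
    (hY : (Y : EuclideanSpace ℝ (Fin n) →ₗ[ℝ] EuclideanSpace ℝ (Fin n)).IsSymmetric)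
    (hXY : ∀ ξ, ⟪X ξ, ξ⟫_ℝ ≤ ⟪Y ξ, ξ⟫_ℝ) (x y : EuclideanSpace ℝ (Fin n)) (t s : ℝ) :
    levelSetOp σ g f (y, s, p, Y) - levelSetOp σ g f (x, t, p, X) ≤
      ‖p‖ * (Lg * |f x t - f y s|) := by
  have hs := inv_norm_smul_mem_sphere hp
  have hσ := h.smooth.contDiffAt_compl_zero hp
  have htr := trace_comp_mono hX hY (inner_hessian_nonneg hσ h.convex) hXY
  simp only [levelSetOp]
  set a := LinearMap.trace ℝ (EuclideanSpace ℝ (Fin n)) ((hessian σ p).comp X).toLinearMap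
  set b := LinearMap.trace ℝ (EuclideanSpace ℝ (Fin n)) ((hessian σ p).comp Y).toLinearMap
  have h1 : g (‖p‖⁻¹ • p) (-b + f y s) ≤ g (‖p‖⁻¹ • p) (-a + f y s) :=
    h.g_mono _ hs (by linarith)
  have h2 := (abs_le.1 (h.g_lip _ hs (-a + f x t) (-a + f y s))).1
  rw [add_sub_add_left_eq_sub] at h2
  rw [← mul_sub]
  refine mul_le_mul_of_nonneg_left (by linarith) (norm_nonneg _)

lemma fst_penaltyGrad (l δ ε : ℝ) (z : SpaceTime n) :
    (penaltyGrad l δ ε z).fst = l • smoothNormGrad δ z.fst := rfl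

lemma spatialBlock_add_le {A B : SpaceTime n →L[ℝ] SpaceTime n}
    (hAB : ∀ ξ, ⟪(A + B) ξ, ξ⟫_ℝ ≤ 0) (ξ : EuclideanSpace ℝ (Fin n)) :
    ⟪spatialBlock A ξ, ξ⟫_ℝ ≤ ⟪(-spatialBlock B) ξ, ξ⟫_ℝ := by
  have h1 := hAB (spaceIncl n ξ)
  rw [_root_.add_apply, inner_add_left, ← inner_spatialBlock, ← inner_spatialBlock] at h1
  rw [_root_.neg_apply, inner_neg_left]
  linarith

/-- The viscosity inequalities at an interior maximum of the doubled problem, combined. When the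
spatial gradient of the penalty vanishes, all the points agree in space and the penalty itself
is a test function that is flat to third order. -/
lemma IsAdmissible.doubling_inequality (h : IsAdmissible σ g f T lamMinus lamPlus Lg Lf K G)
    {u : EuclideanSpace ℝ (Fin n) → ℝ → ℝ} (hu : IsViscositySolution (levelSetOp σ g f) T u)
    {k c : ℝ} (hk : Lg * Lf ≤ k) (hk0 : 0 ≤ k) {Φ : ℝ → ℝ} (hΦ : ContDiff ℝ 2 Φ)
    {v v₁ v₂ : SpaceTime n → ℝ}
    (huv : ∀ z ∈ slab n T, u z.fst z.snd = c + Real.exp (k * z.snd) * v z)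
    (hv : ContinuousOn v (slab n T)) (hv₁ : ∀ z, v₁ z = v z - Φ z.snd) (hv₂ : ∀ z, v₂ z = -v z)
    {l δ ε : ℝ} (hl : 0 < l) (hδ : 0 < δ) {z₀ w₁ w₂ p : SpaceTime n}
    {A B : SpaceTime n →L[ℝ] SpaceTime n} (hw₁ : w₁.snd ∈ Ioo 0 T) (hw₂ : w₂.snd ∈ Ioo 0 T)
    (hmax : ∀ z, ∀ x ∈ slab n T, ∀ y ∈ slab n T,
      v₁ x + v₂ y - penalty l δ ε (z - x) - penalty l δ ε (z - y) ≤
        v₁ w₁ + v₂ w₂ - penalty l δ ε (z₀ - w₁) - penalty l δ ε (z₀ - w₂))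
    (hp₁ : p = -penaltyGrad l δ ε (z₀ - w₁)) (hp₂ : -p = -penaltyGrad l δ ε (z₀ - w₂))
    (hj₁ : HasLimitSuperjet (slab n T) v₁ w₁ p A) (hj₂ : HasLimitSuperjet (slab n T) v₂ w₂ (-p) B)
    (hA : (A : SpaceTime n →ₗ[ℝ] SpaceTime n).IsSymmetric)
    (hB : (B : SpaceTime n →ₗ[ℝ] SpaceTime n).IsSymmetric)
    (hAB : ∀ ξ, ⟪(A + B) ξ, ξ⟫_ℝ ≤ 0) :
    k * (v w₁ - v w₂) + deriv Φ w₁.snd ≤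
      k * (l * smoothNorm δ (z₀ - w₁).fst + l * smoothNorm δ (z₀ - w₂).fst) +
        l * |Lg| * |f w₂.fst w₁.snd - f w₂.fst w₂.snd| := by
  set e : ℝ → ℝ := fun t => Real.exp (k * t) with he
  have hes : ContDiff ℝ 2 e := by fun_prop
  have he0 : ∀ t, 0 < e t := fun t => Real.exp_pos _
  have hed : ∀ t, HasDerivAt e (k * e t) t := fun t => by
    have := ((hasDerivAt_id t).const_mul k).exp
    simpa [he, mul_comm] using this
  set c₁ : ℝ → ℝ := fun t => c + e t * Φ t with hc₁
  have hc₁s : ContDiff ℝ 2 c₁ := contDiff_const.add (hes.mul hΦ)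
  have hc₁d : ∀ t, deriv c₁ t = k * e t * Φ t + e t * deriv Φ t := fun t =>
    (((hed t).mul (hΦ.differentiable (by norm_num) t).hasDerivAt).const_add c).deriv
  set c₂ : ℝ → ℝ := fun _ => -c with hc₂
  have hc₂s : ContDiff ℝ 2 c₂ := contDiff_const
  have hu₁ : ∀ z ∈ slab n T, u z.fst z.snd = c₁ z.snd + e z.snd * v₁ z := fun z hz => by
    rw [huv z hz, hv₁]; simp only [hc₁, he]; ring
  have hu₂ : ∀ z ∈ slab n T, -u z.fst z.snd = c₂ z.snd + e z.snd * v₂ z := fun z hz => by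
    rw [huv z hz, hv₂]; simp only [hc₂, he]; ring
  have hv₁c : ContinuousOn v₁ (slab n T) :=
    (hv.sub (hΦ.continuous.comp continuous_snd_spaceTime).continuousOn).congr fun z _ => hv₁ z
  have hv₂c : ContinuousOn v₂ (slab n T) := hv.neg.congr fun z _ => hv₂ z
  have hmem₁ : w₁ ∈ slab n T := Ioo_subset_Icc_self hw₁
  have hmem₂ : w₂ ∈ slab n T := Ioo_subset_Icc_self hw₂
  have hsn₁ := (smoothNorm_pos hδ (z₀ - w₁).fst).le
  have hsn₂ := (smoothNorm_pos hδ (z₀ - w₂).fst).le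
  have key : ∀ a₁ a₂ R : ℝ,
      deriv c₁ w₁.snd + deriv e w₁.snd * v₁ w₁ + e w₁.snd * a₁ ≤ 0 →
      deriv c₂ w₂.snd + deriv e w₂.snd * v₂ w₂ + e w₂.snd * a₂ ≤ 0 → -(a₁ + a₂) ≤ R →
      k * (v w₁ - v w₂) + deriv Φ w₁.snd ≤ R := by
    intro a₁ a₂ R h1 h2 h3
    rw [hc₁d, (hed _).deriv, hv₁] at h1
    rw [show deriv c₂ w₂.snd = 0 from deriv_const _ _, (hed _).deriv, hv₂] at h2
    have h4 : k * v w₁ + deriv Φ w₁.snd + a₁ ≤ 0 := by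
      have : e w₁.snd * (k * v w₁ + deriv Φ w₁.snd + a₁) ≤ 0 := by linarith
      exact nonpos_of_mul_nonpos_right this (he0 _)
    have h5 : -(k * v w₂) + a₂ ≤ 0 := by
      have : e w₂.snd * (-(k * v w₂) + a₂) ≤ 0 := by linarith
      exact nonpos_of_mul_nonpos_right this (he0 _)
    linarith
  by_cases hp : p.fst = 0
  · have hs₁ : (z₀ - w₁).fst = 0 := by
      rw [hp₁, WithLp.neg_fst, neg_eq_zero, fst_penaltyGrad] at hp
      exact smoothNormGrad_eq_zero hδ ((smul_eq_zero.1 hp).resolve_left hl.ne')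
    have hs₂ : (z₀ - w₂).fst = 0 := by
      rw [neg_inj.1 hp₂, fst_penaltyGrad] at hp
      exact smoothNormGrad_eq_zero hδ ((smul_eq_zero.1 hp).resolve_left hl.ne')
    have hpg₁ : (penaltyGrad l δ ε (z₀ - w₁)).fst = 0 := by
      rw [fst_penaltyGrad, hs₁]; simp [smoothNormGrad]
    have hpg₂ : (penaltyGrad l δ ε (z₀ - w₂)).fst = 0 := by
      rw [fst_penaltyGrad, hs₂]; simp [smoothNormGrad]
    have j₁ : HasSuperjet (slab n T) v₁ w₁ (penaltyGrad l δ ε (z₀ - w₂)) (timeBlock n (1 / ε)) := by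
      refine hasSuperjet_of_le_penalty hδ hl.le hs₂ fun ζ hζ => ?_
      have := hmax (z₀ + ζ) (w₁ + ζ) hζ w₂ hmem₂
      rw [add_sub_add_right_eq_sub, show z₀ + ζ - w₂ = z₀ - w₂ + ζ by abel] at this
      linarith
    have j₂ : HasSuperjet (slab n T) v₂ w₂ (penaltyGrad l δ ε (z₀ - w₁)) (timeBlock n (1 / ε)) := by
      refine hasSuperjet_of_le_penalty hδ hl.le hs₁ fun ζ hζ => ?_
      have := hmax (z₀ + ζ) w₁ hmem₁ (w₂ + ζ) hζ
      rw [add_sub_add_right_eq_sub, show z₀ + ζ - w₁ = z₀ - w₁ + ζ by abel] at this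
      linarith
    have i₁ := hu.1.le_of_hasSuperjet_zero h hc₁s hes he0 hu₁ hw₁ (isSymmetric_timeBlock _) j₁ hpg₂
      (spatialBlock_timeBlock _)
    have i₂ := hu.2.neg.le_of_hasSuperjet_zero h.reflect hc₂s hes he0 hu₂ hw₂
      (isSymmetric_timeBlock _) j₂ hpg₁ (spatialBlock_timeBlock _)
    refine (key _ _ 0 i₁ i₂ ?_).trans (by positivity)
    have : penaltyGrad l δ ε (z₀ - w₁) = -penaltyGrad l δ ε (z₀ - w₂) := by
      rw [← hp₂, hp₁]; simp
    rw [this, WithLp.neg_snd]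
    linarith
  · have hLg : 0 ≤ Lg := h.lipConst_nonneg hp
    have hLf : 0 ≤ Lf := by
      have h1 := (abs_nonneg _).trans (h.f_lip w₁.snd hmem₁ p.fst 0)
      rw [sub_zero] at h1
      exact nonneg_of_mul_nonneg_left h1 (norm_pos_iff.2 hp)
    have i₁ := hu.1.le_of_hasLimitSuperjet h hc₁s hes he0 hu₁ hv₁c hw₁ hj₁ hp
    have i₂ := hu.2.neg.le_of_hasLimitSuperjet h.reflect hc₂s hes he0 hu₂ hv₂c hw₂ hj₂
      (by rw [WithLp.neg_fst]; exact neg_ne_zero.2 hp)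
    rw [levelSetOp_reflect] at i₂
    simp only [WithLp.neg_fst, WithLp.neg_snd, neg_neg] at i₂
    have hnB : ((-spatialBlock B : EuclideanSpace ℝ (Fin n) →L[ℝ] EuclideanSpace ℝ (Fin n)) :
        EuclideanSpace ℝ (Fin n) →ₗ[ℝ] EuclideanSpace ℝ (Fin n)).IsSymmetric := fun a b => by
      simpa using isSymmetric_spatialBlock hB a b
    have hF := h.levelSetOp_sub_le hp (isSymmetric_spatialBlock hA) hnB
      (spatialBlock_add_le hAB) w₁.fst w₂.fst w₁.snd w₂.snd
    have hpl : ‖p.fst‖ ≤ l := by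
      rw [hp₁, WithLp.neg_fst, norm_neg, fst_penaltyGrad, norm_smul, Real.norm_eq_abs,
        abs_of_pos hl]
      exact mul_le_of_le_one_right hl.le (norm_smoothNormGrad_le hδ _)
    refine key (p.snd + levelSetOp σ g f (w₁.fst, w₁.snd, p.fst, spatialBlock A))
      (-p.snd + -levelSetOp σ g f (w₂.fst, w₂.snd, p.fst, -spatialBlock B)) _
      (by linarith) (by linarith) ?_
    have hf1 : |f w₁.fst w₁.snd - f w₂.fst w₂.snd| ≤ Lf * ‖w₁.fst - w₂.fst‖ +
        |f w₂.fst w₁.snd - f w₂.fst w₂.snd| :=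
      (abs_sub_le _ (f w₂.fst w₁.snd) _).trans
        (by gcongr; exact h.f_lip _ hmem₁ _ _)
    have hd : ‖w₁.fst - w₂.fst‖ ≤ smoothNorm δ (z₀ - w₁).fst + smoothNorm δ (z₀ - w₂).fst := by
      have h1 := norm_le_smoothNorm (δ := δ) (z₀ - w₁).fst
      have h2 := norm_le_smoothNorm (δ := δ) (z₀ - w₂).fst
      have h3 : w₁.fst - w₂.fst = (z₀ - w₂).fst - (z₀ - w₁).fst := by simp
      rw [h3]
      refine (norm_sub_le _ _).trans (by linarith)
    rw [abs_of_nonneg hLg]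
    calc _ ≤ ‖p.fst‖ * (Lg * |f w₁.fst w₁.snd - f w₂.fst w₂.snd|) := by linarith
      _ ≤ l * (Lg * (Lf * (smoothNorm δ (z₀ - w₁).fst + smoothNorm δ (z₀ - w₂).fst) +
          |f w₂.fst w₁.snd - f w₂.fst w₂.snd|)) := by
        gcongr
        exact hf1.trans (by gcongr)
      _ = (Lg * Lf) * (l * smoothNorm δ (z₀ - w₁).fst + l * smoothNorm δ (z₀ - w₂).fst) +
          l * Lg * |f w₂.fst w₁.snd - f w₂.fst w₂.snd| := by ring
      _ ≤ _ := by gcongr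

lemma exists_abs_le_of_eq_zero_outside {w : EuclideanSpace ℝ (Fin n) → ℝ → ℝ} {R : ℝ}
    (hw : ContinuousOn (fun z : EuclideanSpace ℝ (Fin n) × ℝ => w z.1 z.2) (univ ×ˢ Icc 0 T))
    (hR : ∀ x, R < ‖x‖ → ∀ t ∈ Icc 0 T, w x t = 0) :
    ∃ m, 0 < m ∧ ∀ x, ∀ t ∈ Icc 0 T, |w x t| ≤ m := by
  have hK : IsCompact (Metric.closedBall (0 : EuclideanSpace ℝ (Fin n)) R ×ˢ Icc 0 T) :=
    (isCompact_closedBall _ _).prod isCompact_Icc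
  obtain ⟨m, hm⟩ := hK.exists_bound_of_continuousOn (hw.mono (prod_mono_left (subset_univ _)))
  refine ⟨|m| + 1, by positivity, fun x t ht => ?_⟩
  rcases lt_or_ge R ‖x‖ with hx | hx
  · rw [hR x hx t ht, abs_zero]; positivity
  · have := hm (x, t) ⟨by simpa using hx, ht⟩
    rw [Real.norm_eq_abs] at this
    exact this.trans (by linarith [le_abs_self m])

lemma exists_time_modulus {w : EuclideanSpace ℝ (Fin n) → ℝ → ℝ}
    (hw : ContinuousOn (fun z : EuclideanSpace ℝ (Fin n) × ℝ => w z.1 z.2) (univ ×ˢ Icc 0 T))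
    (R : ℝ) {η : ℝ} (hη : 0 < η) :
    ∃ ρ, 0 < ρ ∧ ∀ x, ‖x‖ ≤ R → ∀ t ∈ Icc 0 T, ∀ s ∈ Icc 0 T, |t - s| < ρ →
      |w x t - w x s| ≤ η := by
  have hK : IsCompact (Metric.closedBall (0 : EuclideanSpace ℝ (Fin n)) R ×ˢ Icc 0 T) :=
    (isCompact_closedBall _ _).prod isCompact_Icc
  have huc := hK.uniformContinuousOn_of_continuous (hw.mono (prod_mono_left (subset_univ _)))
  obtain ⟨ρ, hρ, h⟩ := Metric.uniformContinuousOn_iff.1 huc η hη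
  refine ⟨ρ, hρ, fun x hx t ht s hs hts => ?_⟩
  have := h (x, t) ⟨by simpa using hx, ht⟩ (x, s) ⟨by simpa using hx, hs⟩ (by
    simpa [Prod.dist_eq, hρ, Real.dist_eq] using hts)
  rw [Real.dist_eq] at this
  exact this.le

set_option maxHeartbeats 1000000 in
/-- The spatial Lipschitz bound for the rescaled solution before the final time. -/
lemma IsAdmissible.rescaled_lipschitz (h : IsAdmissible σ g f T lamMinus lamPlus Lg Lf K G)
    {u w : EuclideanSpace ℝ (Fin n) → ℝ → ℝ} (hu : IsViscositySolution (levelSetOp σ g f) T u)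
    {k c l R : ℝ} (hk : Lg * Lf ≤ k) (hk0 : 0 < k) (hl : 1 ≤ l)
    (huw : ∀ x t, u x t = c + Real.exp (k * t) * w x t)
    (hw : ContinuousOn (fun z : EuclideanSpace ℝ (Fin n) × ℝ => w z.1 z.2) (univ ×ˢ Icc 0 T))
    (hR : ∀ x, R < ‖x‖ → ∀ t ∈ Icc 0 T, w x t = 0) (h0 : ∀ x y, w x 0 - w y 0 ≤ l * ‖x - y‖)
    {t : ℝ} (ht : t ∈ Ico 0 T) (x y : EuclideanSpace ℝ (Fin n)) :
    w x t - w y t ≤ l * ‖x - y‖ := by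
  by_contra hcon
  push Not at hcon
  obtain ⟨m, hm0, hm⟩ := exists_abs_le_of_eq_zero_outside hw hR
  have hT : 0 < T := ht.1.trans_lt ht.2
  have hl0 : 0 < l := by linarith
  set γ := (w x t - w y t - l * ‖x - y‖) / 4 with hγ
  have hγ0 : 0 < γ := by rw [hγ]; linarith
  set δ := γ / (2 * l) with hδ
  have hδ0 : 0 < δ := by positivity
  have hδl : 2 * l * δ = γ := by rw [hδ]; field_simp
  -- the barrier `4 m e^{q (t - T)}` keeps maxima away from the final time
  set q := 4 * m / (γ * (T - t)) with hq
  have hTt : 0 < T - t := by linarith [ht.2]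
  have hq0 : 0 < q := by positivity
  set Φ : ℝ → ℝ := fun s => 4 * m * Real.exp (q * (s - T)) with hΦ
  have hΦs : ContDiff ℝ 2 Φ := by fun_prop
  have hΦ0 : ∀ s, 0 ≤ Φ s := fun s => by simp only [hΦ]; positivity
  have hΦd : ∀ s, 0 ≤ deriv Φ s := fun s => by
    have h1 : HasDerivAt Φ (4 * m * (Real.exp (q * (s - T)) * (q * 1))) s :=
      ((((hasDerivAt_id s).sub_const T).const_mul q).exp).const_mul _
    rw [h1.deriv]
    positivity
  have hΦt : Φ t ≤ γ := by
    have h1 : q * (T - t) ≤ Real.exp (q * (T - t)) := by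
      linarith [Real.add_one_le_exp (q * (T - t))]
    have h2 : Real.exp (q * (t - T)) = (Real.exp (q * (T - t)))⁻¹ := by
      rw [← Real.exp_neg]; congr 1; ring
    have h3 : q * (T - t) = 4 * m / γ := by rw [hq]; field_simp
    rw [h3] at h1
    simp only [hΦ]
    rw [h2, h3, ← div_eq_mul_inv, div_le_iff₀ (Real.exp_pos _)]
    calc 4 * m = γ * (4 * m / γ) := by field_simp
      _ ≤ _ := by gcongr
  obtain ⟨ρ₁, hρ₁, hmod₁⟩ := exists_time_modulus hw (R + 4 * m) hγ0
  obtain ⟨ρ₂, hρ₂, hmod₂⟩ := exists_time_modulus h.f_cont (R + 4 * m)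
    (η := k * γ / (l * (|Lg| + 1))) (by positivity)
  set ρ := min (min ρ₁ ρ₂) (1 / q) / 2 with hρ
  have hρ0 : 0 < ρ := by positivity
  have hρ₁' : ρ < ρ₁ := by
    have : min (min ρ₁ ρ₂) (1 / q) ≤ ρ₁ := (min_le_left _ _).trans (min_le_left _ _)
    linarith
  have hρ₂' : ρ < ρ₂ := by
    have : min (min ρ₁ ρ₂) (1 / q) ≤ ρ₂ := (min_le_left _ _).trans (min_le_right _ _)
    linarith
  have hρq : q * ρ ≤ 1 / 2 := by
    have : ρ ≤ 1 / q / 2 := by rw [hρ]; gcongr; exact min_le_right _ _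
    calc q * ρ ≤ q * (1 / q / 2) := by gcongr
      _ = 1 / 2 := by field_simp
  set ε := ρ ^ 2 / (8 * m) with hε
  have hε0 : 0 < ε := by positivity
  set v : SpaceTime n → ℝ := fun z => w z.fst z.snd with hv
  set v₁ : SpaceTime n → ℝ := fun z => v z - Φ z.snd with hv₁
  set v₂ : SpaceTime n → ℝ := fun z => -v z with hv₂
  have hvc : ContinuousOn v (slab n T) :=
    hw.comp (f := fun z : SpaceTime n => (z.fst, z.snd))
      (continuous_fst_spaceTime.prodMk continuous_snd_spaceTime).continuousOn
      fun z hz => ⟨mem_univ _, hz⟩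
  have hv₁c : ContinuousOn v₁ (slab n T) :=
    hvc.sub (hΦs.continuous.comp continuous_snd_spaceTime).continuousOn
  have hv₂c : ContinuousOn v₂ (slab n T) := hvc.neg
  have hvm : ∀ z ∈ slab n T, |v z| ≤ m := fun z hz => hm _ _ hz
  have hm₁ : ∀ z ∈ slab n T, v₁ z ≤ m := fun z hz => by
    have h1 := (abs_le.1 (hvm z hz)).2
    have h2 := hΦ0 z.snd
    simp only [hv₁]; linarith
  have hm₂ : ∀ z ∈ slab n T, v₂ z ≤ m := fun z hz => by
    have h1 := (abs_le.1 (hvm z hz)).1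
    simp only [hv₂]; linarith
  have hΘ0 : ∀ z : SpaceTime n, 0 ≤ penalty l δ ε z := penalty_nonneg hδ0 hε0 hl0.le
  set a : SpaceTime n := WithLp.toLp 2 (x, t) with ha
  set b : SpaceTime n := WithLp.toLp 2 (y, t) with hb
  set z₁ : SpaceTime n := WithLp.toLp 2 ((1 / 2 : ℝ) • (x + y), t) with hz₁
  have haS : a ∈ slab n T := Ico_subset_Icc_self ht
  have hbS : b ∈ slab n T := Ico_subset_Icc_self ht
  have hstart : 2 * γ ≤ v₁ a + v₂ b - penalty l δ ε (z₁ - a) - penalty l δ ε (z₁ - b) := by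
    have e1 : (z₁ - a).fst = (-(1 / 2) : ℝ) • (x - y) := by
      change (1 / 2 : ℝ) • (x + y) - x = _; module
    have e2 : (z₁ - b).fst = (1 / 2 : ℝ) • (x - y) := by
      change (1 / 2 : ℝ) • (x + y) - y = _; module
    have e3 : (z₁ - a).snd = 0 := sub_self t
    have e4 : (z₁ - b).snd = 0 := sub_self t
    have n1 := mul_le_mul_of_nonneg_left (smoothNorm_le_add_norm hδ0 (z₁ - a).fst) hl0.le
    have n2 := mul_le_mul_of_nonneg_left (smoothNorm_le_add_norm hδ0 (z₁ - b).fst) hl0.le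
    have n3 : ‖(z₁ - a).fst‖ = ‖x - y‖ / 2 := by
      rw [e1, norm_smul, Real.norm_eq_abs, abs_neg, abs_of_pos (by norm_num)]; ring
    have n4 : ‖(z₁ - b).fst‖ = ‖x - y‖ / 2 := by
      rw [e2, norm_smul, Real.norm_eq_abs, abs_of_pos (by norm_num)]; ring
    rw [n3] at n1
    rw [n4] at n2
    have v1 : v₁ a = w x t - Φ t := rfl
    have v2 : v₂ b = -w y t := rfl
    rw [v1, v2, penalty, penalty, e3, e4]
    have : w x t - w y t - l * ‖x - y‖ = 4 * γ := by rw [hγ]; ring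
    rw [show (0 : ℝ) ^ 2 / (2 * ε) = 0 by simp]
    linarith
  have hΨR : ∀ x' ∈ slab n T, ∀ y' ∈ slab n T, R < ‖x'.fst‖ → R < ‖y'.fst‖ →
      v₁ x' + v₂ y' ≤ 0 := by
    intro x' hx' y' hy' hx'R hy'R
    have h1 : v x' = 0 := hR _ hx'R _ hx'
    have h2 : v y' = 0 := hR _ hy'R _ hy'
    have h3 := hΦ0 x'.snd
    simp only [hv₁, hv₂, h1, h2]; linarith
  have hfar : ∀ z ∈ slab n T, R + T < ‖z‖ → R < ‖z.fst‖ := by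
    intro z hz hzR
    have h1 : ‖z‖ ≤ ‖z.fst‖ + T := by
      have hT0 : (0 : ℝ) ≤ T := hT.le
      refine abs_le_of_sq_le_sq' ?_ (by positivity) |>.2
      rw [norm_sq_spaceTime]
      have h2 : z.snd ^ 2 ≤ T ^ 2 := pow_le_pow_left₀ hz.1 hz.2 2
      nlinarith [mul_nonneg (norm_nonneg z.fst) hT0]
    linarith
  obtain ⟨z₀, a', ha', b', hb', hmax'⟩ := exists_max_doubling (isClosed_slab T) hv₁c hv₂c hm₁ hm₂
    (continuous_penalty (l := l) (δ := δ) (ε := ε)) (tendsto_penalty hε0 hl hδ0) hΘ0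
    (R := R + T) (fun x' hx' y' hy' h1 h2 => hΨR x' hx' y' hy' (hfar _ hx' h1) (hfar _ hy' h2))
    haS hbS (by linarith : 0 < v₁ a + v₂ b - penalty l δ ε (z₁ - a) - penalty l δ ε (z₁ - b))
  obtain ⟨w₁, hw₁, w₂, hw₂, p, A, B, hmax, hp₁, hp₂, hj₁, hj₂, hA, hB, hAB⟩ :=
    exists_limitSuperjets_of_max (isClosed_slab T) (by positivity : 0 < 6 * l / δ + 1 / ε) hv₁c hv₂c
      hm₁ hm₂ continuous_penalty (continuous_penaltyGrad hδ0) (tendsto_penalty hε0 hl hδ0)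
      (penalty_semiconcave hδ0 hε0 hl0.le) ha' hb' hmax'
  have hΨ := hstart.trans (hmax z₁ a haS b hbS)
  have b₁ := abs_le.1 (hvm w₁ hw₁)
  have b₂ := abs_le.1 (hvm w₂ hw₂)
  set s₁ := smoothNorm δ (z₀ - w₁).fst with hs₁
  set s₂ := smoothNorm δ (z₀ - w₂).fst with hs₂
  have hs₁0 : 0 < s₁ := smoothNorm_pos hδ0 _
  have hs₂0 : 0 < s₂ := smoothNorm_pos hδ0 _
  set d₁ := (z₀ - w₁).snd with hd₁
  set d₂ := (z₀ - w₂).snd with hd₂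
  have hval : 2 * γ + l * s₁ + l * s₂ + Φ w₁.snd + (d₁ ^ 2 + d₂ ^ 2) / (2 * ε) ≤ v w₁ - v w₂ := by
    have e : v₁ w₁ + v₂ w₂ - penalty l δ ε (z₀ - w₁) - penalty l δ ε (z₀ - w₂) =
      v w₁ - Φ w₁.snd - v w₂ - l * s₁ - l * s₂ - (d₁ ^ 2 + d₂ ^ 2) / (2 * ε) := by
      simp only [hv₁, hv₂, penalty]; ring
    rw [e] at hΨ
    linarith
  have hΦ₁ := hΦ0 w₁.snd
  have hdd0 : 0 ≤ (d₁ ^ 2 + d₂ ^ 2) / (2 * ε) := by positivity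
  have hls₁ : s₁ ≤ l * s₁ := le_mul_of_one_le_left hs₁0.le hl
  have hls₂ : s₂ ≤ l * s₂ := le_mul_of_one_le_left hs₂0.le hl
  have hdt : |w₁.snd - w₂.snd| ≤ ρ := by
    have h1 : (d₁ ^ 2 + d₂ ^ 2) / (2 * ε) ≤ 2 * m := by linarith
    rw [div_le_iff₀ (by positivity)] at h1
    have h2 : w₁.snd - w₂.snd = d₂ - d₁ := by
      simp only [hd₁, hd₂, WithLp.sub_snd]; ring
    have h3 : 8 * m * ε = ρ ^ 2 := by rw [hε]; field_simp
    refine abs_le_of_sq_le_sq ?_ hρ0.le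
    rw [h2]
    linarith [sq_nonneg (d₁ + d₂),
      show (d₂ - d₁) ^ 2 = 2 * (d₁ ^ 2 + d₂ ^ 2) - (d₁ + d₂) ^ 2 by ring]
  have hdx : ‖w₁.fst - w₂.fst‖ ≤ s₁ + s₂ := by
    have h1 := norm_le_smoothNorm (δ := δ) (z₀ - w₁).fst
    have h2 := norm_le_smoothNorm (δ := δ) (z₀ - w₂).fst
    have h3 : w₁.fst - w₂.fst = (z₀ - w₂).fst - (z₀ - w₁).fst := by simp
    rw [h3]
    exact (norm_sub_le _ _).trans (by linarith)
  have hball : ‖w₁.fst‖ ≤ R + 4 * m ∧ ‖w₂.fst‖ ≤ R + 4 * m := by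
    have h1 : ‖w₁.fst‖ ≤ R ∨ ‖w₂.fst‖ ≤ R := by
      by_contra hc
      push Not at hc
      have h2 := hΨR w₁ hw₁ w₂ hw₂ hc.1 hc.2
      simp only [hv₁, hv₂] at h2
      linarith
    have h2 : ‖w₁.fst - w₂.fst‖ ≤ 2 * m := by linarith
    have h3 : ‖w₁.fst‖ ≤ ‖w₁.fst - w₂.fst‖ + ‖w₂.fst‖ := by
      simpa using norm_add_le (w₁.fst - w₂.fst) w₂.fst
    have h4 : ‖w₂.fst‖ ≤ ‖w₁.fst - w₂.fst‖ + ‖w₁.fst‖ := by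
      rw [norm_sub_rev]; simpa using norm_add_le (w₂.fst - w₁.fst) w₁.fst
    rcases h1 with h1 | h1 <;> exact ⟨by linarith, by linarith⟩
  have h00 : (0 : ℝ) ∈ Icc 0 T := ⟨le_rfl, hT.le⟩
  have hinit : w w₁.fst 0 - w w₂.fst 0 ≤ l * s₁ + l * s₂ := by
    refine (h0 _ _).trans ?_
    rw [← mul_add]
    gcongr
  have hΦlow : T - ρ ≤ w₁.snd → 2 * m ≤ Φ w₁.snd := by
    intro h1
    have h2 := Real.add_one_le_exp (q * (w₁.snd - T))
    have h3 : -(q * ρ) ≤ q * (w₁.snd - T) := by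
      rw [← mul_neg]; gcongr; linarith
    have h4 : 1 / 2 ≤ Real.exp (q * (w₁.snd - T)) := by linarith
    calc 2 * m = 4 * m * (1 / 2) := by ring
      _ ≤ 4 * m * Real.exp (q * (w₁.snd - T)) := by gcongr
  have hdt' := abs_le.1 hdt
  have hI₁ : w₁.snd ∈ Ioo 0 T := by
    refine ⟨lt_of_le_of_ne hw₁.1 fun hz => ?_, lt_of_le_of_ne hw₁.2 fun hz => ?_⟩
    · have h1 := (abs_le.1 (hmod₁ w₂.fst hball.2 w₂.snd hw₂ 0 h00
        (by rw [hz, abs_sub_comm]; linarith))).1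
      have h2 : v w₁ = w w₁.fst 0 := by simp only [hv, ← hz]
      have h3 : v w₂ = w w₂.fst w₂.snd := rfl
      linarith
    · have := hΦlow (by linarith)
      linarith
  have hI₂ : w₂.snd ∈ Ioo 0 T := by
    refine ⟨lt_of_le_of_ne hw₂.1 fun hz => ?_, lt_of_le_of_ne hw₂.2 fun hz => ?_⟩
    · have h1 := (abs_le.1 (hmod₁ w₁.fst hball.1 w₁.snd hw₁ 0 h00 (by rw [hz]; linarith))).2
      have h2 : v w₂ = w w₂.fst 0 := by simp only [hv, ← hz]
      have h3 : v w₁ = w w₁.fst w₁.snd := rfl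
      linarith
    · have := hΦlow (by linarith)
      linarith
  have hfin := h.doubling_inequality hu hk hk0.le hΦs (v := v) (fun z _ => huw _ _) hvc
    (fun _ => rfl) (fun _ => rfl) hl0 hδ0 hI₁ hI₂ hmax hp₁ hp₂ hj₁ hj₂ hA hB hAB
  have hf := hmod₂ w₂.fst hball.2 w₁.snd hw₁ w₂.snd hw₂ (by linarith)
  have hfl : l * |Lg| * |f w₂.fst w₁.snd - f w₂.fst w₂.snd| ≤ k * γ := by
    calc _ ≤ l * (|Lg| + 1) * (k * γ / (l * (|Lg| + 1))) := by gcongr; linarith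
      _ = k * γ := by field_simp
  have hkv : k * (2 * γ + l * s₁ + l * s₂) ≤ k * (v w₁ - v w₂) := by
    gcongr; linarith
  have := hΦd w₁.snd
  have : 0 < k * γ := by positivity
  linarith

/-- Spatial Lipschitz continuity: the Lipschitz constant grows at most exponentially in time. -/
theorem IsAdmissible.spatial_lipschitz (h : IsAdmissible σ g f T lamMinus lamPlus Lg Lf K G)
    {u : EuclideanSpace ℝ (Fin n) → ℝ → ℝ} (hu : IsViscositySolution (levelSetOp σ g f) T u)
    (hT : 0 < T) {k c l R : ℝ} (hk : Lg * Lf ≤ k) (hk0 : 0 < k) (hl : 1 ≤ l)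
    (huc : ContinuousOn (fun z : EuclideanSpace ℝ (Fin n) × ℝ => u z.1 z.2) (univ ×ˢ Icc 0 T))
    (hR : ∀ x, R < ‖x‖ → ∀ t ∈ Icc 0 T, u x t = c) (h0 : ∀ x y, |u x 0 - u y 0| ≤ l * ‖x - y‖)
    {t : ℝ} (ht : t ∈ Icc 0 T) (x y : EuclideanSpace ℝ (Fin n)) :
    |u x t - u y t| ≤ l * Real.exp (k * T) * ‖x - y‖ := by
  set w : EuclideanSpace ℝ (Fin n) → ℝ → ℝ := fun x t => Real.exp (-(k * t)) * (u x t - c) with hw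
  have huw : ∀ x t, u x t = c + Real.exp (k * t) * w x t := fun x t => by
    rw [hw, ← mul_assoc, ← Real.exp_add]; simp
  have hwc : ContinuousOn (fun z : EuclideanSpace ℝ (Fin n) × ℝ => w z.1 z.2) (univ ×ˢ Icc 0 T) :=
    (Continuous.continuousOn (by fun_prop)).mul (huc.sub continuousOn_const)
  have hw0 : ∀ x y, w x 0 - w y 0 ≤ l * ‖x - y‖ := fun x y => by
    refine le_trans (le_of_eq ?_) ((le_abs_self _).trans (h0 x y))
    simp [hw]
  have hwt : ∀ x : EuclideanSpace ℝ (Fin n), ContinuousOn (fun t => w x t) (Icc 0 T) := fun x =>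
    hwc.comp (f := fun t => (x, t)) (by fun_prop) fun t ht => ⟨mem_univ _, ht⟩
  have key : ∀ x y, w x t - w y t ≤ l * ‖x - y‖ := by
    intro x y
    refine le_on_closure (s := Ico 0 T) (f := fun t => w x t - w y t) (g := fun _ => l * ‖x - y‖)
      (fun s hs => h.rescaled_lipschitz (R := R) hu hk hk0 hl huw hwc (fun x hx t ht => ?_)
        hw0 hs x y)
      ?_ continuousOn_const (by rwa [closure_Ico hT.ne])
    · simp [hw, hR x hx t ht]
    · rw [closure_Ico hT.ne]
      exact (hwt x).sub (hwt y)
  have hkey : |w x t - w y t| ≤ l * ‖x - y‖ := by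
    rw [abs_le]
    have := key y x
    rw [norm_sub_rev] at this
    exact ⟨by linarith, key x y⟩
  rw [huw x, huw y, add_sub_add_left_eq_sub, ← mul_sub, abs_mul, abs_of_pos (Real.exp_pos _)]
  calc _ ≤ Real.exp (k * T) * (l * ‖x - y‖) := by
        gcongr
        exact ht.2
    _ = _ := by ring

end doubling

end

section
open scoped InnerProductSpace NNReal ENNReal

/-! ### The dual energy of the regularized anisotropy -/

section dual
variable {n : ℕ} {σ : EuclideanSpace ℝ (Fin n) → ℝ} {x x' p p' : EuclideanSpace ℝ (Fin n)}

/-- The uniformly convex energy `(σ(p)² + |p|²) / 2`. -/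
noncomputable def primalEnergy (σ : EuclideanSpace ℝ (Fin n) → ℝ) (p : EuclideanSpace ℝ (Fin n)) :
    ℝ :=
  (σ p ^ 2 + ‖p‖ ^ 2) / 2

/-- The convex conjugate of `primalEnergy σ`. -/
noncomputable def dualEnergy (σ : EuclideanSpace ℝ (Fin n) → ℝ) (x : EuclideanSpace ℝ (Fin n)) :
    ℝ :=
  ⨆ p, (⟪x, p⟫_ℝ - primalEnergy σ p)

/-- `p` attains the supremum defining `dualEnergy σ x`. -/
def IsDualPoint (σ : EuclideanSpace ℝ (Fin n) → ℝ) (x p : EuclideanSpace ℝ (Fin n)) : Prop :=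
  ∀ q, ⟪x, q⟫_ℝ - primalEnergy σ q ≤ ⟪x, p⟫_ℝ - primalEnergy σ p

lemma IsDualPoint.dualEnergy_eq (h : IsDualPoint σ x p) :
    dualEnergy σ x = ⟪x, p⟫_ℝ - primalEnergy σ p :=
  le_antisymm (ciSup_le h) (le_ciSup (f := fun q => ⟪x, q⟫_ℝ - primalEnergy σ q)
    ⟨_, forall_mem_range.2 h⟩ p)

lemma exists_isDualPoint (hc : ConvexOn ℝ univ σ) (h0 : σ 0 = 0) (x : EuclideanSpace ℝ (Fin n)) :
    ∃ p, IsDualPoint σ x p := by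
  have hσ : Continuous σ := continuousOn_univ.1 (hc.continuousOn isOpen_univ)
  have hcont : Continuous fun q => ⟪x, q⟫_ℝ - primalEnergy σ q := by
    unfold primalEnergy; fun_prop
  refine hcont.exists_forall_ge' 0 ?_
  filter_upwards [tendsto_norm_cocompact_atTop.eventually_gt_atTop (2 * ‖x‖)] with q hq
  have h1 := real_inner_le_norm x q
  have h2 : 2 * ‖x‖ * ‖q‖ ≤ ‖q‖ * ‖q‖ := by gcongr
  simp only [primalEnergy, h0, inner_zero_right, norm_zero]
  nlinarith [sq_nonneg (σ q)]

lemma le_dualEnergy (hc : ConvexOn ℝ univ σ) (h0 : σ 0 = 0) (x q : EuclideanSpace ℝ (Fin n)) :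
    ⟪x, q⟫_ℝ - primalEnergy σ q ≤ dualEnergy σ x := by
  obtain ⟨p, hp⟩ := exists_isDualPoint hc h0 x
  exact hp.dualEnergy_eq ▸ hp q

/-- Strong convexity of the energy around a dual point. -/
lemma IsDualPoint.le_primalEnergy (h : IsDualPoint σ x p) (hc : ConvexOn ℝ univ σ)
    (hσ : ∀ q, 0 ≤ σ q) (q : EuclideanSpace ℝ (Fin n)) :
    primalEnergy σ p + ⟪x, q - p⟫_ℝ + 1 / 2 * ‖q - p‖ ^ 2 ≤ primalEnergy σ q := by
  have key : ∀ s ∈ Ioo (0 : ℝ) 1, primalEnergy σ p + ⟪x, q - p⟫_ℝ + (1 - s) / 2 * ‖q - p‖ ^ 2 ≤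
      primalEnergy σ q := by
    intro s ⟨hs0, hs1⟩
    have h1 : σ ((1 - s) • p + s • q) ≤ (1 - s) * σ p + s * σ q :=
      hc.2 (mem_univ _) (mem_univ _) (by linarith) hs0.le (by ring)
    have h2 : σ ((1 - s) • p + s • q) ^ 2 ≤ (1 - s) * σ p ^ 2 + s * σ q ^ 2 := by
      have h3 : σ ((1 - s) • p + s • q) ^ 2 ≤ ((1 - s) * σ p + s * σ q) ^ 2 :=
        pow_le_pow_left₀ (hσ _) h1 2
      have h4 : 0 ≤ (1 - s) * s * (σ p - σ q) ^ 2 := by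
        have : 0 < 1 - s := by linarith
        positivity
      linarith [show (1 - s) * σ p ^ 2 + s * σ q ^ 2 - ((1 - s) * σ p + s * σ q) ^ 2 =
        (1 - s) * s * (σ p - σ q) ^ 2 by ring]
    have h3 : (1 - s) • p + s • q = p + s • (q - p) := by module
    have h4 : ‖(1 - s) • p + s • q‖ ^ 2 = ‖p‖ ^ 2 + 2 * s * ⟪p, q - p⟫_ℝ + s ^ 2 * ‖q - p‖ ^ 2 := by
      rw [h3, norm_add_sq_real, inner_smul_right, norm_smul, mul_pow, Real.norm_eq_abs, sq_abs]
      ring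
    have h5 : ‖q‖ ^ 2 = ‖p‖ ^ 2 + 2 * ⟪p, q - p⟫_ℝ + ‖q - p‖ ^ 2 := by
      rw [← norm_add_sq_real, add_sub_cancel]
    have h6 := h ((1 - s) • p + s • q)
    have h7 : ⟪x, (1 - s) • p + s • q⟫_ℝ = ⟪x, p⟫_ℝ + s * ⟪x, q - p⟫_ℝ := by
      rw [h3, inner_add_right, inner_smul_right]
    rw [h7] at h6
    unfold primalEnergy at h6 ⊢
    rw [h4] at h6
    have h8 : s * ((σ p ^ 2 + ‖p‖ ^ 2) / 2 + ⟪x, q - p⟫_ℝ + (1 - s) / 2 * ‖q - p‖ ^ 2) ≤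
        s * ((σ q ^ 2 + ‖q‖ ^ 2) / 2) := by
      rw [h5]
      linarith
    exact le_of_mul_le_mul_left h8 hs0
  have hlim : Tendsto (fun s : ℝ => primalEnergy σ p + ⟪x, q - p⟫_ℝ + (1 - s) / 2 * ‖q - p‖ ^ 2)
      (𝓝[>] 0) (𝓝 (primalEnergy σ p + ⟪x, q - p⟫_ℝ + (1 - 0) / 2 * ‖q - p‖ ^ 2)) :=
    (Continuous.tendsto (by fun_prop) 0).mono_left nhdsWithin_le_nhds
  rw [sub_zero] at hlim
  exact le_of_tendsto hlim (by
    filter_upwards [Ioo_mem_nhdsGT (zero_lt_one' ℝ)] with s hs using key s hs)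

lemma IsDualPoint.norm_sub_le (h : IsDualPoint σ x p) (h' : IsDualPoint σ x' p')
    (hc : ConvexOn ℝ univ σ) (hσ : ∀ q, 0 ≤ σ q) : ‖p' - p‖ ≤ ‖x' - x‖ := by
  have h1 := h.le_primalEnergy hc hσ p'
  have h2 := h'.le_primalEnergy hc hσ p
  have h3 : ⟪x', p - p'⟫_ℝ = -⟪x' - x, p' - p⟫_ℝ - ⟪x, p' - p⟫_ℝ := by
    rw [← neg_sub p' p, inner_neg_right, inner_sub_left]; ring
  rw [h3, norm_sub_rev p p'] at h2
  have h4 := real_inner_le_norm (x' - x) (p' - p)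
  by_contra hcon
  push Not at hcon
  have h5 : 0 < ‖p' - p‖ := (norm_nonneg _).trans_lt hcon
  nlinarith

lemma convexOn_dualEnergy (hc : ConvexOn ℝ univ σ) (h0 : σ 0 = 0) :
    ConvexOn ℝ univ (dualEnergy σ) := by
  refine ⟨convex_univ, fun x _ y _ a b ha hb hab => ?_⟩
  obtain ⟨p, hp⟩ := exists_isDualPoint hc h0 (a • x + b • y)
  have h1 := mul_le_mul_of_nonneg_left (le_dualEnergy hc h0 x p) ha
  have h2 := mul_le_mul_of_nonneg_left (le_dualEnergy hc h0 y p) hb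
  rw [hp.dualEnergy_eq, inner_add_left, inner_smul_left, inner_smul_left, RCLike.conj_to_real,
    RCLike.conj_to_real, smul_eq_mul, smul_eq_mul]
  have h3 : primalEnergy σ p = a * primalEnergy σ p + b * primalEnergy σ p := by
    rw [← add_mul, hab, one_mul]
  linarith

lemma continuous_dualEnergy (hc : ConvexOn ℝ univ σ) (h0 : σ 0 = 0) : Continuous (dualEnergy σ) :=
  continuousOn_univ.1 ((convexOn_dualEnergy hc h0).continuousOn isOpen_univ)

lemma dualEnergy_nonneg (hc : ConvexOn ℝ univ σ) (h0 : σ 0 = 0) (x : EuclideanSpace ℝ (Fin n)) :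
    0 ≤ dualEnergy σ x := by
  have := le_dualEnergy hc h0 x 0
  simpa [primalEnergy, h0] using this

lemma dualEnergy_le (hc : ConvexOn ℝ univ σ) (h0 : σ 0 = 0) (x : EuclideanSpace ℝ (Fin n)) :
    dualEnergy σ x ≤ ‖x‖ ^ 2 / 2 := by
  obtain ⟨p, hp⟩ := exists_isDualPoint hc h0 x
  rw [hp.dualEnergy_eq, primalEnergy]
  have h1 := real_inner_le_norm x p
  nlinarith [sq_nonneg (‖x‖ - ‖p‖), sq_nonneg (σ p)]

lemma le_dualEnergy_of_le (hc : ConvexOn ℝ univ σ) (hσ : ∀ q, 0 ≤ σ q) {b : ℝ}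
    (hb : ∀ q, σ q ≤ b * ‖q‖) (x : EuclideanSpace ℝ (Fin n)) :
    ‖x‖ ^ 2 / (2 * (b ^ 2 + 1)) ≤ dualEnergy σ x := by
  have h0 : σ 0 = 0 := le_antisymm (by simpa using hb 0) (hσ 0)
  refine le_trans (le_of_eq ?_) ((sub_le_sub_left (?_ : primalEnergy σ ((b ^ 2 + 1)⁻¹ • x) ≤
    (b ^ 2 + 1) * ‖(b ^ 2 + 1)⁻¹ • x‖ ^ 2 / 2) _).trans
    (le_dualEnergy hc h0 x ((b ^ 2 + 1)⁻¹ • x)))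
  · have : 0 < b ^ 2 + 1 := by positivity
    rw [inner_smul_right, real_inner_self_eq_norm_sq, norm_smul, Real.norm_eq_abs,
      abs_of_pos (by positivity)]
    field_simp
    ring
  · have h1 := pow_le_pow_left₀ (hσ _) (hb ((b ^ 2 + 1)⁻¹ • x)) 2
    rw [primalEnergy]
    linarith

lemma primalEnergy_smul (hh : ∀ (a : ℝ) (x : EuclideanSpace ℝ (Fin n)), 0 < a → σ (a • x) = a * σ x)
    {s : ℝ} (hs : 0 < s) (p : EuclideanSpace ℝ (Fin n)) :
    primalEnergy σ (s • p) = s ^ 2 * primalEnergy σ p := by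
  rw [primalEnergy, primalEnergy, hh s p hs, norm_smul, Real.norm_eq_abs, abs_of_pos hs]; ring

/-- Homogeneity of degree two makes the two energies agree at dual points. -/
lemma IsDualPoint.dualEnergy_eq_primalEnergy (h : IsDualPoint σ x p)
    (hh : ∀ (a : ℝ) (x : EuclideanSpace ℝ (Fin n)), 0 < a → σ (a • x) = a * σ x) :
    ⟪x, p⟫_ℝ = 2 * primalEnergy σ p ∧ dualEnergy σ x = primalEnergy σ p := by
  have key : ∀ s : ℝ, 0 < s → (s - 1) * ⟪x, p⟫_ℝ ≤ (s ^ 2 - 1) * primalEnergy σ p := by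
    intro s hs
    have := h (s • p)
    rw [primalEnergy_smul hh hs, inner_smul_right] at this
    linarith
  have hE : 0 ≤ primalEnergy σ p := by unfold primalEnergy; positivity
  have h1 : ∀ ε ∈ Ioo (0 : ℝ) 1, ⟪x, p⟫_ℝ ≤ 2 * primalEnergy σ p + ε * primalEnergy σ p ∧
      2 * primalEnergy σ p ≤ ⟪x, p⟫_ℝ + ε * primalEnergy σ p := by
    intro ε ⟨hε0, hε1⟩
    constructor
    · refine le_of_mul_le_mul_left ?_ hε0
      linarith [key (1 + ε) (by linarith)]
    · refine le_of_mul_le_mul_left ?_ hε0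
      linarith [key (1 - ε) (by linarith)]
  have hlim : Tendsto (fun ε : ℝ => ε * primalEnergy σ p) (𝓝[>] 0) (𝓝 0) := by
    have : Continuous fun ε : ℝ => ε * primalEnergy σ p := by fun_prop
    simpa using (this.tendsto 0).mono_left nhdsWithin_le_nhds
  have hev : ∀ᶠ ε in 𝓝[>] (0 : ℝ), ε ∈ Ioo (0 : ℝ) 1 := Ioo_mem_nhdsGT (zero_lt_one' ℝ)
  have e1 := ge_of_tendsto (hlim.const_add (2 * primalEnergy σ p))
    (hev.mono fun ε hε => (h1 ε hε).1)
  have e2 := ge_of_tendsto (hlim.const_add ⟪x, p⟫_ℝ) (hev.mono fun ε hε => (h1 ε hε).2)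
  have e3 : ⟪x, p⟫_ℝ = 2 * primalEnergy σ p := by linarith
  exact ⟨e3, by rw [h.dualEnergy_eq, e3]; ring⟩

lemma IsDualPoint.ne_zero (h : IsDualPoint σ x p) (hσ : ∀ q, 0 ≤ σ q) {b : ℝ}
    (hb : ∀ q, σ q ≤ b * ‖q‖) (hc : ConvexOn ℝ univ σ) (hx : x ≠ 0) : p ≠ 0 := by
  rintro rfl
  have h1 := le_dualEnergy_of_le hc hσ hb x
  have h0 : σ 0 = 0 := le_antisymm (by simpa using hb 0) (hσ 0)
  rw [h.dualEnergy_eq, primalEnergy, h0] at h1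
  have h2 : 0 < ‖x‖ := norm_pos_iff.2 hx
  have h3 : 0 < ‖x‖ ^ 2 / (2 * (b ^ 2 + 1)) := by positivity
  simp at h1
  linarith

end dual

end

section
open scoped InnerProductSpace NNReal ENNReal
open InnerProductSpace

/-! ### Second order behaviour of the dual energy -/

section inverse
variable {V : Type*} [NormedAddCommGroup V] [InnerProductSpace ℝ V] [FiniteDimensional ℝ V]

/-- A coercive symmetric operator has a symmetric nonnegative inverse. -/
lemma exists_inverse_of_coercive {A : V →L[ℝ] V} (hA : (A : V →ₗ[ℝ] V).IsSymmetric)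
    (hco : ∀ ξ, ‖ξ‖ ^ 2 ≤ ⟪A ξ, ξ⟫_ℝ) :
    ∃ B : V →L[ℝ] V, (∀ ξ, A (B ξ) = ξ) ∧ (∀ ξ, B (A ξ) = ξ) ∧
      (B : V →ₗ[ℝ] V).IsSymmetric ∧ ∀ ξ, 0 ≤ ⟪B ξ, ξ⟫_ℝ := by
  have hinj : Function.Injective (A : V →ₗ[ℝ] V) := by
    rw [injective_iff_map_eq_zero]
    intro ξ hξ
    have h1 := hco ξ
    rw [show A ξ = 0 from hξ, inner_zero_left] at h1
    have : ‖ξ‖ ^ 2 = 0 := le_antisymm h1 (by positivity)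
    simpa using this
  set e := (LinearEquiv.ofInjectiveEndo (A : V →ₗ[ℝ] V) hinj).toContinuousLinearEquiv with he
  have h1 : ∀ ξ, A (e.symm ξ) = ξ := fun ξ => e.apply_symm_apply ξ
  have h2 : ∀ ξ, e.symm (A ξ) = ξ := fun ξ => e.symm_apply_apply ξ
  refine ⟨(e.symm : V →L[ℝ] V), h1, h2, fun a b => ?_, fun ξ => ?_⟩
  · have := hA (e.symm a) (e.symm b)
    simp only [ContinuousLinearMap.coe_coe, h1] at this
    exact this.symm
  · have := hco (e.symm ξ)
    rw [h1, real_inner_comm] at this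
    exact (by positivity : (0 : ℝ) ≤ ‖e.symm ξ‖ ^ 2).trans this

end inverse

section dual
variable {n : ℕ} {σ : EuclideanSpace ℝ (Fin n) → ℝ} {x p : EuclideanSpace ℝ (Fin n)}

/-- The Hessian `σ ∇²σ + ∇σ ⊗ ∇σ + 1` of `primalEnergy σ`. -/
noncomputable def energyHessian (σ : EuclideanSpace ℝ (Fin n) → ℝ)
    (p : EuclideanSpace ℝ (Fin n)) : EuclideanSpace ℝ (Fin n) →L[ℝ] EuclideanSpace ℝ (Fin n) :=
  σ p • hessian σ p + rankOne ℝ (gradient σ p) (gradient σ p) + ContinuousLinearMap.id ℝ _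

lemma energyHessian_apply (ξ : EuclideanSpace ℝ (Fin n)) : energyHessian σ p ξ =
    σ p • hessian σ p ξ + ⟪gradient σ p, ξ⟫_ℝ • gradient σ p + ξ := rfl

lemma isSymmetric_energyHessian (h : ContDiffAt ℝ 2 σ p) :
    (energyHessian σ p : EuclideanSpace ℝ (Fin n) →ₗ[ℝ] EuclideanSpace ℝ (Fin n)).IsSymmetric := by
  intro a b
  have h1 : ⟪hessian σ p a, b⟫_ℝ = ⟪a, hessian σ p b⟫_ℝ := isSymmetric_hessian h a b
  simp only [ContinuousLinearMap.coe_coe, energyHessian_apply, inner_add_left, inner_add_right,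
    inner_smul_left, inner_smul_right, RCLike.conj_to_real, h1, real_inner_comm (gradient σ p)]
  ring

lemma norm_sq_le_inner_energyHessian (h : ContDiffAt ℝ 2 σ p) (hc : ConvexOn ℝ univ σ)
    (hσ : 0 ≤ σ p) (ξ : EuclideanSpace ℝ (Fin n)) : ‖ξ‖ ^ 2 ≤ ⟪energyHessian σ p ξ, ξ⟫_ℝ := by
  have h1 := mul_nonneg hσ (inner_hessian_nonneg h hc ξ)
  rw [energyHessian_apply, inner_add_left, inner_add_left, inner_smul_left, inner_smul_left,
    real_inner_self_eq_norm_sq, RCLike.conj_to_real, RCLike.conj_to_real]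
  nlinarith [mul_self_nonneg ⟪gradient σ p, ξ⟫_ℝ]

lemma hasGradientAt_primalEnergy (h : DifferentiableAt ℝ σ p) :
    HasGradientAt (primalEnergy σ) (σ p • gradient σ p + p) p := by
  rw [hasGradientAt_iff_hasFDerivAt]
  have h1 := ((h.hasGradientAt.hasFDerivAt.pow 2).add
    (hasStrictFDerivAt_norm_sq p).hasFDerivAt).const_mul (1 / 2 : ℝ)
  refine (h1.congr_fderiv ?_).congr_of_eventuallyEq (Eventually.of_forall fun q => ?_)
  · ext ξ
    simp
    ring
  · simp only [primalEnergy, Pi.add_apply]; ring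

lemma hasExpansion_primalEnergy (h : ContDiffOn ℝ 2 σ {0}ᶜ) (hp : p ≠ 0) :
    HasExpansion (primalEnergy σ) p (σ p • gradient σ p + p) (energyHessian σ p) := by
  have hC := h.contDiffAt_compl_zero hp
  have hg : ∀ q, q ≠ 0 → HasGradientAt (primalEnergy σ) (σ q • gradient σ q + q) q := fun q hq =>
    hasGradientAt_primalEnergy ((h.contDiffAt_compl_zero hq).differentiableAt (by norm_num))
  have hne : ∀ᶠ q in 𝓝 p, q ≠ 0 := isOpen_ne.mem_nhds hp
  have hσ := (hC.differentiableAt (by norm_num)).hasGradientAt.hasFDerivAt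
  have hh : HasFDerivAt (gradient (primalEnergy σ)) (energyHessian σ p) p := by
    refine (((hσ.smul (hasFDerivAt_gradient hC)).add (hasFDerivAt_id p)).congr_fderiv
      ?_).congr_of_eventuallyEq (hne.mono fun q hq => (hg q hq).gradient)
    ext1 ξ
    rw [energyHessian_apply]
    simp
  have := HasExpansion.of_contDiffAt (hne.mono fun q hq => (hg q hq).differentiableAt)
    (hh.differentiableAt.hasFDerivAt)
  rwa [(hg p hp).gradient, show hessian (primalEnergy σ) p = energyHessian σ p from hh.fderiv]
    at this

lemma IsDualPoint.eq_gradient (hd : IsDualPoint σ x p) (h : ContDiffOn ℝ 2 σ {0}ᶜ)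
    (hc : ConvexOn ℝ univ σ) (hσ : ∀ q, 0 ≤ σ q) (hp : p ≠ 0) :
    σ p • gradient σ p + p = x := by
  refine ((hasExpansion_primalEnergy h hp).ge_of_ge (c := 0) fun w => ?_).1
  have := hd.le_primalEnergy hc hσ w
  have : 0 ≤ ‖w - p‖ ^ 2 := by positivity
  linarith

/-- The dual energy is bounded from above to second order by the inverse Hessian of the primal
energy. -/
lemma IsDualPoint.hasSuperjet_dualEnergy (hd : IsDualPoint σ x p) (h : ContDiffOn ℝ 2 σ {0}ᶜ)
    (hc : ConvexOn ℝ univ σ) (hσ : ∀ q, 0 ≤ σ q) (h0 : σ 0 = 0) (hp : p ≠ 0)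
    {B : EuclideanSpace ℝ (Fin n) →L[ℝ] EuclideanSpace ℝ (Fin n)}
    (hB : ∀ ξ, energyHessian σ p (B ξ) = ξ) :
    HasSuperjet univ (dualEnergy σ) x p B := by
  intro ε hε
  have hex := hasExpansion_primalEnergy h hp
  rw [hd.eq_gradient h hc hσ hp] at hex
  obtain ⟨r, hr, hball⟩ := Metric.eventually_nhds_iff.1 (hex ε hε)
  have hC := h.contDiffAt_compl_zero hp
  filter_upwards [Metric.ball_mem_nhds (0 : EuclideanSpace ℝ (Fin n)) hr] with ξ hξ _
  obtain ⟨q, hq⟩ := exists_isDualPoint hc h0 (x + ξ)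
  obtain ⟨η, rfl⟩ : ∃ η, q = p + η := ⟨q - p, by abel⟩
  have h1 : ‖η‖ ≤ ‖ξ‖ := by simpa using hd.norm_sub_le hq hc hσ
  have h2 := (abs_le.1 (hball (show dist η 0 < r by
    rw [dist_zero_right]; exact h1.trans_lt (by simpa using hξ)))).1
  have h3 := norm_sq_le_inner_energyHessian hC hc (hσ p) (η - B ξ)
  have h4 : ⟪energyHessian σ p η, B ξ⟫_ℝ = ⟪ξ, η⟫_ℝ := by
    have : ⟪energyHessian σ p η, B ξ⟫_ℝ = ⟪η, energyHessian σ p (B ξ)⟫_ℝ :=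
      isSymmetric_energyHessian hC η (B ξ)
    rw [this, hB, real_inner_comm]
  rw [map_sub, hB, inner_sub_left, inner_sub_right, inner_sub_right, h4,
    real_inner_comm (B ξ) ξ] at h3
  have h5 : 0 ≤ ‖η - B ξ‖ ^ 2 := by positivity
  have h6 : ε * ‖η‖ ^ 2 ≤ ε * ‖ξ‖ ^ 2 := by gcongr
  rw [hq.dualEnergy_eq, hd.dualEnergy_eq, inner_add_left, inner_add_right, inner_add_right,
    real_inner_comm p ξ]
  linarith

/-- The curvature of the level sets of the dual energy is that of a Wulff shape of radius `σ(p)`,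
up to the regularization, which only decreases it. -/
lemma trace_hessian_comp_inverse_le (h : ContDiffAt ℝ 2 σ p)
    (hh : ∀ (a : ℝ) (x : EuclideanSpace ℝ (Fin n)), 0 < a → σ (a • x) = a * σ x) (hp : p ≠ 0)
    (hσ : 0 < σ p) {B : EuclideanSpace ℝ (Fin n) →L[ℝ] EuclideanSpace ℝ (Fin n)}
    (hAB : ∀ ξ, energyHessian σ p (B ξ) = ξ) (hBA : ∀ ξ, B (energyHessian σ p ξ) = ξ)
    (hBs : (B : EuclideanSpace ℝ (Fin n) →ₗ[ℝ] EuclideanSpace ℝ (Fin n)).IsSymmetric)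
    (hB0 : ∀ ξ, 0 ≤ ⟪B ξ, ξ⟫_ℝ) :
    LinearMap.trace ℝ (EuclideanSpace ℝ (Fin n)) ((hessian σ p).comp B).toLinearMap ≤
      ((n : ℝ) - 1) / σ p := by
  set a := gradient σ p with ha
  set e := ‖p‖⁻¹ • p with he
  set y := σ p • a + p with hy
  have hpn : 0 < ‖p‖ := norm_pos_iff.2 hp
  have hap : ⟪a, p⟫_ℝ = σ p := inner_gradient_self (h.differentiableAt (by norm_num)) hh
  have hBy : B y = p := by
    have : energyHessian σ p p = y := by
      rw [energyHessian_apply, hessian_apply_self h hh, hap, smul_zero, zero_add]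
    rw [← this, hBA]
  set N := σ p ^ 2 + ‖p‖ ^ 2 with hN
  have hN0 : 0 < N := by positivity
  have hyp : ⟪y, p⟫_ℝ = N := by
    rw [hy, inner_add_left, inner_smul_left, RCLike.conj_to_real, hap, real_inner_self_eq_norm_sq]
    ring
  have hep : ⟪e, p⟫_ℝ = ‖p‖ := by
    rw [he, inner_smul_left, RCLike.conj_to_real, real_inner_self_eq_norm_sq]
    field_simp
  have hen : ‖e‖ = 1 := by rw [he, norm_smul, norm_inv, norm_norm, inv_mul_cancel₀ hpn.ne']
  -- the Cauchy-Schwarz inequality for the form `⟪B ξ, ξ⟫`, against the vector `y`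
  have hcs : ∀ w, ⟪w, p⟫_ℝ ^ 2 / N ≤ ⟪B w, w⟫_ℝ := by
    intro w
    have h1 := hB0 (w - (⟪w, p⟫_ℝ / N) • y)
    have h2 : ⟪B w, y⟫_ℝ = ⟪w, p⟫_ℝ := by
      have : ⟪B w, y⟫_ℝ = ⟪w, B y⟫_ℝ := hBs w y
      rw [this, hBy]
    rw [map_sub, map_smul, hBy, inner_sub_left, inner_sub_right, inner_sub_right, inner_smul_left,
      inner_smul_right, inner_smul_left, inner_smul_right, RCLike.conj_to_real, h2,
      real_inner_comm w p, real_inner_comm y p, hyp] at h1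
    have h3 : ⟪w, p⟫_ℝ / N * (⟪w, p⟫_ℝ / N * N) = ⟪w, p⟫_ℝ ^ 2 / N := by field_simp
    have h4 : ⟪w, p⟫_ℝ / N * ⟪w, p⟫_ℝ = ⟪w, p⟫_ℝ ^ 2 / N := by ring
    rw [h3, h4] at h1
    linarith
  have hsum : 1 ≤ ⟪B a, a⟫_ℝ + ⟪B e, e⟫_ℝ := by
    have h1 := hcs a
    have h2 := hcs e
    rw [hap] at h1
    rw [hep] at h2
    have h3 : σ p ^ 2 / N + ‖p‖ ^ 2 / N = 1 := by rw [← add_div]; exact div_self hN0.ne'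
    linarith
  have htrB : ⟪B e, e⟫_ℝ ≤ LinearMap.trace ℝ (EuclideanSpace ℝ (Fin n)) B.toLinearMap := by
    have h1 := trace_comp_mono (D := B) (X := rankOne ℝ e e) (Y := ContinuousLinearMap.id ℝ _)
      (isSymmetric_rankOne_self e) (fun _ _ => rfl) hB0 fun ξ => by
        rw [rankOne_apply, inner_smul_left, RCLike.conj_to_real]
        change _ ≤ ⟪ξ, ξ⟫_ℝ
        have := real_inner_mul_inner_self_le e ξ
        rw [real_inner_self_eq_norm_sq, hen] at this
        linarith
    rw [comp_rankOne, trace_rankOne, ContinuousLinearMap.comp_id, real_inner_comm] at h1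
    exact h1
  have hdec : σ p • ((hessian σ p).comp B).toLinearMap = LinearMap.id -
      (rankOne ℝ a (B a)).toLinearMap - B.toLinearMap := by
    ext1 ξ
    have h1 := hAB ξ
    rw [energyHessian_apply] at h1
    have h2 : ⟪B a, ξ⟫_ℝ = ⟪a, B ξ⟫_ℝ := hBs a ξ
    change σ p • hessian σ p (B ξ) = ξ - ⟪B a, ξ⟫_ℝ • a - B ξ
    rw [h2]
    nth_rewrite 2 [← h1]
    abel
  have htr := congrArg (LinearMap.trace ℝ (EuclideanSpace ℝ (Fin n))) hdec
  rw [map_smul, map_sub, map_sub, trace_rankOne, LinearMap.trace_id, finrank_euclideanSpace_fin,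
    smul_eq_mul] at htr
  rw [le_div_iff₀ hσ, mul_comm, htr]
  linarith

end dual

end

section
open scoped InnerProductSpace NNReal ENNReal
open InnerProductSpace

/-! ### The spatial profile of the barrier -/

section profile
variable {n : ℕ} {σ : EuclideanSpace ℝ (Fin n) → ℝ} {δ : ℝ} {x p : EuclideanSpace ℝ (Fin n)}

/-- The regularized dual gauge `(δ⁴ + 4 σ*(x)²)^(1/4)`, where `σ*` is the dual energy. -/
noncomputable def dualProfile (σ : EuclideanSpace ℝ (Fin n) → ℝ) (δ : ℝ)
    (x : EuclideanSpace ℝ (Fin n)) : ℝ :=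
  fourthRoot (δ ^ 4 + 4 * dualEnergy σ x ^ 2)

lemma dualProfile_pow (x : EuclideanSpace ℝ (Fin n)) :
    dualProfile σ δ x ^ 4 = δ ^ 4 + 4 * dualEnergy σ x ^ 2 :=
  fourthRoot_pow (by positivity)

lemma le_dualProfile (x : EuclideanSpace ℝ (Fin n)) : δ ≤ dualProfile σ δ x :=
  le_fourthRoot_of_pow_le (by linarith [sq_nonneg (dualEnergy σ x)])

lemma continuous_dualProfile (hc : ConvexOn ℝ univ σ) (h0 : σ 0 = 0) :
    Continuous (dualProfile σ δ) := by
  have := continuous_dualEnergy hc h0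
  exact continuous_fourthRoot.comp (by fun_prop)

lemma dualProfile_zero (hδ : 0 < δ) (hc : ConvexOn ℝ univ σ) (h0 : σ 0 = 0) :
    dualProfile σ δ 0 = δ := by
  have h1 : dualEnergy σ 0 = 0 :=
    le_antisymm (by simpa using dualEnergy_le hc h0 0) (dualEnergy_nonneg hc h0 0)
  have h : dualProfile σ δ 0 ^ 4 = δ ^ 4 := by rw [dualProfile_pow, h1]; ring
  exact (pow_left_inj₀ (hδ.le.trans (le_dualProfile _)) hδ.le (by norm_num)).1 h

lemma norm_le_mul_dualProfile (hc : ConvexOn ℝ univ σ) (hσ : ∀ q, 0 ≤ σ q) {b : ℝ}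
    (hb : ∀ q, σ q ≤ b * ‖q‖) (x : EuclideanSpace ℝ (Fin n)) :
    ‖x‖ ≤ √(b ^ 2 + 1) * dualProfile σ δ x := by
  have hs : 0 < √(b ^ 2 + 1) := by positivity
  have hs2 : √(b ^ 2 + 1) ^ 2 = b ^ 2 + 1 := Real.sq_sqrt (by positivity)
  have h1 := le_dualEnergy_of_le hc hσ hb x
  rw [mul_comm, ← div_le_iff₀ hs]
  refine le_fourthRoot_of_pow_le ?_
  have h2 : (‖x‖ / √(b ^ 2 + 1)) ^ 4 = 4 * (‖x‖ ^ 2 / (2 * (b ^ 2 + 1))) ^ 2 := by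
    rw [← hs2]; field_simp; norm_num
  have h3 : (‖x‖ ^ 2 / (2 * (b ^ 2 + 1))) ^ 2 ≤ dualEnergy σ x ^ 2 :=
    pow_le_pow_left₀ (by positivity) h1 2
  have h4 : 0 ≤ δ ^ 4 := by positivity
  rw [h2]
  linarith

lemma dualProfile_tangent (hδ : 0 < δ) (x y : EuclideanSpace ℝ (Fin n)) : dualProfile σ δ y ≤
    dualProfile σ δ x + (dualEnergy σ y ^ 2 - dualEnergy σ x ^ 2) / dualProfile σ δ x ^ 3 := by
  have h0 : 0 < dualProfile σ δ x := hδ.trans_le (le_dualProfile x)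
  refine (fourthRoot_le_tangent (y := δ ^ 4 + 4 * dualEnergy σ x ^ 2)
    (y' := δ ^ 4 + 4 * dualEnergy σ y ^ 2) (by positivity) (by positivity)).trans (le_of_eq ?_)
  change dualProfile σ δ x + _ / (4 * dualProfile σ δ x ^ 3) = _
  field_simp
  ring

/-- The profile is flat to third order at its centre. -/
lemma hasSuperjet_dualProfile_zero (hδ : 0 < δ) (hc : ConvexOn ℝ univ σ) (h0 : σ 0 = 0) :
    HasSuperjet univ (dualProfile σ δ) 0 0 0 := by
  intro ε hε
  have hsmall : ∀ᶠ ξ in 𝓝 (0 : EuclideanSpace ℝ (Fin n)), ‖ξ‖ ^ 2 / (4 * δ ^ 3) < ε := by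
    have : Continuous fun ξ : EuclideanSpace ℝ (Fin n) => ‖ξ‖ ^ 2 / (4 * δ ^ 3) := by fun_prop
    exact (this.tendsto 0).eventually (gt_mem_nhds (by simpa using hε))
  filter_upwards [hsmall] with ξ hξ _
  have h1 := dualProfile_tangent (σ := σ) hδ 0 ξ
  have h2 : dualEnergy σ 0 = 0 :=
    le_antisymm (by simpa using dualEnergy_le hc h0 0) (dualEnergy_nonneg hc h0 0)
  have h3 : dualEnergy σ ξ ^ 2 ≤ (‖ξ‖ ^ 2 / 2) ^ 2 :=
    pow_le_pow_left₀ (dualEnergy_nonneg hc h0 ξ) (dualEnergy_le hc h0 ξ) 2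
  rw [h2, dualProfile_zero hδ hc h0] at h1
  have h4 : (dualEnergy σ ξ ^ 2 - 0 ^ 2) / δ ^ 3 ≤ ε * ‖ξ‖ ^ 2 := by
    calc (dualEnergy σ ξ ^ 2 - 0 ^ 2) / δ ^ 3 ≤ (‖ξ‖ ^ 2 / 2) ^ 2 / δ ^ 3 := by
          gcongr; linarith
      _ = ‖ξ‖ ^ 2 / (4 * δ ^ 3) * ‖ξ‖ ^ 2 := by field_simp; norm_num
      _ ≤ ε * ‖ξ‖ ^ 2 := by gcongr
  rw [dualProfile_zero hδ hc h0, zero_add]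
  simp
  linarith

/-- The chain rule for superjets of the profile. -/
lemma hasSuperjet_dualProfile (hδ : 0 < δ) (hc : ConvexOn ℝ univ σ) (h0 : σ 0 = 0)
    {B : EuclideanSpace ℝ (Fin n) →L[ℝ] EuclideanSpace ℝ (Fin n)}
    (h : HasSuperjet univ (dualEnergy σ) x p B) :
    HasSuperjet univ (dualProfile σ δ) x
      ((2 * dualEnergy σ x / dualProfile σ δ x ^ 3) • p)
      ((2 * dualEnergy σ x / dualProfile σ δ x ^ 3) • B +
        (2 / dualProfile σ δ x ^ 3) • rankOne ℝ p p) := by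
  intro ε hε
  have hh0 : 0 < dualProfile σ δ x := hδ.trans_le (le_dualProfile x)
  have htan := dualProfile_tangent (σ := σ) hδ x
  have hU := dualEnergy_nonneg hc h0
  set N := dualProfile σ δ x with hN
  set s := dualEnergy σ x with hs
  have hs0 : 0 ≤ s := hU x
  set ε₁ := ε * N ^ 3 / (4 * (s + 1)) with hε₁
  have hε₁0 : 0 < ε₁ := by positivity
  set c := ‖B‖ / 2 + ε₁ with hc'
  have hc0 : 0 < c := by positivity
  have hsmall : ∀ᶠ ξ in 𝓝 (0 : EuclideanSpace ℝ (Fin n)),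
      2 * ‖p‖ * c * ‖ξ‖ + c ^ 2 * ‖ξ‖ ^ 2 < ε * N ^ 3 / 2 := by
    have : Continuous fun ξ : EuclideanSpace ℝ (Fin n) =>
      2 * ‖p‖ * c * ‖ξ‖ + c ^ 2 * ‖ξ‖ ^ 2 := by fun_prop
    exact (this.tendsto 0).eventually (gt_mem_nhds (by simp; positivity))
  filter_upwards [h ε₁ hε₁0, hsmall] with ξ hξ hξ2 hmem
  have h1 := hξ hmem
  set i := ⟪p, ξ⟫_ℝ with hi
  set ρ := 1 / 2 * ⟪B ξ, ξ⟫_ℝ + ε₁ * ‖ξ‖ ^ 2 with hρ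
  have hBξ : |⟪B ξ, ξ⟫_ℝ| ≤ ‖B‖ * ‖ξ‖ ^ 2 := by
    refine (abs_real_inner_le_norm _ _).trans ?_
    calc ‖B ξ‖ * ‖ξ‖ ≤ ‖B‖ * ‖ξ‖ * ‖ξ‖ := by gcongr; exact B.le_opNorm ξ
      _ = _ := by ring
  have hρc : |ρ| ≤ c * ‖ξ‖ ^ 2 := by
    have h2 := abs_le.1 hBξ
    have : 0 ≤ ε₁ * ‖ξ‖ ^ 2 := by positivity
    rw [abs_le, hρ, hc']
    constructor <;> linarith [h2.1, h2.2]
  have hip : |i| ≤ ‖p‖ * ‖ξ‖ := abs_real_inner_le_norm _ _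
  have h2 : dualEnergy σ (x + ξ) ^ 2 ≤ (s + (i + ρ)) ^ 2 :=
    pow_le_pow_left₀ (hU _) (by linarith) 2
  have h3 : i * ρ ≤ ‖p‖ * ‖ξ‖ * (c * ‖ξ‖ ^ 2) := by
    refine (le_abs_self _).trans ?_
    rw [abs_mul]
    gcongr
  have h4 : ρ ^ 2 ≤ (c * ‖ξ‖ ^ 2) ^ 2 := by
    rw [← sq_abs]; gcongr
  have h5 : (2 * ‖p‖ * c * ‖ξ‖ + c ^ 2 * ‖ξ‖ ^ 2) * ‖ξ‖ ^ 2 ≤ ε * N ^ 3 / 2 * ‖ξ‖ ^ 2 := by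
    gcongr
  have h6 : 2 * s * ε₁ * ‖ξ‖ ^ 2 ≤ ε * N ^ 3 / 2 * ‖ξ‖ ^ 2 := by
    gcongr
    rw [hε₁, mul_div_assoc', div_le_iff₀ (by positivity)]
    have : 0 < ε * N ^ 3 := by positivity
    linarith
  have h7 : dualEnergy σ (x + ξ) ^ 2 - s ^ 2 ≤
      2 * s * i + 1 / 2 * (2 * s * ⟪B ξ, ξ⟫_ℝ + 2 * i ^ 2) + ε * N ^ 3 * ‖ξ‖ ^ 2 := by
    have : (s + (i + ρ)) ^ 2 - s ^ 2 = 2 * s * i + 2 * s * ρ + i ^ 2 + 2 * (i * ρ) + ρ ^ 2 := by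
      ring
    have h8 : 2 * s * ρ = s * ⟪B ξ, ξ⟫_ℝ + 2 * s * ε₁ * ‖ξ‖ ^ 2 := by rw [hρ]; ring
    linarith
  refine (htan (x + ξ)).trans ?_
  have h8 : (dualEnergy σ (x + ξ) ^ 2 - s ^ 2) / N ^ 3 ≤
      (2 * s * i + 1 / 2 * (2 * s * ⟪B ξ, ξ⟫_ℝ + 2 * i ^ 2) + ε * N ^ 3 * ‖ξ‖ ^ 2) / N ^ 3 := by
    gcongr
  have h9 : (2 * s * i + 1 / 2 * (2 * s * ⟪B ξ, ξ⟫_ℝ + 2 * i ^ 2) + ε * N ^ 3 * ‖ξ‖ ^ 2) / N ^ 3 =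
      2 * s / N ^ 3 * i + 1 / 2 * (2 * s / N ^ 3 * ⟪B ξ, ξ⟫_ℝ + 2 / N ^ 3 * i ^ 2) +
        ε * ‖ξ‖ ^ 2 := by field_simp
  have h10 : ⟪((2 * s / N ^ 3) • B + (2 / N ^ 3) • rankOne ℝ p p) ξ, ξ⟫_ℝ =
      2 * s / N ^ 3 * ⟪B ξ, ξ⟫_ℝ + 2 / N ^ 3 * i ^ 2 := by
    rw [_root_.add_apply, _root_.smul_apply, _root_.smul_apply, rankOne_apply, inner_add_left,
      inner_smul_left, inner_smul_left, inner_smul_left]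
    simp only [RCLike.conj_to_real, ← hi]
    ring
  rw [h10, inner_smul_left, RCLike.conj_to_real, ← hi]
  linarith

end profile

/-! ### Bounds for the operator on the barrier -/

section barrier
variable {n : ℕ} {σ : EuclideanSpace ℝ (Fin n) → ℝ} {g f : EuclideanSpace ℝ (Fin n) → ℝ → ℝ}
  {T lamMinus lamPlus Lg Lf K G : ℝ}

/-- The growth condition on `g` bounds the operator from below on jets of Wulff shapes. -/
lemma IsAdmissible.neg_le_levelSetOp (h : IsAdmissible σ g f T lamMinus lamPlus Lg Lf K G)
    (hlam : 0 < lamMinus) (hn : 1 ≤ n) {x p : EuclideanSpace ℝ (Fin n)} {t : ℝ} (ht : t ∈ Icc 0 T)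
    (hp : p ≠ 0) {B : EuclideanSpace ℝ (Fin n) →L[ℝ] EuclideanSpace ℝ (Fin n)}
    (hB : LinearMap.trace ℝ (EuclideanSpace ℝ (Fin n)) ((hessian σ p).comp B).toLinearMap ≤
      ((n : ℝ) - 1) / σ p) {a : ℝ} (ha : 0 < a) (β : ℝ) :
    -(G / lamMinus * (a * max 1 (σ p))) ≤
      levelSetOp σ g f (x, t, a • p, a • B + β • rankOne ℝ p p) := by
  have hC := h.smooth.contDiffAt_compl_zero hp
  have hpn : 0 < ‖p‖ := norm_pos_iff.2 hp
  have hσp : lamMinus * ‖p‖ ≤ σ p := (h.bounds p).1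
  have hσ0 : 0 < σ p := (mul_pos hlam hpn).trans_le hσp
  have hs := inv_norm_smul_mem_sphere hp
  have hX : a • B + β • rankOne ℝ p p = a • (B + (β / a) • rankOne ℝ p p) := by
    rw [smul_add, smul_smul, mul_div_cancel₀ _ ha.ne']
  have hcomp : (hessian σ p).comp (B + (β / a) • rankOne ℝ p p) = (hessian σ p).comp B := by
    rw [ContinuousLinearMap.comp_add, ContinuousLinearMap.comp_smul, comp_rankOne,
      hessian_apply_self hC h.homog]
    ext1 ξ
    simp
  rw [hX, levelSetOp_smul h.homog ha]
  simp only [levelSetOp, hcomp]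
  set τ := LinearMap.trace ℝ (EuclideanSpace ℝ (Fin n)) ((hessian σ p).comp B).toLinearMap
  set r := min 1 (σ p) with hr
  have hr0 : 0 < r := lt_min one_pos hσ0
  have hn' : (0 : ℝ) ≤ n - 1 := by
    have : (1 : ℝ) ≤ n := by exact_mod_cast hn
    linarith
  have h1 : ((n : ℝ) - 1) / σ p ≤ ((n : ℝ) - 1) / r := by
    gcongr
    exact min_le_right _ _
  have h2 := (abs_le.1 (h.f_le t ht x)).1
  have h3 : g (‖p‖⁻¹ • p) (-(((n : ℝ) - 1) / r + K)) ≤ g (‖p‖⁻¹ • p) (-τ + f x t) :=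
    h.g_mono _ hs (by linarith)
  have h4 := (h.growth r hr0 (min_le_left _ _) _ hs).2
  have hG : 0 ≤ G := (mul_nonneg hr0.le (abs_nonneg _)).trans h4
  have h5 : -(G / r) ≤ g (‖p‖⁻¹ • p) (-(((n : ℝ) - 1) / r + K)) := by
    rw [← le_div_iff₀' hr0] at h4
    linarith [neg_abs_le (g (‖p‖⁻¹ • p) (-(((n : ℝ) - 1) / r + K)))]
  have h6 : ‖p‖ * (G / r) ≤ G / lamMinus * max 1 (σ p) := by
    have h7 : r * max 1 (σ p) = σ p := by rw [hr, min_mul_max, one_mul]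
    rw [mul_div_assoc', div_mul_eq_mul_div, div_le_div_iff₀ hr0 hlam]
    calc ‖p‖ * G * lamMinus = G * (lamMinus * ‖p‖) := by ring
      _ ≤ G * σ p := by gcongr
      _ = G * max 1 (σ p) * r := by rw [mul_assoc, mul_comm (max _ _), h7]
  calc -(G / lamMinus * (a * max 1 (σ p))) = a * -(G / lamMinus * max 1 (σ p)) := by ring
    _ ≤ a * (‖p‖ * -(G / r)) := by gcongr; linarith
    _ ≤ _ := by gcongr; linarith

/-- Away from its centre the barrier has superjets on which the operator is bounded from below by
a multiple of `δ⁻¹`. -/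
lemma IsAdmissible.exists_hasSuperjet_dualProfile
    (h : IsAdmissible σ g f T lamMinus lamPlus Lg Lf K G) (hlam : 0 < lamMinus) (hn : 1 ≤ n)
    {δ k : ℝ} (hδ : 0 < δ) (hδ1 : δ ≤ 1) (hk : 0 < k) {y : EuclideanSpace ℝ (Fin n)} (hy : y ≠ 0) :
    ∃ (P : EuclideanSpace ℝ (Fin n)) (X : EuclideanSpace ℝ (Fin n) →L[ℝ] EuclideanSpace ℝ (Fin n)),
      HasSuperjet univ (dualProfile σ δ) y P X ∧ P ≠ 0 ∧
      (X : EuclideanSpace ℝ (Fin n) →ₗ[ℝ] EuclideanSpace ℝ (Fin n)).IsSymmetric ∧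
      ∀ x, ∀ t ∈ Icc 0 T, -(G / lamMinus * (k / δ)) ≤ levelSetOp σ g f (x, t, k • P, k • X) := by
  have hσ : ∀ q, 0 ≤ σ q := fun q => (mul_nonneg hlam.le (norm_nonneg q)).trans (h.bounds q).1
  have hb : ∀ q, σ q ≤ lamPlus * ‖q‖ := fun q => (h.bounds q).2
  have h0 : σ 0 = 0 := le_antisymm (by simpa using hb 0) (hσ 0)
  obtain ⟨p, hd⟩ := exists_isDualPoint h.convex h0 y
  have hp := hd.ne_zero hσ hb h.convex hy
  have hC := h.smooth.contDiffAt_compl_zero hp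
  have hpn : 0 < ‖p‖ := norm_pos_iff.2 hp
  have hσ0 : 0 < σ p := (mul_pos hlam hpn).trans_le (h.bounds p).1
  obtain ⟨B, hAB, hBA, hBs, hB0⟩ := exists_inverse_of_coercive (isSymmetric_energyHessian hC)
    (norm_sq_le_inner_energyHessian hC h.convex (hσ p))
  have htr := trace_hessian_comp_inverse_le hC h.homog hp hσ0 hAB hBA hBs hB0
  have hj := hasSuperjet_dualProfile hδ h.convex h0
    (hd.hasSuperjet_dualEnergy h.smooth h.convex hσ h0 hp hAB)
  have hδN := le_dualProfile (σ := σ) (δ := δ) y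
  have hpow := dualProfile_pow (σ := σ) (δ := δ) y
  set N := dualProfile σ δ y with hN
  set s := dualEnergy σ y with hs
  have hN0 : 0 < N := hδ.trans_le hδN
  have hsE : 2 * s = σ p ^ 2 + ‖p‖ ^ 2 := by
    rw [hs, (hd.dualEnergy_eq_primalEnergy h.homog).2, primalEnergy]; ring
  have hs0 : 0 < 2 * s := by rw [hsE]; positivity
  have hsN : 2 * s ≤ N ^ 2 := by
    refine abs_le_of_sq_le_sq' ?_ (by positivity) |>.2
    have : 0 ≤ δ ^ 4 := by positivity
    linarith [show (N ^ 2) ^ 2 = N ^ 4 by ring, show (2 * s) ^ 2 = 4 * s ^ 2 by ring]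
  have hσN : σ p ≤ N := by
    refine abs_le_of_sq_le_sq' ?_ hN0.le |>.2
    linarith [sq_nonneg ‖p‖]
  set a := 2 * s / N ^ 3 with ha
  have ha0 : 0 < a := by positivity
  refine ⟨_, _, hj, smul_ne_zero ha0.ne' hp, ?_, fun x t ht => ?_⟩
  · intro v w
    have h1 : ⟪B v, w⟫_ℝ = ⟪v, B w⟫_ℝ := hBs v w
    simp only [ContinuousLinearMap.coe_coe, _root_.add_apply, _root_.smul_apply, rankOne_apply,
      inner_add_left, inner_add_right, inner_smul_left, inner_smul_right, RCLike.conj_to_real, h1,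
      real_inner_comm p]
    ring
  · rw [smul_smul, smul_add, smul_smul, smul_smul]
    refine le_trans ?_ (h.neg_le_levelSetOp hlam hn ht hp htr (mul_pos hk ha0) _)
    have hs' := inv_norm_smul_mem_sphere hp
    have hG : 0 ≤ G := by
      have := (h.growth 1 one_pos le_rfl _ hs').1
      rw [one_mul] at this
      exact (abs_nonneg _).trans this
    have haN : a ≤ 1 / N := by
      rw [ha, div_le_div_iff₀ (by positivity) hN0]
      calc 2 * s * N ≤ N ^ 2 * N := by gcongr
        _ = 1 * N ^ 3 := by ring
    have key : a * max 1 (σ p) ≤ 1 / δ := by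
      rcases max_choice 1 (σ p) with hm | hm <;> rw [hm]
      · rw [mul_one]
        exact haN.trans (one_div_le_one_div_of_le hδ hδN)
      · calc a * σ p ≤ 1 / N * N := by gcongr
          _ = 1 := by field_simp
          _ ≤ 1 / δ := by rw [le_div_iff₀ hδ]; linarith
    rw [neg_le_neg_iff]
    gcongr
    calc k * a * max 1 (σ p) = k * (a * max 1 (σ p)) := by ring
      _ ≤ k * (1 / δ) := by gcongr
      _ = k / δ := by ring

end barrier

end

section
open scoped InnerProductSpace NNReal ENNReal

/-! ### Regularity in time -/

section holder
variable {n : ℕ} {σ : EuclideanSpace ℝ (Fin n) → ℝ} {g f : EuclideanSpace ℝ (Fin n) → ℝ → ℝ}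
  {T lamMinus lamPlus Lg Lf K G : ℝ}

/-- The space-time operator with spatial block `X` and no other entries. -/
def spatialExt (X : EuclideanSpace ℝ (Fin n) →L[ℝ] EuclideanSpace ℝ (Fin n)) :
    SpaceTime n →L[ℝ] SpaceTime n :=
  (spaceIncl n).comp (X.comp (WithLp.fstL 2 ℝ (EuclideanSpace ℝ (Fin n)) ℝ))

lemma inner_spatialExt (X : EuclideanSpace ℝ (Fin n) →L[ℝ] EuclideanSpace ℝ (Fin n))
    (ζ ζ' : SpaceTime n) : ⟪spatialExt X ζ, ζ'⟫_ℝ = ⟪X ζ.fst, ζ'.fst⟫_ℝ := by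
  rw [real_inner_comm]
  change ⟪ζ', spaceIncl n (X ζ.fst)⟫_ℝ = _
  rw [inner_spaceIncl, real_inner_comm]

lemma isSymmetric_spatialExt {X : EuclideanSpace ℝ (Fin n) →L[ℝ] EuclideanSpace ℝ (Fin n)}
    (hX : (X : EuclideanSpace ℝ (Fin n) →ₗ[ℝ] EuclideanSpace ℝ (Fin n)).IsSymmetric) :
    (spatialExt X : SpaceTime n →ₗ[ℝ] SpaceTime n).IsSymmetric := by
  intro a b
  have h1 : ⟪X a.fst, b.fst⟫_ℝ = ⟪a.fst, X b.fst⟫_ℝ := hX _ _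
  change ⟪spatialExt X a, b⟫_ℝ = ⟪a, spatialExt X b⟫_ℝ
  rw [real_inner_comm (spatialExt X b) a, inner_spatialExt, inner_spatialExt, h1, real_inner_comm]

lemma spatialBlock_spatialExt (X : EuclideanSpace ℝ (Fin n) →L[ℝ] EuclideanSpace ℝ (Fin n)) :
    spatialBlock (spatialExt X) = X := by
  ext1 ξ
  refine ext_inner_right ℝ fun η => ?_
  rw [inner_spatialBlock, inner_spatialExt]
  simp [spaceIncl]

/-- A function touched from above by `k ψ(x) + C t` inherits the superjets of `ψ`. -/
lemma HasSuperjet.spaceTime {S : Set (SpaceTime n)} {w : SpaceTime n → ℝ} {z : SpaceTime n}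
    {ψ : EuclideanSpace ℝ (Fin n) → ℝ} {y P : EuclideanSpace ℝ (Fin n)}
    {X : EuclideanSpace ℝ (Fin n) →L[ℝ] EuclideanSpace ℝ (Fin n)} (hψ : HasSuperjet univ ψ y P X)
    {k C : ℝ} (hk : 0 ≤ k)
    (h : ∀ᶠ ζ in 𝓝 (0 : SpaceTime n), w (z + ζ) ≤ w z + k * (ψ (y + ζ.fst) - ψ y) + C * ζ.snd) :
    HasSuperjet S w z (WithLp.toLp 2 (k • P, C)) (spatialExt (k • X)) := by
  intro ε hε
  have hfst : Tendsto (fun ζ : SpaceTime n => ζ.fst) (𝓝 0) (𝓝 0) :=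
    continuous_fst_spaceTime.tendsto 0
  filter_upwards [h, hfst.eventually (hψ (ε / (k + 1)) (by positivity))] with ζ h1 h2 _
  have h3 := mul_le_mul_of_nonneg_left (h2 (mem_univ _)) hk
  have h4 : k * (ε / (k + 1) * ‖ζ.fst‖ ^ 2) ≤ ε * ‖ζ‖ ^ 2 := by
    have h5 : ‖ζ.fst‖ ^ 2 ≤ ‖ζ‖ ^ 2 := by
      rw [norm_sq_spaceTime]; linarith [sq_nonneg ζ.snd]
    calc k * (ε / (k + 1) * ‖ζ.fst‖ ^ 2) = k / (k + 1) * (ε * ‖ζ.fst‖ ^ 2) := by ring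
      _ ≤ 1 * (ε * ‖ζ‖ ^ 2) := by
        gcongr
        rw [div_le_one (by positivity)]
        linarith
      _ = _ := one_mul _
  have h6 : ⟪(WithLp.toLp 2 (k • P, C) : SpaceTime n), ζ⟫_ℝ = k * ⟪P, ζ.fst⟫_ℝ + C * ζ.snd := by
    simp [inner_smul_left, mul_comm]
  rw [h6, inner_spatialExt, _root_.smul_apply, inner_smul_left, RCLike.conj_to_real]
  linarith

/-- Comparison of a subsolution with the barrier `k (δ⁴ + 4 σ*(x - x₀)²)^(1/4) + C (t - s)`, where
`σ*` is the dual energy, evaluated on the axis `x = x₀`. -/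
lemma IsAdmissible.le_barrier (h : IsAdmissible σ g f T lamMinus lamPlus Lg Lf K G)
    {u : EuclideanSpace ℝ (Fin n) → ℝ → ℝ} (hu : IsViscositySubsolution (levelSetOp σ g f) T u)
    (huc : ContinuousOn (fun z : EuclideanSpace ℝ (Fin n) × ℝ => u z.1 z.2) (univ ×ˢ Icc 0 T))
    {m : ℝ} (hm0 : 0 < m) (hm : ∀ x, ∀ t ∈ Icc 0 T, |u x t| ≤ m) (hlam : 0 < lamMinus) (hn : 1 ≤ n)
    {l k C δ : ℝ} (hl : 0 < l) (hk : k = l * √(lamPlus ^ 2 + 1)) (hδ : 0 < δ) (hδ1 : δ ≤ 1)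
    (hC : G / lamMinus * (k / δ) < C) (hC0 : 0 < C) {s t : ℝ} (hs : 0 ≤ s) (ht : t ∈ Ioo s T)
    {x₀ : EuclideanSpace ℝ (Fin n)} (hlip : ∀ x, u x s ≤ u x₀ s + l * ‖x - x₀‖) :
    u x₀ t ≤ u x₀ s + k * δ + C * (t - s) := by
  by_contra hcon
  push Not at hcon
  have hσ : ∀ q, 0 ≤ σ q := fun q => (mul_nonneg hlam.le (norm_nonneg q)).trans (h.bounds q).1
  have hb : ∀ q, σ q ≤ lamPlus * ‖q‖ := fun q => (h.bounds q).2
  have h0 : σ 0 = 0 := le_antisymm (by simpa using hb 0) (hσ 0)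
  have hk0 : 0 < k := by rw [hk]; positivity
  have hsT : s < T := ht.1.trans ht.2
  have hIcc : ∀ r ∈ Icc s T, r ∈ Icc 0 T := fun r hr => ⟨hs.trans hr.1, hr.2⟩
  have hsI : s ∈ Icc s T := ⟨le_rfl, hsT.le⟩
  set γ := (u x₀ t - u x₀ s - k * δ - C * (t - s)) / 2 with hγ
  have hγ0 : 0 < γ := by rw [hγ]; linarith
  -- the penalty `(2 m + 1) e^{q (r - T)}` keeps maxima away from the final time
  set q := (2 * m + 1) / (γ * (T - t)) with hq
  have hTt : 0 < T - t := by linarith [ht.2]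
  have hq0 : 0 < q := by positivity
  set Φ : ℝ → ℝ := fun r => (2 * m + 1) * Real.exp (q * (r - T)) with hΦ
  have hΦs : ContDiff ℝ 2 Φ := by fun_prop
  have hΦ0 : ∀ r, 0 ≤ Φ r := fun r => by simp only [hΦ]; positivity
  have hΦT : Φ T = 2 * m + 1 := by simp [hΦ]
  have hΦd : ∀ r, 0 ≤ deriv Φ r := fun r => by
    have h1 : HasDerivAt Φ ((2 * m + 1) * (Real.exp (q * (r - T)) * (q * 1))) r :=
      ((((hasDerivAt_id r).sub_const T).const_mul q).exp).const_mul _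
    rw [h1.deriv]
    positivity
  have hΦt : Φ t ≤ γ := by
    have h1 : q * (T - t) ≤ Real.exp (q * (T - t)) := by
      linarith [Real.add_one_le_exp (q * (T - t))]
    have h2 : Real.exp (q * (t - T)) = (Real.exp (q * (T - t)))⁻¹ := by
      rw [← Real.exp_neg]; congr 1; ring
    have h3 : q * (T - t) = (2 * m + 1) / γ := by rw [hq]; field_simp
    rw [h3] at h1
    simp only [hΦ]
    rw [h2, h3, ← div_eq_mul_inv, div_le_iff₀ (Real.exp_pos _)]
    calc 2 * m + 1 = γ * ((2 * m + 1) / γ) := by field_simp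
      _ ≤ _ := by gcongr
  set ψ := dualProfile σ δ with hψ
  have hψc : Continuous ψ := continuous_dualProfile h.convex h0
  have hψl : ∀ y, l * ‖y‖ ≤ k * ψ y := fun y => by
    rw [hk, mul_assoc]
    gcongr
    exact norm_le_mul_dualProfile h.convex hσ hb y
  set Ψ : EuclideanSpace ℝ (Fin n) × ℝ → ℝ := fun z =>
    u z.1 z.2 - Φ z.2 - k * ψ (z.1 - x₀) - C * (z.2 - s) with hΨ
  have hΨc : ContinuousOn Ψ (univ ×ˢ Icc s T) := by
    have h1 : ContinuousOn (fun z : EuclideanSpace ℝ (Fin n) × ℝ => u z.1 z.2) (univ ×ˢ Icc s T) :=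
      huc.mono (prod_mono_right (Icc_subset_Icc_left hs))
    have h2 : Continuous fun z : EuclideanSpace ℝ (Fin n) × ℝ => Φ z.2 :=
      hΦs.continuous.comp continuous_snd
    have h3 : Continuous fun z : EuclideanSpace ℝ (Fin n) × ℝ => k * ψ (z.1 - x₀) := by fun_prop
    have h4 : Continuous fun z : EuclideanSpace ℝ (Fin n) × ℝ => C * (z.2 - s) := by fun_prop
    exact ((h1.sub h2.continuousOn).sub h3.continuousOn).sub h4.continuousOn
  have hstart : u x₀ s < Ψ (x₀, t) := by
    have h1 : ψ (x₀ - x₀) = δ := by rw [sub_self]; exact dualProfile_zero hδ h.convex h0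
    have h2 : u x₀ t - u x₀ s - k * δ - C * (t - s) = 2 * γ := by rw [hγ]; ring
    simp only [hΨ, h1]
    linarith
  have htI : t ∈ Icc s T := Ioo_subset_Icc_self ht
  obtain ⟨⟨x₁, t₁⟩, hz₁, hmaxK⟩ := ((isCompact_closedBall x₀ (2 * m / l)).prod
    (isCompact_Icc (a := s) (b := T))).exists_isMaxOn
      ⟨(x₀, t), Metric.mem_closedBall_self (by positivity), htI⟩
      (hΨc.mono (prod_mono_left (subset_univ _)))
  have ht₁ : t₁ ∈ Icc s T := hz₁.2
  have hge : Ψ (x₀, t) ≤ Ψ (x₁, t₁) :=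
    hmaxK ⟨Metric.mem_closedBall_self (by positivity), htI⟩
  have hmax : ∀ x, ∀ r ∈ Icc s T, Ψ (x, r) ≤ Ψ (x₁, t₁) := by
    intro x r hr
    by_cases hx : x ∈ Metric.closedBall x₀ (2 * m / l)
    · exact hmaxK ⟨hx, hr⟩
    · rw [Metric.mem_closedBall, dist_eq_norm, not_le, div_lt_iff₀' hl] at hx
      have h1 := hψl (x - x₀)
      have h2 := (abs_le.1 (hm x r (hIcc r hr))).2
      have h3 := (abs_le.1 (hm x₀ s (hIcc s hsI))).1
      have h4 := mul_nonneg hC0.le (sub_nonneg.2 hr.1)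
      have h5 := hΦ0 r
      have h6 : Ψ (x, r) ≤ u x₀ s := by simp only [hΨ]; linarith
      linarith
  have hval : u x₀ s < u x₁ t₁ - Φ t₁ - k * ψ (x₁ - x₀) - C * (t₁ - s) := hstart.trans_le hge
  have hψ₁ := hψl (x₁ - x₀)
  have hlip₁ := hlip x₁
  have hnl : 0 ≤ l * ‖x₁ - x₀‖ := by positivity
  have hI : t₁ ∈ Ioo s T := by
    refine ⟨lt_of_le_of_ne ht₁.1 fun hz => ?_, lt_of_le_of_ne ht₁.2 fun hz => ?_⟩
    · rw [← hz] at hval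
      have := hΦ0 s
      linarith
    · rw [hz, hΦT] at hval
      have h2 := (abs_le.1 (hm x₁ T ⟨hs.trans hsT.le, le_rfl⟩)).2
      have h3 := (abs_le.1 (hm x₀ s (hIcc s hsI))).1
      have h4 := mul_nonneg hC0.le (sub_nonneg.2 hsT.le)
      linarith
  set z : SpaceTime n := WithLp.toLp 2 (x₁, t₁) with hz
  have hz0 : z.snd ∈ Ioo 0 T := ⟨hs.trans_lt hI.1, hI.2⟩
  set w : SpaceTime n → ℝ := fun z => u z.fst z.snd - Φ z.snd with hw
  have hev : ∀ᶠ ζ in 𝓝 (0 : SpaceTime n),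
      w (z + ζ) ≤ w z + k * (ψ (x₁ - x₀ + ζ.fst) - ψ (x₁ - x₀)) + C * ζ.snd := by
    have h1 : Tendsto (fun ζ : SpaceTime n => t₁ + ζ.snd) (𝓝 0) (𝓝 t₁) := by
      have : Continuous fun ζ : SpaceTime n => t₁ + ζ.snd :=
        continuous_const.add continuous_snd_spaceTime
      simpa using this.tendsto 0
    filter_upwards [h1.eventually (Icc_mem_nhds hI.1 hI.2)] with ζ hζ
    have h2 := hmax (x₁ + ζ.fst) (t₁ + ζ.snd) hζ
    simp only [hΨ] at h2
    rw [show x₁ + ζ.fst - x₀ = x₁ - x₀ + ζ.fst by abel] at h2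
    change u (x₁ + ζ.fst) (t₁ + ζ.snd) - Φ (t₁ + ζ.snd) ≤ u x₁ t₁ - Φ t₁ + _ + _
    linarith
  have huw : ∀ z ∈ slab n T, u z.fst z.snd = Φ z.snd + (fun _ => (1 : ℝ)) z.snd * w z :=
    fun z _ => by simp only [hw]; ring
  have hd1 : deriv (fun _ : ℝ => (1 : ℝ)) z.snd = 0 := deriv_const _ _
  have hd2 := hΦd z.snd
  by_cases hy : x₁ - x₀ = 0
  · rw [hy] at hev
    have hj := HasSuperjet.spaceTime (S := slab n T) (z := z)
      (hasSuperjet_dualProfile_zero hδ h.convex h0) hk0.le hev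
    have h1 := hu.le_of_hasSuperjet_zero h hΦs contDiff_const (fun _ => one_pos) huw hz0
      (isSymmetric_spatialExt (by intro a b; simp)) hj (smul_zero k)
      (by rw [spatialBlock_spatialExt]; ext1 ξ; simp)
    rw [hd1] at h1
    change _ + _ + 1 * C ≤ 0 at h1
    linarith
  · obtain ⟨P, X, hj, hP, hX, hF⟩ := h.exists_hasSuperjet_dualProfile hlam hn hδ hδ1 hk0 hy
    have hj' := hj.spaceTime (S := slab n T) (z := z) hk0.le hev
    have hkX : ((k • X : EuclideanSpace ℝ (Fin n) →L[ℝ] EuclideanSpace ℝ (Fin n)) :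
        EuclideanSpace ℝ (Fin n) →ₗ[ℝ] EuclideanSpace ℝ (Fin n)).IsSymmetric := fun a b => by
      have : ⟪X a, b⟫_ℝ = ⟪a, X b⟫_ℝ := hX a b
      simp [inner_smul_left, inner_smul_right, this]
    have h1 := hu.le_of_hasSuperjet h hΦs contDiff_const (fun _ => one_pos) huw hz0
      (isSymmetric_spatialExt hkX) hj' (smul_ne_zero hk0.ne' hP)
    rw [hd1, spatialBlock_spatialExt] at h1
    have h2 := hF x₁ t₁ (hIcc t₁ ht₁)
    change _ + _ + 1 * C + 1 * levelSetOp σ g f (x₁, t₁, k • P, k • X) ≤ 0 at h1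
    linarith

/-- The one-sided Hölder estimate, by optimizing the regularization of the barrier. -/
lemma IsAdmissible.sub_le_sqrt (h : IsAdmissible σ g f T lamMinus lamPlus Lg Lf K G)
    {u : EuclideanSpace ℝ (Fin n) → ℝ → ℝ} (hu : IsViscositySubsolution (levelSetOp σ g f) T u)
    (huc : ContinuousOn (fun z : EuclideanSpace ℝ (Fin n) × ℝ => u z.1 z.2) (univ ×ˢ Icc 0 T))
    {m : ℝ} (hm0 : 0 < m) (hm : ∀ x, ∀ t ∈ Icc 0 T, |u x t| ≤ m) (hlam : 0 < lamMinus) (hn : 1 ≤ n)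
    {l k : ℝ} (hl : 0 < l) (hk : k = l * √(lamPlus ^ 2 + 1)) {s t : ℝ} (hs : 0 ≤ s) (hst : s < t)
    (ht : t ≤ T) {x₀ : EuclideanSpace ℝ (Fin n)} (hlip : ∀ x, u x s ≤ u x₀ s + l * ‖x - x₀‖) :
    u x₀ t - u x₀ s ≤ (k + (|G| / lamMinus * k + 1) * (T + 1)) * √(t - s) := by
  have hk0 : 0 < k := by rw [hk]; positivity
  have hT1 : 1 < T + 1 := by linarith
  set δ := √(t - s) / √(T + 1) with hδ
  have hts : 0 < t - s := by linarith
  have hδ0 : 0 < δ := by positivity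
  have hδ1 : δ ≤ 1 := by
    rw [hδ, div_le_one (by positivity)]
    exact Real.sqrt_le_sqrt (by linarith)
  have hδs : δ ≤ √(t - s) := by
    rw [hδ]
    exact div_le_self (Real.sqrt_nonneg _) (Real.one_le_sqrt.2 hT1.le)
  have hδ2 : t - s = δ ^ 2 * (T + 1) := by
    rw [hδ, div_pow, Real.sq_sqrt hts.le, Real.sq_sqrt (by linarith)]
    field_simp
  set c := |G| / lamMinus * k + 1 with hc
  have hc0 : 0 < c := by positivity
  have hC : G / lamMinus * (k / δ) < c / δ := by
    rw [mul_div_assoc', div_lt_div_iff_of_pos_right hδ0, hc]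
    have : G / lamMinus * k ≤ |G| / lamMinus * k := by gcongr; exact le_abs_self G
    linarith
  have hut : ContinuousOn (fun r => u x₀ r) (Icc s T) :=
    huc.comp (f := fun r => (x₀, r)) (by fun_prop) fun r hr => ⟨mem_univ _, hs.trans hr.1, hr.2⟩
  have hcl : closure (Ioo s T) = Icc s T := closure_Ioo (hst.trans_le ht).ne
  have h1 : u x₀ t ≤ u x₀ s + k * δ + c / δ * (t - s) :=
    le_on_closure (s := Ioo s T) (f := fun r => u x₀ r)
      (g := fun r => u x₀ s + k * δ + c / δ * (r - s))
      (fun r hr => h.le_barrier hu huc hm0 hm hlam hn hl hk hδ0 hδ1 hC (by positivity) hs hr hlip)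
      (by rwa [hcl]) (Continuous.continuousOn (by fun_prop)) (by rw [hcl]; exact ⟨hst.le, ht⟩)
  have h2 : c / δ * (t - s) = c * (T + 1) * δ := by rw [hδ2]; field_simp
  calc u x₀ t - u x₀ s ≤ (k + c * (T + 1)) * δ := by linarith
    _ ≤ _ := by gcongr

end holder

end

theorem theoremH (L M T G lamPlus lamMinus : ℝ) (hT : 0 < T)
    (hlamMinus : 0 < lamMinus) (hlamPlus : 0 < lamPlus) :
    ∃ A : ℝ, ∀ (n : ℕ), 1 ≤ n →
      ∀ (σ : EuclideanSpace ℝ (Fin n) → ℝ) (g f u : EuclideanSpace ℝ (Fin n) → ℝ → ℝ)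
        (Lg Lf K : ℝ),
      -- the anisotropy
      ContDiffOn ℝ 2 σ {0}ᶜ →
      ConvexOn ℝ univ σ →
      (∀ (a : ℝ) (x : EuclideanSpace ℝ (Fin n)), 0 < a → σ (a • x) = a * σ x) →
      (∀ x : EuclideanSpace ℝ (Fin n), lamMinus * ‖x‖ ≤ σ x ∧ σ x ≤ lamPlus * ‖x‖) →
      -- the function `g` on (unit sphere) × ℝ
      ContinuousOn (fun z : EuclideanSpace ℝ (Fin n) × ℝ => g z.1 z.2)
        (Metric.sphere 0 1 ×ˢ univ) →
      (∀ p ∈ Metric.sphere (0 : EuclideanSpace ℝ (Fin n)) 1, ∀ ξ η : ℝ,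
        |g p ξ - g p η| ≤ Lg * |ξ - η|) →
      (∀ p ∈ Metric.sphere (0 : EuclideanSpace ℝ (Fin n)) 1, Monotone (g p)) →
      -- the driving force, with `K = sup |f|`
      ContinuousOn (fun z : EuclideanSpace ℝ (Fin n) × ℝ => f z.1 z.2) (univ ×ˢ Icc 0 T) →
      (∀ t ∈ Icc 0 T, ∀ x y : EuclideanSpace ℝ (Fin n), |f x t - f y t| ≤ Lf * ‖x - y‖) →
      IsLUB ((fun z : EuclideanSpace ℝ (Fin n) × ℝ => |f z.1 z.2|) '' (univ ×ˢ Icc 0 T)) K →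
      -- the growth bound
      (∀ r : ℝ, 0 < r → r ≤ 1 → ∀ p ∈ Metric.sphere (0 : EuclideanSpace ℝ (Fin n)) 1,
        r * |g p (((n : ℝ) - 1) / r + K)| ≤ G ∧ r * |g p (-(((n : ℝ) - 1) / r + K))| ≤ G) →
      Lg * Lf = M →
      -- the solution
      ContinuousOn (fun z : EuclideanSpace ℝ (Fin n) × ℝ => u z.1 z.2) (univ ×ˢ Icc 0 T) →
      IsViscositySolution (levelSetOp σ g f) T u →
      (∃ R c : ℝ, ∀ x : EuclideanSpace ℝ (Fin n), R < ‖x‖ → ∀ t ∈ Icc 0 T, u x t = c) →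
      (∀ x y : EuclideanSpace ℝ (Fin n), |u x 0 - u y 0| ≤ L * ‖x - y‖) →
      ∀ x : EuclideanSpace ℝ (Fin n), ∀ t ∈ Icc 0 T, ∀ s ∈ Icc 0 T,
        |u x t - u x s| ≤ A * |t - s| ^ (1 / 2 : ℝ) := by
  set l := (|L| + 1) * Real.exp ((|M| + 1) * T) with hl
  set k := l * √(lamPlus ^ 2 + 1) with hk
  have hl0 : 0 < l := by positivity
  refine ⟨k + (|G| / lamMinus * k + 1) * (T + 1), ?_⟩
  intro n hn σ g f u Lg Lf K hσs hσc hσh hσb hgc hgl hgm hfc hfl hK hG hM huc hu ⟨R, c, hR⟩ hL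
  have h : IsAdmissible σ g f T lamMinus lamPlus Lg Lf K G :=
    ⟨hσs, hσc, hσh, hσb, hgc, hgl, hgm, hfc, hfl,
      fun t ht x => hK.1 ⟨(x, t), ⟨mem_univ _, ht⟩, rfl⟩, hG⟩
  have hspace : ∀ t ∈ Icc 0 T, ∀ x y, |u x t - u y t| ≤ l * ‖x - y‖ := fun t ht x y =>
    h.spatial_lipschitz hu hT (by rw [hM]; linarith [le_abs_self M]) (by positivity)
      (by linarith [abs_nonneg L]) huc hR
      (fun x y => (hL x y).trans (by gcongr; linarith [le_abs_self L])) ht x y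
  obtain ⟨m, hm0, hm⟩ := exists_abs_le_of_eq_zero_outside (w := fun x t => u x t - c)
    (huc.sub continuousOn_const) (R := R) fun x hx t ht => by simp [hR x hx t ht]
  have hum : ∀ x, ∀ t ∈ Icc 0 T, |u x t| ≤ m + |c| := fun x t ht => by
    have h1 := abs_add_le (u x t - c) c
    rw [sub_add_cancel] at h1
    linarith [hm x t ht]
  have hm0' : 0 < m + |c| := by positivity
  -- the estimate from below is the estimate from above for `-u`
  have key : ∀ x, ∀ t ∈ Icc 0 T, ∀ s ∈ Icc 0 T, s < t →
      |u x t - u x s| ≤ (k + (|G| / lamMinus * k + 1) * (T + 1)) * √(t - s) := by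
    intro x t ht s hs hst
    have h1 := h.sub_le_sqrt hu.1 huc hm0' hum hlamMinus hn hl0 hk hs.1 hst ht.2 (x₀ := x)
      fun y => by linarith [(abs_le.1 (hspace s hs y x)).2]
    have h2 := h.reflect.sub_le_sqrt hu.2.neg huc.neg hm0' (fun x t ht => by
      rw [abs_neg]; exact hum x t ht) hlamMinus hn hl0 hk hs.1 hst ht.2 (x₀ := x)
      fun y => by linarith [(abs_le.1 (hspace s hs y x)).1]
    rw [abs_le]
    constructor <;> linarith
  intro x t ht s hs
  rw [← Real.sqrt_eq_rpow]
  rcases lt_trichotomy s t with hst | hst | hst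
  · rw [abs_of_pos (sub_pos.2 hst)]
    exact key x t ht s hs hst
  · simp [hst]
  · rw [abs_sub_comm, abs_sub_comm t, abs_of_pos (sub_pos.2 hst)]
    exact key x s hs t ht hst
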